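/- **Notation.** Fix integers $N,n\ge 1$, $\lambda=(\lambda_1,\dots,\lambda_N)\in\mathbb Z_{\ge0}^N$ with $\sum_k\lambda_k=n$, and $\kappa\in\mathbb C^\times$. Put $\lambda^{(j)}=\lambda_1+\dots+\lambda_j$. The variables are $t=(t^{(j)}_a)$ $(1\le j\le N-1,\ 1\le a\le\lambda^{(j)})$, $z=(z_1,\dots,z_n)$, $h$ and $q=(q_1,\dots,q_N)$; put $t^{(N)}_a=z_a$, and let $t^{(0)}$ be empty. Let $\mathcal I_\lambda$ be the set of partitions $I=(I_1,\dots,I_N)$ of $\{1,\dots,n\}$ into disjoint subsets with $|I_k|=\lambda_k$. Let $\mathrm{Sym}$ denote the (unnormalized) symmetrization of a function of $t$ over $S_{\lambda^{(1)}}\times\dots\times S_{\lambda^{(N-1)}}$, where the $j$-th factor permutes $t^{(j)}_1,\dots,t^{(j)}_{\lambda^{(j)}}$. *Weight functions.* For a partition $I=(I_1,\dots,I_N)$ of $\{1,\dots,n\}$ of any type, put $m_j=|I_1\cup\dots\cup I_j|$, write $I_1\cup\dots\cup I_j=\{i^{(j)}_1<\dots<i^{(j)}_{m_j}\}$ and set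 $$U_I(t;z)=\prod_{j=1}^{N-1}\prod_{a=1}^{m_j}\Bigl(\prod_{c:\,i^{(j+1)}_c<i^{(j)}_a}(t^{(j)}_a-t^{(j+1)}_c)\prod_{d:\,i^{(j+1)}_d>i^{(j)}_a}(t^{(j)}_a-t^{(j+1)}_d-h)\prod_{b=a+1}^{m_j}\frac{t^{(j)}_b-t^{(j)}_a-h}{t^{(j)}_b-t^{(j)}_a}\Bigr).$$ For $I\in\mathcal I_\lambda$ put $W_I=\mathrm{Sym}\,U_I$. Let $v_1,\dots,v_N$ be the standard basis of $\mathbb C^N$, let $v_I=v_{i_1}\otimes\dots\otimes v_{i_n}\in(\mathbb C^N)^{\otimes n}$ with $i_a=k$ for $a\in I_k$, and put $W_\lambda(t;z)=\sum_{I\in\mathcal I_\lambda}W_I(t;z)\,v_I$. *Dynamical Hamiltonians.* With $e_{k,l}v_l=v_k$ the matrix units, $e^{(a)}_{k,l}$ their action on the $a$-th tensor factor and $e_{k,l}=\sum_a e^{(a)}_{k,l}$ the total action, $$X_i(z;h;q)=\sum_{a=1}^n z_ae^{(a)}_{i,i}-h\Bigl(\frac{e_{i,i}(1-e_{i,i})}2+\sum_{1\le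 a<b\le n}\sum_{k=1}^N e^{(a)}_{i,k}e^{(b)}_{k,i}+\sum_{j\ne i}\frac{q_j}{q_i-q_j}(e_{i,j}e_{j,i}-e_{i,i})\Bigr).$$ *Master function.* With $\varphi(x)=\Gamma(x/\kappa)\,\Gamma((h-x)/\kappa)$, $$\Phi_\lambda(t;z;h;q)=(e^{\pi\sqrt{-1}(n-\lambda_N)}q_N)^{\sum_a z_a/\kappa}\prod_{i=1}^{N-1}\Bigl(e^{\pi\sqrt{-1}(\lambda_{i+1}-\lambda_i)}\frac{q_i}{q_{i+1}}\Bigr)^{\sum_j t^{(i)}_j/\kappa}\prod_{i=1}^{N-1}\prod_{a=1}^{\lambda^{(i)}}\Bigl(\prod_{b\ne a}\frac1{(t^{(i)}_a-t^{(i)}_b-h)\varphi(t^{(i)}_a-t^{(i)}_b)}\prod_{c=1}^{\lambda^{(i+1)}}\varphi(t^{(i)}_a-t^{(i+1)}_c)\Bigr),$$ and $\Omega_\lambda(q)=\prod_{i<j}(1-q_j/q_i)^{h\lambda_i/\kappa}$. *Discrete differentials.* A discrete differential is a finite sum of rational functions of the form $\frac{\Phi_\lambda(t+w;z;h;q)}{\Phi_\lambda(t;z;h;q)}f(t+w;z;h;q)-f(t;z;h;q)$,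 where $f$ is a rational function of $t,z,h,q$ and $w$ is a vector in $\kappa\mathbb Z^{\lambda^{(1)}+\dots+\lambda^{(N-1)}}$. For $1\le\alpha<\beta\le N$ with $\lambda_\alpha\ge1$, write $s_i=t^{(i)}_{\lambda^{(i)}}$, and for a partition $J$ with $|J_\alpha|=\lambda_\alpha-1$, $|J_\beta|=\lambda_\beta+1$ and $|J_k|=\lambda_k$ for $k\ne\alpha,\beta$ set $$d_{\{\alpha,\beta\}}U_J=\mathrm{Sym}\Bigl[\frac{U_J}{q_\alpha-q_\beta}\bigl(q_\beta A-q_\alpha B\bigr)\Bigr],$$ $$A=(s_{\alpha-1}-s_\alpha)\prod_{i=\alpha}^{\beta-1}\prod_{a=1}^{\lambda^{(i-1)}-1}(t^{(i-1)}_a-s_i)\,(s_{\beta-1}-s_\beta-h)\prod_{i=\alpha}^{\beta-1}\prod_{a=1}^{\lambda^{(i+1)}-1}(s_i-t^{(i+1)}_a-h)\prod_{i=\alpha}^{\beta-1}\prod_{a=1}^{\lambda^{(i)}-1}\frac{t^{(i)}_a-s_i-h}{t^{(i)}_a-s_i},$$ $$B=(s_{\alpha-1}-s_\alpha-h)\prod_{i=\alpha}^{\beta-1}\prod_{a=1}^{\lambda^{(i-1)}-1}(t^{(i-1)}_a-s_i-h)\,(s_{\beta-1}-s_\beta)\prod_{i=\alpha}^{\beta-1}\prod_{a=1}^{\lambda^{(i+1)}-1}(s_i-t^{(i+1)}_a)\prod_{i=\alpha}^{\beta-1}\prod_{a=1}^{\lambda^{(i)}-1}\frac{s_i-t^{(i)}_a-h}{s_i-t^{(i)}_a},$$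 where the factor containing $s_{\alpha-1}$ is omitted if $\lambda^{(\alpha-1)}=0$. For $p\in\{1,\dots,n\}$ let $I(p\to k)$ be the partition obtained from $I$ by moving $p$ to $I_k$. For $I\in\mathcal I_\lambda$ and $1\le i\le N$ put $$D_{I,i}=\sum_{j=1}^{i-1}\sum_{p\in I_j}d_{\{j,i\}}U_{I(p\to i)}-\sum_{j=i+1}^{N}\sum_{p\in I_i}d_{\{i,j\}}U_{I(p\to j)}.$$ **Theorem.** For every $i=1,\dots,N$, $$\Bigl(\kappa q_i\frac{\partial}{\partial q_i}-X_i(z;h;q)\Bigr)\,\Omega_\lambda(q)\,\Phi_\lambda(t;z;h;q)\,W_\lambda(t;z)=\Omega_\lambda(q)\,\Phi_\lambda(t;z;h;q)\sum_{I\in\mathcal I_\lambda}D_{I,i}(t;z;h;q)\,v_I,$$ for arbitrary local holomorphic branches of the powers in $q$ (where the $q_k$ are nonzero and pairwise distinct) and for all $t$ with $t^{(j)}_a\ne t^{(j)}_b$ whenever $a\ne b$. Moreover, each $D_{I,i}$, $I\in\mathcal I_\lambda$, is a discrete differential. -/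

import Mathlib

/-!
 Conventions. The set of colours `{1, …, N}` is `Fin N` and the set of positions `{1, …, n}` is
 `Fin n`, both numbered from `0`. Levels keep their usual numbers `1, …, N`: the level-`j`
 variables `t^{(j)}_1, …, t^{(j)}_{λ^{(j)}}` (`1 ≤ j ≤ N - 1`) are the values
 `t j 0, …, t j (λ^{(j)} - 1)` of a function `t : ℕ → ℕ → ℂ`; no definition below depends on
 the other values of `t`. So colour `i : Fin N` has level `i + 1`, and the level just below it is
 level `i`. A partition `I = (I_1, …, I_N)` of the positions is its colouring
 `I : Fin n → Fin N`, where `I_k` is the fibre of `I` over `k`.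
-/

namespace DynConn

open scoped BigOperators TensorProduct

noncomputable section

/-! ### Partitions and variables -/

/-- The partial sum `λ^{(j)} = λ_1 + … + λ_j`. -/
def lev {N : ℕ} (lam : Fin N → ℕ) (j : ℕ) : ℕ :=
  ∑ k ∈ Finset.univ.filter (fun k : Fin N => k.val < j), lam k

/-- The set of partitions `I` with `|I_k| = λ_k` for all `k`. -/
def parts {N : ℕ} (n : ℕ) (lam : Fin N → ℕ) : Finset (Fin n → Fin N) :=
  Finset.univ.filter
    (fun I => ∀ k, (Finset.univ.filter (fun m => I m = k)).card = lam k)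

/-- All variables together: `t^{(j)}_a` at level `j < N`, and `t^{(N)}_a = z_a`. -/
def allVars (N : ℕ) {n : ℕ} (t : ℕ → ℕ → ℂ) (z : Fin n → ℂ) (j a : ℕ) : ℂ :=
  if j < N then t j a else if ha : a < n then z ⟨a, ha⟩ else 0

/-! ### Weight functions -/

/-- The union `I_1 ∪ … ∪ I_j`. -/
def unionTo {N n : ℕ} (I : Fin n → Fin N) (j : ℕ) : Finset (Fin n) :=
  Finset.univ.filter (fun m => (I m).val < j)

/-- The increasing enumeration `i^{(j)}_1 < i^{(j)}_2 < …` of `I_1 ∪ … ∪ I_j`. -/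
def pos {N n : ℕ} (I : Fin n → Fin N) (j : ℕ) (a : Fin (unionTo I j).card) : Fin n :=
  (unionTo I j).orderEmbOfFin rfl a

/-- The function `U_I(t; z)`. -/
def U {N n : ℕ} (I : Fin n → Fin N) (t : ℕ → ℕ → ℂ) (z : Fin n → ℂ) (h : ℂ) : ℂ :=
  ∏ j ∈ Finset.Icc 1 (N - 1), ∏ a : Fin (unionTo I j).card,
    ((∏ c ∈ Finset.univ.filter
          (fun c : Fin (unionTo I (j + 1)).card => pos I (j + 1) c < pos I j a),
        (allVars N t z j a - allVars N t z (j + 1) c)) *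
      (∏ d ∈ Finset.univ.filter
          (fun d : Fin (unionTo I (j + 1)).card => pos I j a < pos I (j + 1) d),
        (allVars N t z j a - allVars N t z (j + 1) d - h)) *
      ∏ b ∈ Finset.univ.filter (fun b : Fin (unionTo I j).card => a < b),
        (t j b - t j a - h) / (t j b - t j a))

/-- Elements of `S_{λ^{(1)}} × … × S_{λ^{(N-1)}}`. -/
abbrev PermGroup {N : ℕ} (lam : Fin N → ℕ) : Type :=
  ∀ j : Fin (N - 1), Equiv.Perm (Fin (lev lam (j.val + 1)))

/-- Permutation of the variables in every group: `t^{(j)}_a ↦ t^{(j)}_{σ_j(a)}`. -/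
def permute {N : ℕ} (lam : Fin N → ℕ) (s : PermGroup lam) (t : ℕ → ℕ → ℂ) : ℕ → ℕ → ℂ
  | 0, a => t 0 a
  | j + 1, a =>
    if hj : j < N - 1 then
      if ha : a < lev lam (j + 1) then t (j + 1) (s ⟨j, hj⟩ ⟨a, ha⟩) else t (j + 1) a
    else t (j + 1) a

/-- `Sym_{t^{(1)}} … Sym_{t^{(N-1)}} f`: the (not normalized) symmetrization in every group. -/
def sym {N : ℕ} (lam : Fin N → ℕ) (f : (ℕ → ℕ → ℂ) → ℂ) (t : ℕ → ℕ → ℂ) : ℂ :=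
  ∑ s : PermGroup lam, f (permute lam s t)

/-- The weight function `W_I(t; z)`, for a partition `I` of type `λ`. -/
def W {N n : ℕ} (lam : Fin N → ℕ) (I : Fin n → Fin N) (t : ℕ → ℕ → ℂ) (z : Fin n → ℂ)
    (h : ℂ) : ℂ :=
  sym lam (fun t' => U I t' z h) t

/-! ### The tensor power of the vector representation and the dynamical Hamiltonians -/

/-- The space `(ℂ^N)^{⊗ n}`. -/
abbrev TensorSpace (N n : ℕ) : Type := ⨂[ℂ] _ : Fin n, (Fin N → ℂ)

/-- The basis vector `v_I = v_{i_1} ⊗ … ⊗ v_{i_n}`. -/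
def basisVec {N n : ℕ} (I : Fin n → Fin N) : TensorSpace N n :=
  PiTensorProduct.tprod ℂ (fun m => (Pi.single (I m) 1 : Fin N → ℂ))

/-- The operator `e_{k,l}^{(a)}`: the matrix unit `e_{k,l}` (with `e_{k,l} v_l = v_k`) acting on
the `a`-th tensor factor. -/
def eAt {N n : ℕ} (a : Fin n) (k l : Fin N) : Module.End ℂ (TensorSpace N n) :=
  PiTensorProduct.map
    (Function.update (fun _ : Fin n => (LinearMap.id : (Fin N → ℂ) →ₗ[ℂ] (Fin N → ℂ))) a
      (Matrix.toLin' (Matrix.single k l (1 : ℂ))))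

/-- The operator `e_{k,l} = ∑_a e_{k,l}^{(a)}`. -/
def eTot {N n : ℕ} (k l : Fin N) : Module.End ℂ (TensorSpace N n) :=
  ∑ a : Fin n, eAt a k l

/-- The dynamical Hamiltonian `X_i(z; h; q)`. -/
def X {N n : ℕ} (i : Fin N) (z : Fin n → ℂ) (h : ℂ) (q : Fin N → ℂ) :
    Module.End ℂ (TensorSpace N n) :=
  ∑ a : Fin n, z a • eAt a i i -
    h • ((1 / 2 : ℂ) • (eTot i i * (1 - eTot i i)) +
      ∑ a : Fin n, ∑ b ∈ Finset.univ.filter (fun b : Fin n => a < b), ∑ k : Fin N,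
        eAt a i k * eAt b k i +
      ∑ j ∈ Finset.univ.filter (fun j : Fin N => j ≠ i),
        (q j / (q i - q j)) • (eTot i j * eTot j i - eTot i i))

/-- `G` is the partial derivative `∂F/∂q_i` at `q` of the function `F` with values in a
finite-dimensional complex vector space (all coordinates of `F` have this derivative). -/
def HasPartialDeriv {N : ℕ} {V : Type*} [AddCommGroup V] [Module ℂ V] (i : Fin N)
    (F : (Fin N → ℂ) → V) (G : V) (q : Fin N → ℂ) : Prop :=
  ∀ f : Module.Dual ℂ V, HasDerivAt (fun u : ℂ => f (F (Function.update q i u))) (f G) (q i)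

/-- `W_λ(t; z) = ∑_I W_I(t; z) v_I`. -/
def Wvec {N : ℕ} (n : ℕ) (lam : Fin N → ℕ) (t : ℕ → ℕ → ℂ) (z : Fin n → ℂ) (h : ℂ) :
    TensorSpace N n :=
  ∑ I ∈ parts n lam, W lam I t z h • basisVec I

/-! ### Multivalued powers, master function and the factor `Ω` -/

/-- `ℓ` is a holomorphic branch of `log f` on `O`. -/
def IsLogBranch {N : ℕ} (O : Set (Fin N → ℂ)) (f ℓ : (Fin N → ℂ) → ℂ) : Prop :=
  DifferentiableOn ℂ ℓ O ∧ ∀ q ∈ O, Complex.exp (ℓ q) = f q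

/-- The bases of the powers in the master function: `e^{π√-1 (λ_{i+1} - λ_i)} q_i / q_{i+1}` for
`i = 1, …, N - 1`, and `e^{π√-1 (n - λ_N)} q_N` for `i = N`. -/
def powBase {N : ℕ} (n : ℕ) (lam : Fin N → ℕ) (i : Fin N) (q : Fin N → ℂ) : ℂ :=
  if hi : i.val + 1 < N then
    Complex.exp (Real.pi * Complex.I * ((lam ⟨i.val + 1, hi⟩ : ℂ) - (lam i : ℂ))) *
      (q i / q ⟨i.val + 1, hi⟩)
  else Complex.exp (Real.pi * Complex.I * ((n : ℂ) - (lam i : ℂ))) * q i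

/-- `φ(x) = Γ(x/κ) Γ((h - x)/κ)`. -/
def phi (κ h x : ℂ) : ℂ := Complex.Gamma (x / κ) * Complex.Gamma ((h - x) / κ)

/-- The master function `Φ_λ(t; z; h; q)`, where `ℓ i` is the chosen value of the logarithm of
`powBase n lam i q`. The factor `i` of the first product has exponent
`∑_{a ≤ λ^{(i)}} t^{(i)}_a / κ`, where `t^{(N)} = z`. -/
def Phi {N n : ℕ} (lam : Fin N → ℕ) (κ : ℂ) (t : ℕ → ℕ → ℂ) (z : Fin n → ℂ) (h : ℂ)
    (ℓ : Fin N → ℂ) : ℂ :=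
  (∏ i : Fin N, Complex.exp (ℓ i *
      ((∑ a ∈ Finset.range (lev lam (i.val + 1)), allVars N t z (i.val + 1) a) / κ))) *
    ∏ j ∈ Finset.Icc 1 (N - 1), ∏ a ∈ Finset.range (lev lam j),
      ((∏ b ∈ (Finset.range (lev lam j)).erase a,
          1 / ((t j a - t j b - h) * phi κ h (t j a - t j b))) *
        ∏ c ∈ Finset.range (lev lam (j + 1)), phi κ h (t j a - allVars N t z (j + 1) c))

/-- `Ω_λ(q) = ∏_{i < j} (1 - q_j/q_i)^{h λ_i/κ}`, where `m i j` is the chosen value of the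
logarithm of `1 - q_j/q_i`. -/
def Omega {N : ℕ} (lam : Fin N → ℕ) (κ h : ℂ) (m : Fin N → Fin N → ℂ) : ℂ :=
  ∏ i : Fin N, ∏ j ∈ Finset.univ.filter (fun j : Fin N => i < j),
    Complex.exp (m i j * (h * (lam i : ℂ) / κ))

/-! ### Discrete differentials -/

/-- The variables `t, z, q, h` of the rational functions. -/
abbrev RatVar (N n : ℕ) (lam : Fin N → ℕ) : Type :=
  (Σ j : Fin (N - 1), Fin (lev lam (j.val + 1))) ⊕ Fin n ⊕ Fin N ⊕ Unit

/-- The point `(t; z; h; q)` as a valuation of the variables of rational functions. -/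
def ratPoint {N n : ℕ} (lam : Fin N → ℕ) (t : ℕ → ℕ → ℂ) (z : Fin n → ℂ) (h : ℂ)
    (q : Fin N → ℂ) : RatVar N n lam → ℂ :=
  Sum.elim (fun p => t (p.1.val + 1) p.2.val) (Sum.elim z (Sum.elim q (fun _ => h)))

/-- The shift `t ↦ t + κ w` by an integer vector `w`. -/
def shift (κ : ℂ) (w : ℕ → ℕ → ℤ) (t : ℕ → ℕ → ℂ) : ℕ → ℕ → ℂ :=
  fun j a => t j a + κ * (w j a : ℂ)

/-- `x` lies in the lattice `κ ℤ`. -/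
def InLattice (κ x : ℂ) : Prop := ∃ k : ℤ, x = κ * k

/-- The point `(t; z; h; q)` is off the hyperplanes where some shift of the master function, or of
its inverse, is singular, or where two of the `q_k` coincide or one of them vanishes. -/
def Generic {N n : ℕ} (lam : Fin N → ℕ) (κ : ℂ) (t : ℕ → ℕ → ℂ) (z : Fin n → ℂ) (h : ℂ)
    (q : Fin N → ℂ) : Prop :=
  (∀ j ∈ Finset.Icc 1 (N - 1), ∀ a < lev lam j, ∀ b < lev lam j, a ≠ b →
    ¬ InLattice κ (t j a - t j b) ∧ ¬ InLattice κ (t j a - t j b - h)) ∧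
  (∀ j ∈ Finset.Icc 1 (N - 1), ∀ a < lev lam j, ∀ c < lev lam (j + 1),
    ¬ InLattice κ (t j a - allVars N t z (j + 1) c) ∧
      ¬ InLattice κ (t j a - allVars N t z (j + 1) c - h)) ∧
  (∀ k, q k ≠ 0) ∧ Function.Injective q

/-- The function `D(t; z; h; q)` is a discrete differential: a finite sum of functions
`Φ_λ(t + κ w; z; h; q) / Φ_λ(t; z; h; q) · f(t + κ w; z; h; q) - f(t; z; h; q)`, where `w` is an
integer vector and `f = P / Q` is a rational function of `t, z, h, q`. The equality is one of
rational functions, so it is required at generic points where the fractions are defined. -/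
def IsDiscreteDifferential {N n : ℕ} (lam : Fin N → ℕ) (κ : ℂ)
    (D : (ℕ → ℕ → ℂ) → (Fin n → ℂ) → ℂ → (Fin N → ℂ) → ℂ) : Prop :=
  ∃ (r : ℕ) (w : Fin r → ℕ → ℕ → ℤ) (P Q : Fin r → MvPolynomial (RatVar N n lam) ℂ),
    (∀ s, Q s ≠ 0) ∧
    ∀ (t : ℕ → ℕ → ℂ) (z : Fin n → ℂ) (h : ℂ) (q : Fin N → ℂ), Generic lam κ t z h q →
      (∀ s, MvPolynomial.eval (ratPoint lam t z h q) (Q s) ≠ 0 ∧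
        MvPolynomial.eval (ratPoint lam (shift κ (w s) t) z h q) (Q s) ≠ 0) →
      ∀ ℓ : Fin N → ℂ, (∀ i, Complex.exp (ℓ i) = powBase n lam i q) →
        D t z h q = ∑ s : Fin r,
          (Phi lam κ (shift κ (w s) t) z h ℓ / Phi lam κ t z h ℓ *
              (MvPolynomial.eval (ratPoint lam (shift κ (w s) t) z h q) (P s) /
                MvPolynomial.eval (ratPoint lam (shift κ (w s) t) z h q) (Q s)) -
            MvPolynomial.eval (ratPoint lam t z h q) (P s) /
              MvPolynomial.eval (ratPoint lam t z h q) (Q s))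

/-- The last variable `t^{(j)}_{λ^{(j)}}` of level `j`. -/
def lastVar {N n : ℕ} (lam : Fin N → ℕ) (t : ℕ → ℕ → ℂ) (z : Fin n → ℂ) (j : ℕ) : ℂ :=
  allVars N t z j (lev lam j - 1)

/-- The first of the two products in the special discrete differential for colours `α < β`. The
factor with the last variable of the level below colour `α` is absent if there are no such
variables. -/
def prodA {N n : ℕ} (lam : Fin N → ℕ) (α β : Fin N) (t : ℕ → ℕ → ℂ) (z : Fin n → ℂ)
    (h : ℂ) : ℂ :=
  (if lev lam α.val = 0 then 1 else lastVar lam t z α.val - lastVar lam t z (α.val + 1)) *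
  (∏ i ∈ Finset.Icc (α.val + 1) β.val, ∏ a ∈ Finset.range (lev lam (i - 1) - 1),
    (allVars N t z (i - 1) a - lastVar lam t z i)) *
  (lastVar lam t z β.val - lastVar lam t z (β.val + 1) - h) *
  (∏ i ∈ Finset.Icc (α.val + 1) β.val, ∏ a ∈ Finset.range (lev lam (i + 1) - 1),
    (lastVar lam t z i - allVars N t z (i + 1) a - h)) *
  ∏ i ∈ Finset.Icc (α.val + 1) β.val, ∏ a ∈ Finset.range (lev lam i - 1),
    (allVars N t z i a - lastVar lam t z i - h) / (allVars N t z i a - lastVar lam t z i)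

/-- The second of the two products in the special discrete differential for colours `α < β`. -/
def prodB {N n : ℕ} (lam : Fin N → ℕ) (α β : Fin N) (t : ℕ → ℕ → ℂ) (z : Fin n → ℂ)
    (h : ℂ) : ℂ :=
  (if lev lam α.val = 0 then 1 else lastVar lam t z α.val - lastVar lam t z (α.val + 1) - h) *
  (∏ i ∈ Finset.Icc (α.val + 1) β.val, ∏ a ∈ Finset.range (lev lam (i - 1) - 1),
    (allVars N t z (i - 1) a - lastVar lam t z i - h)) *
  (lastVar lam t z β.val - lastVar lam t z (β.val + 1)) *
  (∏ i ∈ Finset.Icc (α.val + 1) β.val, ∏ a ∈ Finset.range (lev lam (i + 1) - 1),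
    (lastVar lam t z i - allVars N t z (i + 1) a)) *
  ∏ i ∈ Finset.Icc (α.val + 1) β.val, ∏ a ∈ Finset.range (lev lam i - 1),
    (lastVar lam t z i - allVars N t z i a - h) / (lastVar lam t z i - allVars N t z i a)

/-- The symmetrized special discrete differential `d_{α,β} U_J`. The partition `J` has one element
fewer in `J_α` and one more in `J_β` than prescribed by `λ`, so `U_J` does not depend on the last
variables of the levels `α, …, β - 1`. -/
def dU {N n : ℕ} (lam : Fin N → ℕ) (α β : Fin N) (J : Fin n → Fin N) (t : ℕ → ℕ → ℂ)
    (z : Fin n → ℂ) (h : ℂ) (q : Fin N → ℂ) : ℂ :=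
  sym lam (fun t' => U J t' z h / (q α - q β) *
    (q β * prodA lam α β t' z h - q α * prodB lam α β t' z h)) t

/-- `D_{I,i} = ∑_{j < i} ∑_{p ∈ I_j} d_{j,i} U_{I(p → i)} - ∑_{j > i} ∑_{p ∈ I_i} d_{i,j} U_{I(p → j)}`,
where `I(p → k)` is obtained from the partition `I` by moving the element `p` to `I_k`. -/
def D {N n : ℕ} (lam : Fin N → ℕ) (I : Fin n → Fin N) (i : Fin N) (t : ℕ → ℕ → ℂ)
    (z : Fin n → ℂ) (h : ℂ) (q : Fin N → ℂ) : ℂ :=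
  (∑ j ∈ Finset.univ.filter (fun j : Fin N => j < i),
    ∑ p ∈ Finset.univ.filter (fun p : Fin n => I p = j),
      dU lam j i (Function.update I p i) t z h q) -
  ∑ j ∈ Finset.univ.filter (fun j : Fin N => i < j),
    ∑ p ∈ Finset.univ.filter (fun p : Fin n => I p = i),
      dU lam i j (Function.update I p j) t z h q

end

end DynConn

/-!
The proof reads `U_J` as an interaction of columns. The position `a` of a colouring `J` carries one
variable at every level above its colour (`supp J a`), and `U_J` is the product over `a < b` of the
interaction `col` of the column of `a`, standing on the left, with the column of `b` (`U_eq_V`).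
Let `J` come from `I` by moving `p` from colour `α` to the larger colour `β`. The last variables of
the levels `α + 1, …, β` (in the numbering where colour `k` occupies the levels above `k`) form one
more column `s`, with no position of its own. Placing `s` just before the position `m` gives the
product `cutProd … m`. Placed in front of everything it is `prodA`, placed behind everything it is
`prodB`, so `d_{α,β} U_J` is a combination of the two ends of the sequence `m ↦ symCut … m`.

The steps of this sequence are known (`symCut_succ_sub`). Let `s` pass the column of `c`. If `c` has
a colour above `β`, the two columns do not interact. If the colour of `c` is `β`, both products are
`U_J` with `c` recoloured by `α`, times factors whose difference is `h`; the sum is `h` times a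
weight function (`sum_ins`). If the colour of `c` is below `β`, the step vanishes after
symmetrization (`sum_cut_eq_zero`): the rest of the product does not change when `s` and the column
of `c` exchange their variables at any set of common levels, and averaging over these exchanges
level by level cancels the difference (`sum_chain_ends`). At `c = p` the product itself is
`U_I` times the difference of two consecutive variables of the column of `p` (`symCut_at`).
Telescoping from `p` to either end expresses `d_{α,β} U_J` through weight functions and the sums
`jump`, the latter telescope over the colours in `D_{I,i}`, and the result is
`D_{I,i} = logDer · W_I - hamCoeff` (`D_eq`). Here `hamCoeff` is the coefficient of `v_I` in
`X_i W_λ` (`X_Wvec`) and `logDer` is the value of `κ q_i ∂/∂q_i log (Ω_λ Φ_λ)`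
(`hasDerivAt_prefactor`), which is the first part of the theorem.

For the second part, shift the variables of the column `s` by `κ`. The function `U_J` does not
contain them, and by the functional equation of `Γ` the shift turns `Φ_λ · q_β · prodA` into
`Φ_λ · q_α · prodB` (`Phi_shift`). Hence every summand of `d_{α,β} U_J` is a single discrete
difference of the rational function `q_β / (q_β - q_α) · U_J · prodA`.
-/

namespace DynConn

open scoped BigOperators TensorProduct

noncomputable section

/-! ### Weight functions as interactions of columns -/

/-- The index, from `0`, of the position `a` in the increasing enumeration of `I_1 ∪ … ∪ I_j`. -/
def rank {N n : ℕ} (I : Fin n → Fin N) (j : ℕ) (a : Fin n) : ℕ :=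
  ((unionTo I j).filter (fun m => m < a)).card

theorem rank_lt {N n : ℕ} {I : Fin n → Fin N} {j : ℕ} {a : Fin n} (ha : a ∈ unionTo I j) :
    rank I j a < (unionTo I j).card := by
  apply Finset.card_lt_card
  refine Finset.filter_ssubset.2 ⟨a, ha, lt_irrefl a⟩

theorem rank_lt_rank {N n : ℕ} {I : Fin n → Fin N} {j : ℕ} {a b : Fin n}
    (ha : a ∈ unionTo I j) (hab : a < b) : rank I j a < rank I j b := by
  apply Finset.card_lt_card
  refine Finset.ssubset_iff_of_subset ?_ |>.2 ⟨a, by simp [ha, hab], by simp⟩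
  intro m hm
  simp only [Finset.mem_filter] at hm ⊢
  exact ⟨hm.1, hm.2.trans hab⟩

theorem rank_injOn {N n : ℕ} (I : Fin n → Fin N) (j : ℕ) :
    Set.InjOn (rank I j) (unionTo I j) := by
  intro a ha b hb hab
  rcases lt_trichotomy a b with h | h | h
  · exact absurd hab (rank_lt_rank ha h).ne
  · exact h
  · exact absurd hab (rank_lt_rank hb h).ne'

theorem image_rank {N n : ℕ} (I : Fin n → Fin N) (j : ℕ) :
    (unionTo I j).image (rank I j) = Finset.range (unionTo I j).card := by
  apply Finset.eq_of_subset_of_card_le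
  · intro r hr
    obtain ⟨a, ha, rfl⟩ := Finset.mem_image.1 hr
    exact Finset.mem_range.2 (rank_lt ha)
  · rw [Finset.card_range, Finset.card_image_of_injOn (rank_injOn I j)]

theorem pos_mem {N n : ℕ} (I : Fin n → Fin N) (j : ℕ) (r : Fin (unionTo I j).card) :
    pos I j r ∈ unionTo I j := Finset.orderEmbOfFin_mem _ _ _

theorem pos_injective {N n : ℕ} (I : Fin n → Fin N) (j : ℕ) : Function.Injective (pos I j) :=
  ((unionTo I j).orderEmbOfFin rfl).injective

theorem rank_pos {N n : ℕ} (I : Fin n → Fin N) (j : ℕ) (r : Fin (unionTo I j).card) :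
    rank I j (pos I j r) = r := by
  have hmap : (unionTo I j).filter (fun m => m < pos I j r) =
      (Finset.univ.filter (fun r' : Fin (unionTo I j).card => r' < r)).image (pos I j) := by
    ext m
    simp only [Finset.mem_filter, Finset.mem_image, Finset.mem_univ, true_and]
    constructor
    · rintro ⟨hm, hlt⟩
      have : m ∈ Set.range ((unionTo I j).orderEmbOfFin rfl) := by
        rw [Finset.range_orderEmbOfFin]; exact hm
      obtain ⟨r', rfl⟩ := this
      exact ⟨r', ((unionTo I j).orderEmbOfFin rfl).lt_iff_lt.1 hlt, rfl⟩
    · rintro ⟨r', hr', rfl⟩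
      exact ⟨pos_mem I j r', ((unionTo I j).orderEmbOfFin rfl).lt_iff_lt.2 hr'⟩
  rw [rank, hmap, Finset.card_image_of_injective _ (pos_injective I j)]
  have : (Finset.univ.filter (fun r' : Fin (unionTo I j).card => r' < r)) = Finset.Iio r := by
    ext; simp
  rw [this, Fin.card_Iio]

theorem prod_pos {N n : ℕ} (I : Fin n → Fin N) (j : ℕ) (f : ℕ → Fin n → ℂ) :
    ∏ r : Fin (unionTo I j).card, f r (pos I j r) = ∏ a ∈ unionTo I j, f (rank I j a) a := by
  symm
  have himg : unionTo I j = Finset.univ.image (pos I j) := by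
    ext m
    rw [← Finset.mem_coe, ← Finset.range_orderEmbOfFin (unionTo I j) rfl]
    simp only [Finset.mem_image, Finset.mem_univ, true_and]
    rfl
  conv_lhs => rw [himg]
  rw [Finset.prod_image (fun _ _ _ _ h => pos_injective I j h)]
  exact Finset.prod_congr rfl fun r _ => by rw [rank_pos]

theorem prod_range_eq_prod_rank {N n : ℕ} (I : Fin n → Fin N) (j : ℕ) (f : ℕ → ℂ) :
    ∏ r ∈ Finset.range (unionTo I j).card, f r = ∏ a ∈ unionTo I j, f (rank I j a) := by
  rw [← image_rank, Finset.prod_image (rank_injOn I j)]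

/-- The interaction of a variable `u` of level `i` with a variable `v` of level `j` whose position
is further to the right. Only equal and adjacent levels interact, and equal levels only below the
top level `N`, whose variables are the `z_a`. -/
def inter (N : ℕ) (h : ℂ) (i : ℕ) (u : ℂ) (j : ℕ) (v : ℂ) : ℂ :=
  (if j = i + 1 then u - v - h else 1) * (if i = j + 1 then v - u else 1) *
    (if i = j ∧ i < N then (v - u - h) / (v - u) else 1)

/-- The interaction of a left column with variables `x i` at the levels `i ∈ P` and a right column
with variables `y j` at the levels `j ∈ Q`. -/
def col (N : ℕ) (h : ℂ) (P Q : Finset ℕ) (x y : ℕ → ℂ) : ℂ :=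
  ∏ i ∈ P, ∏ j ∈ Q, inter N h i (x i) j (y j)

theorem col_eq_prod_levels {N : ℕ} (h : ℂ) {P Q : Finset ℕ} (hP : P ⊆ Finset.Icc 1 N)
    (hQ : Q ⊆ Finset.Icc 1 N) (x y : ℕ → ℂ) :
    col N h P Q x y = ∏ l ∈ Finset.Icc 1 (N - 1),
      ((if l ∈ P ∧ l + 1 ∈ Q then x l - y (l + 1) - h else 1) *
        (if l ∈ Q ∧ l + 1 ∈ P then y l - x (l + 1) else 1) *
        (if l ∈ P ∧ l ∈ Q then (y l - x l - h) / (y l - x l) else 1)) := by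
  have key : ∀ (P Q : Finset ℕ) (f : ℕ → ℂ), P ⊆ Finset.Icc 1 N → Q ⊆ Finset.Icc 1 N →
      (∏ i ∈ P, ∏ j ∈ Q, if j = i + 1 then f i else 1) =
        ∏ l ∈ Finset.Icc 1 (N - 1), if l ∈ P ∧ l + 1 ∈ Q then f l else 1 := by
    intro P Q f hP hQ
    have h1 : ∀ i ∈ P, (∏ j ∈ Q, if j = i + 1 then f i else 1) =
        if i + 1 ∈ Q then f i else 1 := fun i _ => by
      rw [Finset.prod_ite_eq']
    rw [Finset.prod_congr rfl h1, Finset.prod_ite, Finset.prod_const_one, mul_one,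
      Finset.prod_ite, Finset.prod_const_one, mul_one]
    refine Finset.prod_congr ?_ fun _ _ => rfl
    ext l
    simp only [Finset.mem_filter, Finset.mem_Icc]
    constructor
    · rintro ⟨h1, h2⟩
      have := Finset.mem_Icc.1 (hP h1)
      have := Finset.mem_Icc.1 (hQ h2)
      exact ⟨by omega, h1, h2⟩
    · rintro ⟨_, h1, h2⟩; exact ⟨h1, h2⟩
  have hdiag : (∏ i ∈ P, ∏ j ∈ Q,
        if i = j ∧ i < N then (y j - x i - h) / (y j - x i) else 1) =
      ∏ l ∈ Finset.Icc 1 (N - 1),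
        if l ∈ P ∧ l ∈ Q then (y l - x l - h) / (y l - x l) else 1 := by
    have h1 : ∀ i ∈ P, (∏ j ∈ Q, if i = j ∧ i < N then (y j - x i - h) / (y j - x i) else 1) =
        if i ∈ Q ∧ i < N then (y i - x i - h) / (y i - x i) else 1 := fun i _ => by
      by_cases hi : i < N
      · simp only [hi, and_true]
        rw [Finset.prod_ite_eq]
      · simp [hi]
    rw [Finset.prod_congr rfl h1, Finset.prod_ite, Finset.prod_const_one, mul_one,
      Finset.prod_ite, Finset.prod_const_one, mul_one]
    refine Finset.prod_congr ?_ fun _ _ => rfl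
    ext l
    simp only [Finset.mem_filter, Finset.mem_Icc]
    constructor
    · rintro ⟨h1, h2, h3⟩
      have := Finset.mem_Icc.1 (hP h1)
      exact ⟨by omega, h1, h2⟩
    · rintro ⟨h0, h1, h2⟩; exact ⟨h1, h2, by omega⟩
  have hup : (∏ i ∈ P, ∏ j ∈ Q, if j = i + 1 then x i - y j - h else 1) =
      ∏ i ∈ P, ∏ j ∈ Q, if j = i + 1 then x i - y (i + 1) - h else 1 := by
    refine Finset.prod_congr rfl fun i _ => Finset.prod_congr rfl fun j _ => ?_
    split_ifs with hj
    · rw [hj]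
    · rfl
  have hdown : (∏ i ∈ P, ∏ j ∈ Q, if i = j + 1 then y j - x i else 1) =
      ∏ j ∈ Q, ∏ i ∈ P, if i = j + 1 then y j - x (j + 1) else 1 := by
    rw [Finset.prod_comm]
    refine Finset.prod_congr rfl fun i _ => Finset.prod_congr rfl fun j _ => ?_
    split_ifs with hj
    · rw [hj]
    · rfl
  simp only [col, inter, Finset.prod_mul_distrib]
  rw [hdiag, hup, hdown, key P Q _ hP hQ, key Q P _ hQ hP]

/-- The levels at which the position `a` has a variable: those `j` with `a ∈ I_1 ∪ … ∪ I_j`. -/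
def supp {N n : ℕ} (J : Fin n → Fin N) (a : Fin n) : Finset ℕ := Finset.Ioc (J a).val N

theorem supp_subset {N n : ℕ} (J : Fin n → Fin N) (a : Fin n) : supp J a ⊆ Finset.Icc 1 N := by
  intro l hl
  simp only [supp, Finset.mem_Ioc, Finset.mem_Icc] at hl ⊢
  omega

theorem mem_supp {N n : ℕ} {J : Fin n → Fin N} {a : Fin n} {l : ℕ} (hl : l ≤ N) :
    l ∈ supp J a ↔ a ∈ unionTo J l := by
  simp [supp, unionTo, hl]

/-- The function `U_J` with its variables indexed by positions: `x j a` is the variable of level `j`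
that belongs to the position `a`. -/
def V {N n : ℕ} (J : Fin n → Fin N) (h : ℂ) (x : ℕ → Fin n → ℂ) : ℂ :=
  ∏ a : Fin n, ∏ b ∈ Finset.univ.filter (fun b : Fin n => a < b),
    col N h (supp J a) (supp J b) (fun i => x i a) (fun i => x i b)

theorem prod_ite_mem_lt {n : ℕ} (A B : Finset (Fin n)) (f : Fin n → Fin n → ℂ) :
    (∏ a : Fin n, ∏ b ∈ Finset.univ.filter (fun b : Fin n => a < b),
      if a ∈ A ∧ b ∈ B then f a b else 1) = ∏ a ∈ A, ∏ b ∈ B.filter (fun b => a < b), f a b := by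
  rw [← Finset.prod_filter_mul_prod_filter_not Finset.univ (fun a => a ∈ A)]
  have h2 : (∏ a ∈ Finset.univ.filter (fun a => a ∉ A),
      ∏ b ∈ Finset.univ.filter (fun b : Fin n => a < b),
        if a ∈ A ∧ b ∈ B then f a b else 1) = 1 := by
    refine Finset.prod_eq_one fun a ha => Finset.prod_eq_one fun b _ => ?_
    rw [if_neg]
    simp only [Finset.mem_filter] at ha
    exact fun h => ha.2 h.1
  rw [h2, mul_one]
  refine Finset.prod_congr (by ext; simp) fun a ha => ?_
  simp only [ha, true_and]
  rw [Finset.prod_ite, Finset.prod_const_one, mul_one, Finset.filter_filter]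
  refine Finset.prod_congr ?_ fun _ _ => rfl
  ext b; simp [and_comm]

theorem V_eq_prod_levels {N n : ℕ} (J : Fin n → Fin N) (h : ℂ) (x : ℕ → Fin n → ℂ) :
    V J h x = ∏ l ∈ Finset.Icc 1 (N - 1), ∏ m ∈ unionTo J l,
      ((∏ c ∈ (unionTo J (l + 1)).filter (fun c => c < m), (x l m - x (l + 1) c)) *
        (∏ d ∈ (unionTo J (l + 1)).filter (fun d => m < d), (x l m - x (l + 1) d - h)) *
        ∏ b ∈ (unionTo J l).filter (fun b => m < b),
          (x l b - x l m - h) / (x l b - x l m)) := by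
  have h1 : V J h x = ∏ l ∈ Finset.Icc 1 (N - 1), ∏ a : Fin n,
      ∏ b ∈ Finset.univ.filter (fun b : Fin n => a < b),
      ((if a ∈ unionTo J l ∧ b ∈ unionTo J (l + 1) then x l a - x (l + 1) b - h else 1) *
        (if b ∈ unionTo J l ∧ a ∈ unionTo J (l + 1) then x l b - x (l + 1) a else 1) *
        (if a ∈ unionTo J l ∧ b ∈ unionTo J l then (x l b - x l a - h) / (x l b - x l a)
          else 1)) := by
    rw [V, Finset.prod_comm (s := Finset.Icc 1 (N - 1))]
    refine Finset.prod_congr rfl fun a _ => ?_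
    rw [Finset.prod_comm (s := Finset.Icc 1 (N - 1))]
    refine Finset.prod_congr rfl fun b _ => ?_
    rw [col_eq_prod_levels h (supp_subset J a) (supp_subset J b)]
    refine Finset.prod_congr rfl fun l hl => ?_
    have hl' := Finset.mem_Icc.1 hl
    simp only [mem_supp (J := J) (l := l) (by omega), mem_supp (J := J) (l := l + 1) (by omega)]
  rw [h1]
  refine Finset.prod_congr rfl fun l _ => ?_
  simp only [Finset.prod_mul_distrib]
  rw [prod_ite_mem_lt (unionTo J l) (unionTo J (l + 1)) (fun a b => x l a - x (l + 1) b - h),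
    prod_ite_mem_lt (unionTo J l) (unionTo J l) (fun a b => (x l b - x l a - h) / (x l b - x l a))]
  have h2 : (∏ a : Fin n, ∏ b ∈ Finset.univ.filter (fun b : Fin n => a < b),
      if b ∈ unionTo J l ∧ a ∈ unionTo J (l + 1) then x l b - x (l + 1) a else 1) =
      ∏ m ∈ unionTo J l, ∏ c ∈ (unionTo J (l + 1)).filter (fun c => c < m),
        (x l m - x (l + 1) c) := by
    rw [show (∏ a : Fin n, ∏ b ∈ Finset.univ.filter (fun b : Fin n => a < b),
      if b ∈ unionTo J l ∧ a ∈ unionTo J (l + 1) then x l b - x (l + 1) a else 1) =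
      ∏ a : Fin n, ∏ b ∈ Finset.univ.filter (fun b : Fin n => a < b),
      if a ∈ unionTo J (l + 1) ∧ b ∈ unionTo J l then x l b - x (l + 1) a else 1 by
        simp only [and_comm], prod_ite_mem_lt (unionTo J (l + 1)) (unionTo J l)
          (fun a b => x l b - x (l + 1) a)]
    refine Finset.prod_comm' fun a b => ?_
    simp only [Finset.mem_filter]; tauto
  rw [h2]
  ring

theorem U_eq_V {N n : ℕ} (I : Fin n → Fin N) (t : ℕ → ℕ → ℂ) (z : Fin n → ℂ) (h : ℂ) :
    U I t z h = V I h (fun j a => allVars N t z j (rank I j a)) := by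
  rw [V_eq_prod_levels, U]
  refine Finset.prod_congr rfl fun l hl => ?_
  have hl' := Finset.mem_Icc.1 hl
  have hlN : l < N := by omega
  have e1 : ∀ (j : ℕ) (p : Fin n → Prop) [DecidablePred p] (f : ℂ → ℂ),
      (∏ c ∈ Finset.univ.filter (fun c : Fin (unionTo I j).card => p (pos I j c)),
        f (allVars N t z j c)) =
      ∏ c ∈ (unionTo I j).filter p, f (allVars N t z j (rank I j c)) := by
    intro j p _ f
    rw [Finset.prod_filter, Finset.prod_filter]
    exact prod_pos I j (fun r m => if p m then f (allVars N t z j r) else 1)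
  have e2 : ∀ a : Fin (unionTo I l).card,
      (∏ b ∈ Finset.univ.filter (fun b : Fin (unionTo I l).card => a < b),
        (t l b - t l a - h) / (t l b - t l a)) =
      ∏ b ∈ (unionTo I l).filter (fun b => pos I l a < b),
        (allVars N t z l (rank I l b) - allVars N t z l a - h) /
          (allVars N t z l (rank I l b) - allVars N t z l a) := by
    intro a
    rw [← e1 l (fun m => pos I l a < m) (fun v => (v - allVars N t z l a - h) /
          (v - allVars N t z l a))]
    refine Finset.prod_congr ?_ fun b _ => by simp [allVars, hlN]
    ext b
    simp only [Finset.mem_filter, Finset.mem_univ, true_and]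
    exact ((unionTo I l).orderEmbOfFin rfl).lt_iff_lt.symm
  rw [← prod_pos I l (fun r m =>
    ((∏ c ∈ (unionTo I (l + 1)).filter (fun c => c < m),
        (allVars N t z l r - allVars N t z (l + 1) (rank I (l + 1) c))) *
      (∏ d ∈ (unionTo I (l + 1)).filter (fun d => m < d),
        (allVars N t z l r - allVars N t z (l + 1) (rank I (l + 1) d) - h)) *
      ∏ b ∈ (unionTo I l).filter (fun b => m < b),
        (allVars N t z l (rank I l b) - allVars N t z l r - h) /
          (allVars N t z l (rank I l b) - allVars N t z l r)))]
  refine Finset.prod_congr rfl fun a _ => ?_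
  rw [e2 a, ← e1 (l + 1) (fun c => c < pos I l a) (fun v => allVars N t z l a - v),
    ← e1 (l + 1) (fun d => pos I l a < d) (fun v => allVars N t z l a - v - h)]

/-! ### Exchange of two columns level by level -/

/-- The factor of two variables `s`, `y` of the level `i`, for two columns `s`, `y` whose variables
are functions on a set `Ω`. -/
def pairRatio {Ω : Type*} (h : ℂ) (s y : ℕ → Ω → ℂ) (i : ℕ) (ω : Ω) : ℂ :=
  (s i ω - y i ω - h) / (s i ω - y i ω)

/-- The factors that couple the levels `i` and `i + 1` of the columns `s` and `y`. -/
def pairLink {Ω : Type*} (h : ℂ) (s y : ℕ → Ω → ℂ) (i : ℕ) (ω : Ω) : ℂ :=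
  (s i ω - y (i + 1) ω) * (y i ω - s (i + 1) ω - h)

/-- Minus one half of `(s - y - h) (s - y + h)` at the level `i`. It is even in `s - y`, hence
invariant under each exchange of `s` and `y`. -/
def pairSq {Ω : Type*} (h : ℂ) (s y : ℕ → Ω → ℂ) (i : ℕ) (ω : Ω) : ℂ :=
  -((s i ω - y i ω) ^ 2 - h ^ 2) / 2

/-- The interaction of the columns `s` and `y` restricted to the levels `k, …, l`. -/
def chain {Ω : Type*} (h : ℂ) (s y : ℕ → Ω → ℂ) (k l : ℕ) (ω : Ω) : ℂ :=
  (∏ i ∈ Finset.Ico k (l + 1), pairRatio h s y i ω) * ∏ i ∈ Finset.Ico k l, pairLink h s y i ω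

/-- The permutation `τ` exchanges `s j` and `y j` at the levels `j ∈ S` and fixes them at the other
levels between `k` and `l`. -/
def IsSwap {Ω : Type*} (s y : ℕ → Ω → ℂ) (k l : ℕ) (S : Finset ℕ) (τ : Equiv.Perm Ω) : Prop :=
  ∀ j ∈ Finset.Icc k l, ∀ ω, s j (τ ω) = (if j ∈ S then y j ω else s j ω) ∧
    y j (τ ω) = (if j ∈ S then s j ω else y j ω)

theorem IsSwap.mono {Ω : Type*} {s y : ℕ → Ω → ℂ} {k l k' l' : ℕ} {S : Finset ℕ}
    {τ : Equiv.Perm Ω} (hτ : IsSwap s y k l S τ) (hk : k ≤ k') (hl : l' ≤ l) :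
    IsSwap s y k' l' S τ := fun j hj =>
  hτ j (Finset.Icc_subset_Icc hk hl hj)

theorem chain_swap_outside {Ω : Type*} (h : ℂ) {s y : ℕ → Ω → ℂ} {k l : ℕ} {S : Finset ℕ}
    {τ : Equiv.Perm Ω} (hτ : IsSwap s y k l S τ) (hS : ∀ j ∈ Finset.Icc k l, j ∉ S) (ω : Ω) :
    chain h s y k l (τ ω) = chain h s y k l ω := by
  have e : ∀ j ∈ Finset.Icc k l, s j (τ ω) = s j ω ∧ y j (τ ω) = y j ω := fun j hj => by
    have := hτ j hj ω
    rwa [if_neg (hS j hj), if_neg (hS j hj)] at this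
  unfold chain
  congr 1
  · refine Finset.prod_congr rfl fun i hi => ?_
    have hi' := Finset.mem_Ico.1 hi
    have h1 := e i (Finset.mem_Icc.2 ⟨hi'.1, by omega⟩)
    rw [pairRatio, pairRatio, h1.1, h1.2]
  · refine Finset.prod_congr rfl fun i hi => ?_
    have hi' := Finset.mem_Ico.1 hi
    have h1 := e i (Finset.mem_Icc.2 ⟨hi'.1, by omega⟩)
    have h2 := e (i + 1) (Finset.mem_Icc.2 ⟨by omega, by omega⟩)
    rw [pairLink, pairLink, h1.1, h1.2, h2.1, h2.2]

theorem chain_swap_all {Ω : Type*} (h : ℂ) {s y : ℕ → Ω → ℂ} {k l : ℕ}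
    {τ : Equiv.Perm Ω} (hτ : IsSwap s y k l (Finset.Icc k l) τ) (ω : Ω) :
    chain h y s k l (τ ω) = chain h s y k l ω := by
  have e : ∀ j ∈ Finset.Icc k l, s j (τ ω) = y j ω ∧ y j (τ ω) = s j ω := fun j hj => by
    have := hτ j hj ω
    rwa [if_pos hj, if_pos hj] at this
  unfold chain
  congr 1
  · refine Finset.prod_congr rfl fun i hi => ?_
    have hi' := Finset.mem_Ico.1 hi
    have h1 := e i (Finset.mem_Icc.2 ⟨hi'.1, by omega⟩)
    rw [pairRatio, pairRatio, h1.1, h1.2]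
  · refine Finset.prod_congr rfl fun i hi => ?_
    have hi' := Finset.mem_Ico.1 hi
    have h1 := e i (Finset.mem_Icc.2 ⟨hi'.1, by omega⟩)
    have h2 := e (i + 1) (Finset.mem_Icc.2 ⟨by omega, by omega⟩)
    rw [pairLink, pairLink, h1.1, h1.2, h2.1, h2.2]

theorem sum_eq_sum_half {Ω : Type*} [Fintype Ω] (τ : Equiv.Perm Ω) (F : Ω → ℂ) :
    ∑ ω, F ω = ∑ ω, (F ω + F (τ ω)) / 2 := by
  rw [← Finset.sum_div, Finset.sum_add_distrib, Equiv.sum_comp τ F]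
  ring

theorem chain_succ_right {Ω : Type*} (h : ℂ) (s y : ℕ → Ω → ℂ) {k l : ℕ} (hkl : k ≤ l) (ω : Ω) :
    chain h s y k (l + 1) ω =
      chain h s y k l ω * pairLink h s y l ω * pairRatio h s y (l + 1) ω := by
  rw [chain, chain, Finset.prod_Ico_succ_top (by omega : k ≤ l + 1),
    Finset.prod_Ico_succ_top hkl (fun i => pairLink h s y i ω)]
  ring

theorem chain_succ_left {Ω : Type*} (h : ℂ) (s y : ℕ → Ω → ℂ) {k l : ℕ} (hkl : k < l) (ω : Ω) :
    chain h s y k l ω =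
      pairRatio h s y k ω * pairLink h s y k ω * chain h s y (k + 1) l ω := by
  rw [chain, chain, Finset.prod_eq_prod_Ico_succ_bot (by omega : k < l + 1),
    Finset.prod_eq_prod_Ico_succ_bot hkl]
  ring

theorem chain_self {Ω : Type*} (h : ℂ) (s y : ℕ → Ω → ℂ) (k : ℕ) (ω : Ω) :
    chain h s y k k ω = pairRatio h s y k ω := by
  simp [chain]

theorem pairSq_swap {Ω : Type*} (h : ℂ) {s y : ℕ → Ω → ℂ} {k l : ℕ} {S : Finset ℕ}
    {τ : Equiv.Perm Ω} (hτ : IsSwap s y k l S τ) {j : ℕ} (hj : j ∈ Finset.Icc k l) (ω : Ω) :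
    pairSq h s y j (τ ω) = pairSq h s y j ω := by
  have := hτ j hj ω
  rw [pairSq, pairSq, this.1, this.2]
  split_ifs <;> ring

/-- If `g` is invariant under the exchanges at the levels `k + 1, …, l`, averaging over these
exchanges, from the top level down, reduces a chain multiplied by `s - y + h` at its top level to
its bottom level. -/
theorem sum_chain_right {Ω : Type*} [Fintype Ω] (h : ℂ) {s y : ℕ → Ω → ℂ} {k l : ℕ}
    (hkl : k ≤ l) (τ : ℕ → Equiv.Perm Ω)
    (hτ : ∀ i ∈ Finset.Icc k l, IsSwap s y k l {i} (τ i))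
    (hne : ∀ i ∈ Finset.Icc k l, ∀ ω, s i ω ≠ y i ω) (g : Ω → ℂ)
    (hg : ∀ i ∈ Finset.Ioc k l, ∀ ω, g (τ i ω) = g ω) :
    ∑ ω, g ω * chain h s y k l ω * (s l ω - y l ω + h) =
      ∑ ω, g ω * (∏ i ∈ Finset.Ioc k l, pairSq h s y i ω) *
        (pairRatio h s y k ω * (s k ω - y k ω + h)) := by
  induction l, hkl using Nat.le_induction generalizing g with
  | base => simp [chain_self, mul_assoc]
  | succ l hkl ih =>
    have hm : l + 1 ∈ Finset.Icc k (l + 1) := Finset.mem_Icc.2 ⟨by omega, le_rfl⟩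
    have hml : l ∈ Finset.Icc k (l + 1) := Finset.mem_Icc.2 ⟨by omega, by omega⟩
    -- The exchange at the level `l + 1` affects only the last link and the last ratio. Their
    -- average, multiplied by `s - y + h`, is `pairSq` times `s - y + h` one level lower.
    have step : ∑ ω, g ω * chain h s y k (l + 1) ω * (s (l + 1) ω - y (l + 1) ω + h) =
        ∑ ω, (g ω * pairSq h s y (l + 1) ω) * chain h s y k l ω * (s l ω - y l ω + h) := by
      rw [sum_eq_sum_half (τ (l + 1))]
      refine Finset.sum_congr rfl fun ω _ => ?_
      have h1 := hτ (l + 1) hm (l + 1) hm ω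
      have h2 := hτ (l + 1) hm l hml ω
      rw [if_pos (by simp), if_pos (by simp)] at h1
      rw [if_neg (by simp), if_neg (by simp)] at h2
      rw [chain_succ_right h s y hkl, chain_succ_right h s y hkl,
        chain_swap_outside h ((hτ (l + 1) hm).mono le_rfl (Nat.le_succ l))
          (fun j hj => by
            have := Finset.mem_Icc.1 hj
            simp only [Finset.mem_singleton]; omega),
        hg (l + 1) (Finset.mem_Ioc.2 ⟨by omega, le_rfl⟩)]
      simp only [pairLink, pairRatio, pairSq, h1.1, h1.2, h2.1, h2.2]
      have hn := sub_ne_zero.2 (hne (l + 1) hm ω)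
      have hn' := sub_ne_zero.2 (hne (l + 1) hm ω).symm
      field_simp
      ring
    rw [step, ih (fun i hi => (hτ i (Finset.Icc_subset_Icc le_rfl (Nat.le_succ l) hi)).mono le_rfl
      (Nat.le_succ l)) (fun i hi => hne i (Finset.Icc_subset_Icc le_rfl (Nat.le_succ l) hi))]
    · refine Finset.sum_congr rfl fun ω _ => ?_
      rw [← Finset.insert_Ioc_right_eq_Ioc_add_one hkl, Finset.prod_insert (by simp)]
      ring
    · intro i hi ω
      have hi' := Finset.mem_Ioc.1 hi
      rw [hg i (Finset.mem_Ioc.2 ⟨hi'.1, by omega⟩),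
        pairSq_swap h (hτ i (Finset.mem_Icc.2 ⟨by omega, by omega⟩)) hm]

/-- The mirror image of `sum_chain_right`: the levels are averaged from the bottom up. -/
theorem sum_chain_left {Ω : Type*} [Fintype Ω] (h : ℂ) {s y : ℕ → Ω → ℂ} {k l : ℕ}
    (hkl : k ≤ l) (τ : ℕ → Equiv.Perm Ω)
    (hτ : ∀ i ∈ Finset.Icc k l, IsSwap s y k l {i} (τ i))
    (hne : ∀ i ∈ Finset.Icc k l, ∀ ω, s i ω ≠ y i ω) (g : Ω → ℂ)
    (hg : ∀ i ∈ Finset.Ico k l, ∀ ω, g (τ i ω) = g ω) :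
    ∑ ω, g ω * chain h s y k l ω * (s k ω - y k ω + h) =
      ∑ ω, g ω * (∏ i ∈ Finset.Ico k l, pairSq h s y i ω) *
        (pairRatio h s y l ω * (s l ω - y l ω + h)) := by
  obtain ⟨m, rfl⟩ := Nat.exists_eq_add_of_le hkl
  induction m generalizing k g with
  | zero => simp [chain_self, mul_assoc]
  | succ m ih =>
    have hm : k ∈ Finset.Icc k (k + (m + 1)) := Finset.mem_Icc.2 ⟨le_rfl, by omega⟩
    have hml : k + 1 ∈ Finset.Icc k (k + (m + 1)) := Finset.mem_Icc.2 ⟨by omega, by omega⟩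
    have hlt : k < k + (m + 1) := by omega
    have step : ∑ ω, g ω * chain h s y k (k + (m + 1)) ω * (s k ω - y k ω + h) =
        ∑ ω, (g ω * pairSq h s y k ω) * chain h s y (k + 1) (k + (m + 1)) ω *
          (s (k + 1) ω - y (k + 1) ω + h) := by
      rw [sum_eq_sum_half (τ k)]
      refine Finset.sum_congr rfl fun ω _ => ?_
      have h1 := hτ k hm k hm ω
      have h2 := hτ k hm (k + 1) hml ω
      rw [if_pos (by simp), if_pos (by simp)] at h1
      rw [if_neg (by simp), if_neg (by simp)] at h2
      rw [chain_succ_left h s y hlt ω, chain_succ_left h s y hlt (τ k ω),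
        chain_swap_outside h ((hτ k hm).mono (Nat.le_succ k) le_rfl)
          (fun j hj => by
            have := Finset.mem_Icc.1 hj
            simp only [Finset.mem_singleton]; omega),
        hg k (Finset.mem_Ico.2 ⟨le_rfl, by omega⟩)]
      simp only [pairLink, pairRatio, pairSq, h1.1, h1.2, h2.1, h2.2]
      have hn := sub_ne_zero.2 (hne k hm ω)
      have hn' := sub_ne_zero.2 (hne k hm ω).symm
      field_simp
      ring
    rw [show k + (m + 1) = k + 1 + m by omega] at *
    rw [step, ih _ (by omega) (fun i hi =>
      (hτ i (Finset.Icc_subset_Icc (Nat.le_succ k) le_rfl hi)).mono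
      (Nat.le_succ k) le_rfl) (fun i hi => hne i (Finset.Icc_subset_Icc (Nat.le_succ k) le_rfl hi))]
    · refine Finset.sum_congr rfl fun ω _ => ?_
      rw [Finset.prod_eq_prod_Ico_succ_bot (show k < k + 1 + m by omega)]
      ring
    · intro i hi ω
      have hi' := Finset.mem_Ico.1 hi
      rw [hg i (Finset.mem_Ico.2 ⟨by omega, by omega⟩),
        pairSq_swap h (hτ i (Finset.mem_Icc.2 ⟨by omega, by omega⟩)) hm]

/-- The difference of the interactions of the columns `s` and `y` in their two orders has zero sum.
The factors `lB`, `lA` describe the lower end of the chain of common levels, `Y` is the variable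
above its upper end, and `g` collects everything that the exchanges of `s` and `y` leave unchanged.
-/
theorem sum_chain_ends {Ω : Type*} [Fintype Ω] (h : ℂ) {s y : ℕ → Ω → ℂ} {k l : ℕ}
    (hkl : k ≤ l) (τ : Finset ℕ → Equiv.Perm Ω)
    (hτ : ∀ S ⊆ Finset.Icc k l, IsSwap s y k l S (τ S))
    (hne : ∀ i ∈ Finset.Icc k l, ∀ ω, s i ω ≠ y i ω) (g Y lB lA : Ω → ℂ)
    (hg : ∀ S ⊆ Finset.Icc k l, ∀ ω, g (τ S ω) = g ω)
    (hY : ∀ S ⊆ Finset.Icc k l, ∀ ω, Y (τ S ω) = Y ω) (ε : ℂ)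
    (h1 : ∀ ω, lB ω - lA (τ (Finset.Icc k l) ω) = ε * (s k ω - y k ω + h))
    (h2 : ∀ ω, lB ω - lB (τ {k} ω) = ε * (s k ω - y k ω))
    (h3 : ∀ i ∈ Finset.Ioc k l, ∀ ω, lB (τ {i} ω) = lB ω) :
    ∑ ω, g ω * (lB ω * chain h s y k l ω * (s l ω - Y ω) -
      lA ω * chain h y s k l ω * (s l ω - Y ω - h)) = 0 := by
  have hsub : ∀ i ∈ Finset.Icc k l, ({i} : Finset ℕ) ⊆ Finset.Icc k l := fun i hi =>
    Finset.singleton_subset_iff.2 hi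
  have hkm : k ∈ Finset.Icc k l := Finset.mem_Icc.2 ⟨le_rfl, hkl⟩
  have hlm : l ∈ Finset.Icc k l := Finset.mem_Icc.2 ⟨hkl, le_rfl⟩
  have hτ1 : ∀ i ∈ Finset.Icc k l, IsSwap s y k l {i} (τ {i}) := fun i hi => hτ _ (hsub i hi)
  -- The exchange at all levels turns one order of the two columns into the other.
  have hA : ∑ ω, g ω * (lA ω * chain h y s k l ω * (s l ω - Y ω - h)) =
      ∑ ω, g ω * (lA (τ (Finset.Icc k l) ω) * chain h s y k l ω * (y l ω - Y ω - h)) := by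
    rw [← Equiv.sum_comp (τ (Finset.Icc k l))]
    refine Finset.sum_congr rfl fun ω _ => ?_
    have := hτ _ subset_rfl l hlm ω
    rw [if_pos hlm] at this
    rw [hg _ subset_rfl, hY _ subset_rfl, chain_swap_all h (hτ _ subset_rfl), this.1]
  have hR : ∑ ω, (g ω * lB ω) * chain h s y k l ω * (s l ω - y l ω + h) =
      -ε * ∑ ω, g ω * ∏ i ∈ Finset.Icc k l, pairSq h s y i ω := by
    rw [sum_chain_right h hkl (fun i => τ {i}) hτ1 hne (fun ω => g ω * lB ω),
      sum_eq_sum_half (τ {k}), Finset.mul_sum]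
    · refine Finset.sum_congr rfl fun ω _ => ?_
      have hk := hτ1 k hkm k hkm ω
      rw [if_pos (by simp), if_pos (by simp)] at hk
      have hP : ∏ i ∈ Finset.Ioc k l, pairSq h s y i (τ {k} ω) =
          ∏ i ∈ Finset.Ioc k l, pairSq h s y i ω := Finset.prod_congr rfl fun i hi =>
        pairSq_swap h (hτ1 k hkm) (Finset.Ioc_subset_Icc_self hi) ω
      have hB : lB (τ {k} ω) = lB ω - ε * (s k ω - y k ω) := by rw [← h2]; ring
      rw [hP, hg _ (hsub k hkm), hB, ← Finset.Ioc_insert_left hkl,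
        Finset.prod_insert (by simp)]
      simp only [pairRatio, hk.1, hk.2]
      rw [pairSq]
      have hn := sub_ne_zero.2 (hne k hkm ω)
      have hn' := sub_ne_zero.2 (hne k hkm ω).symm
      field_simp
      ring
    · intro i hi ω
      rw [hg _ (hsub i (Finset.Ioc_subset_Icc_self hi)), h3 i hi]
  have hL : ∑ ω, (g ω * (y l ω - Y ω - h)) * chain h s y k l ω * (s k ω - y k ω + h) =
      ∑ ω, g ω * ∏ i ∈ Finset.Icc k l, pairSq h s y i ω := by
    rw [sum_chain_left h hkl (fun i => τ {i}) hτ1 hne (fun ω => g ω * (y l ω - Y ω - h)),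
      sum_eq_sum_half (τ {l})]
    · refine Finset.sum_congr rfl fun ω _ => ?_
      have hl := hτ1 l hlm l hlm ω
      rw [if_pos (by simp), if_pos (by simp)] at hl
      have hP : ∏ i ∈ Finset.Ico k l, pairSq h s y i (τ {l} ω) =
          ∏ i ∈ Finset.Ico k l, pairSq h s y i ω := Finset.prod_congr rfl fun i hi =>
        pairSq_swap h (hτ1 l hlm) (Finset.Ico_subset_Icc_self hi) ω
      rw [hP, hg _ (hsub l hlm), hY _ (hsub l hlm), ← Finset.Ico_insert_right hkl,
        Finset.prod_insert (by simp)]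
      simp only [pairRatio, hl.1, hl.2]
      rw [pairSq]
      have hn := sub_ne_zero.2 (hne l hlm ω)
      have hn' := sub_ne_zero.2 (hne l hlm ω).symm
      field_simp
      ring
    · intro i hi ω
      have hi' := Finset.mem_Ico.1 hi
      have := (hτ1 i (Finset.Ico_subset_Icc_self hi) l hlm ω).2
      rw [if_neg (by simp only [Finset.mem_singleton]; omega)] at this
      rw [hg _ (hsub i (Finset.Ico_subset_Icc_self hi)), this,
        hY _ (hsub i (Finset.Ico_subset_Icc_self hi))]
  -- Put `B = s l - Y`, `A = y l - Y - h` and let `lA'` be `lA` after the exchange at all levels.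
  -- Then `lB B - lA' A = lB (B - A) + (lB - lA') A`, and by `hR` and `hL` the two terms on the
  -- right have opposite sums.
  have hsplit : ∑ ω, g ω * (lB ω * chain h s y k l ω * (s l ω - Y ω) -
      lA ω * chain h y s k l ω * (s l ω - Y ω - h)) =
      ∑ ω, (g ω * lB ω) * chain h s y k l ω * (s l ω - y l ω + h) +
      ε * ∑ ω, (g ω * (y l ω - Y ω - h)) * chain h s y k l ω * (s k ω - y k ω + h) := by
    rw [Finset.mul_sum, ← Finset.sum_add_distrib]
    simp only [mul_sub (g _) (lB _ * _ * _)]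
    rw [Finset.sum_sub_distrib, hA, ← Finset.sum_sub_distrib]
    refine Finset.sum_congr rfl fun ω _ => ?_
    have hA' : lA (τ (Finset.Icc k l) ω) = lB ω - ε * (s k ω - y k ω + h) := by rw [← h1]; ring
    rw [hA']
    ring
  rw [hsplit, hR, hL]
  ring

/-! ### The symmetrization group acting on labelled variables -/

/-- The action of a tuple of permutations on the indices: the level-`j` variable with index `r` is
replaced by the one with index `permIdx lam s j r`. Indices that belong to no permuted variable are
fixed. -/
def permIdx {N : ℕ} (lam : Fin N → ℕ) (s : PermGroup lam) : ℕ → ℕ → ℕ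
  | 0, r => r
  | j + 1, r =>
    if hj : j < N - 1 then
      if hr : r < lev lam (j + 1) then (s ⟨j, hj⟩ ⟨r, hr⟩).val else r
    else r

theorem permute_apply {N : ℕ} (lam : Fin N → ℕ) (s : PermGroup lam) (t : ℕ → ℕ → ℂ) (j r : ℕ) :
    permute lam s t j r = t j (permIdx lam s j r) := by
  cases j with
  | zero => rfl
  | succ j => simp only [permute, permIdx]; split_ifs <;> rfl

theorem permIdx_of_lt {N : ℕ} {lam : Fin N → ℕ} (s : PermGroup lam) {j r : ℕ} (hj : j < N - 1)
    (hr : r < lev lam (j + 1)) : permIdx lam s (j + 1) r = (s ⟨j, hj⟩ ⟨r, hr⟩).val := by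
  simp [permIdx, hj, hr]

theorem permIdx_of_le {N : ℕ} {lam : Fin N → ℕ} (s : PermGroup lam) {j : ℕ} (hj : N ≤ j) (r : ℕ) :
    permIdx lam s j r = r := by
  cases j with
  | zero => rfl
  | succ j => rw [permIdx, dif_neg (by omega)]

theorem permIdx_lt {N : ℕ} {lam : Fin N → ℕ} (s : PermGroup lam) {j r : ℕ}
    (hr : r < lev lam j) : permIdx lam s j r < lev lam j := by
  cases j with
  | zero => exact hr
  | succ j =>
    by_cases hj : j < N - 1
    · rw [permIdx_of_lt s hj hr]; exact Fin.isLt _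
    · rwa [permIdx, dif_neg hj]

theorem permIdx_mul {N : ℕ} {lam : Fin N → ℕ} (s e : PermGroup lam) (j r : ℕ) :
    permIdx lam (s * e) j r = permIdx lam s j (permIdx lam e j r) := by
  cases j with
  | zero => rfl
  | succ j =>
    by_cases hj : j < N - 1
    · by_cases hr : r < lev lam (j + 1)
      · rw [permIdx_of_lt _ hj hr, permIdx_of_lt e hj hr, permIdx_of_lt _ hj (Fin.isLt _)]
        rfl
      · simp [permIdx, hr]
    · simp [permIdx, hj]

theorem permIdx_one {N : ℕ} {lam : Fin N → ℕ} (j r : ℕ) :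
    permIdx lam (1 : PermGroup lam) j r = r := by
  cases j with
  | zero => rfl
  | succ j => simp only [permIdx]; split_ifs <;> rfl

theorem permIdx_injective {N : ℕ} {lam : Fin N → ℕ} (s : PermGroup lam) (j : ℕ) :
    Function.Injective (permIdx lam s j) := fun r r' hr => by
  have := congrArg (permIdx lam s⁻¹ j) hr
  rwa [← permIdx_mul, ← permIdx_mul, inv_mul_cancel, permIdx_one, permIdx_one] at this

theorem allVars_permute_mul {N n : ℕ} {lam : Fin N → ℕ} (s e : PermGroup lam) (t : ℕ → ℕ → ℂ)
    (z : Fin n → ℂ) (j r : ℕ) :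
    allVars N (permute lam (s * e) t) z j r =
      allVars N (permute lam s t) z j (permIdx lam e j r) := by
  by_cases hj : j < N
  · simp only [allVars, hj, if_true, permute_apply, permIdx_mul]
  · simp only [allVars, hj, if_false, permIdx_of_le e (not_lt.1 hj)]

theorem allVars_permute {N n : ℕ} {lam : Fin N → ℕ} (σ : PermGroup lam) (t : ℕ → ℕ → ℂ)
    (z : Fin n → ℂ) (j r : ℕ) :
    allVars N (permute lam σ t) z j r = allVars N t z j (permIdx lam σ j r) := by
  have := allVars_permute_mul (1 : PermGroup lam) σ t z j r
  rw [one_mul] at this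
  rw [this]
  simp only [allVars, permute_apply, permIdx_one]

theorem permIdx_image_range {N : ℕ} {lam : Fin N → ℕ} (σ : PermGroup lam) (j : ℕ) :
    (Finset.range (lev lam j)).image (permIdx lam σ j) = Finset.range (lev lam j) := by
  apply Finset.eq_of_subset_of_card_le
  · intro r hr
    obtain ⟨a, ha, rfl⟩ := Finset.mem_image.1 hr
    exact Finset.mem_range.2 (permIdx_lt σ (Finset.mem_range.1 ha))
  · rw [Finset.card_image_of_injective _ (permIdx_injective σ j)]

theorem sum_range_permIdx {N : ℕ} {lam : Fin N → ℕ} (σ : PermGroup lam) (j : ℕ) (f : ℕ → ℂ) :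
    ∑ r ∈ Finset.range (lev lam j), f (permIdx lam σ j r) =
      ∑ r ∈ Finset.range (lev lam j), f r := by
  conv_rhs => rw [← permIdx_image_range σ j]
  rw [Finset.sum_image (permIdx_injective σ j).injOn]

/-- Two injections of `A` into `Fin m` differ by a permutation of `Fin m`. -/
theorem exists_perm_extend {ι : Type*} {m : ℕ} (A : Finset ι) {r r' : ι → ℕ}
    (hr : ∀ a ∈ A, r a < m) (hr' : ∀ a ∈ A, r' a < m) (hi : Set.InjOn r A)
    (hi' : Set.InjOn r' A) :
    ∃ e : Equiv.Perm (Fin m), ∀ a ∈ A, ∀ h : r a < m, (e ⟨r a, h⟩).val = r' a := by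
  classical
  let f : A → Fin m := fun a => ⟨r a, hr a a.2⟩
  let f' : A → Fin m := fun a => ⟨r' a, hr' a a.2⟩
  have hf : Function.Injective f := fun a b hab =>
    Subtype.ext (hi a.2 b.2 (congrArg Fin.val hab))
  have hf' : Function.Injective f' := fun a b hab =>
    Subtype.ext (hi' a.2 b.2 (congrArg Fin.val hab))
  let e : {x // x ∈ Set.range f} ≃ {x // x ∈ Set.range f'} :=
    (Equiv.ofInjective f hf).symm.trans (Equiv.ofInjective f' hf')
  refine ⟨e.extendSubtype, fun a ha h => ?_⟩
  have hmem : (⟨r a, h⟩ : Fin m) ∈ Set.range f := ⟨⟨a, ha⟩, rfl⟩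
  rw [Equiv.extendSubtype_apply_of_mem e _ hmem]
  have : (⟨⟨r a, h⟩, hmem⟩ : {x // x ∈ Set.range f}) = Equiv.ofInjective f hf ⟨a, ha⟩ := rfl
  rw [this]
  simp only [e, Equiv.trans_apply, Equiv.symm_apply_apply]
  rfl

/-- Two numberings of finite sets `A j` by indices of the level `j` differ by an element of the
symmetrization group. -/
theorem exists_permIdx {N : ℕ} {lam : Fin N → ℕ} {ι : Type*} (A : ℕ → Finset ι)
    {r r' : ℕ → ι → ℕ}
    (hr : ∀ j ∈ Finset.Icc 1 (N - 1), ∀ a ∈ A j, r j a < lev lam j)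
    (hr' : ∀ j ∈ Finset.Icc 1 (N - 1), ∀ a ∈ A j, r' j a < lev lam j)
    (hi : ∀ j ∈ Finset.Icc 1 (N - 1), Set.InjOn (r j) (A j))
    (hi' : ∀ j ∈ Finset.Icc 1 (N - 1), Set.InjOn (r' j) (A j)) :
    ∃ e : PermGroup lam, ∀ j ∈ Finset.Icc 1 (N - 1), ∀ a ∈ A j,
      permIdx lam e j (r j a) = r' j a := by
  have hm : ∀ j : Fin (N - 1), j.val + 1 ∈ Finset.Icc 1 (N - 1) := fun j =>
    Finset.mem_Icc.2 ⟨by omega, by omega⟩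
  choose e he using fun j : Fin (N - 1) => exists_perm_extend (A (j.val + 1)) (hr _ (hm j))
    (hr' _ (hm j)) (hi _ (hm j)) (hi' _ (hm j))
  refine ⟨e, fun j hj a ha => ?_⟩
  have hj' := Finset.mem_Icc.1 hj
  obtain ⟨j, rfl⟩ : ∃ i, j = i + 1 := ⟨j - 1, by omega⟩
  rw [permIdx_of_lt e (by omega) (hr _ hj a ha)]
  exact he ⟨j, by omega⟩ a ha _

/-- The variables labelled by `ι` instead of by indices: `r j a` is the index at level `j` of the
variable with the label `a`, and `s` permutes the indices. -/
def lab {N n : ℕ} {lam : Fin N → ℕ} (t : ℕ → ℕ → ℂ) (z : Fin n → ℂ) {ι : Type*} (r : ℕ → ι → ℕ)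
    (s : PermGroup lam) (j : ℕ) (a : ι) : ℂ :=
  allVars N (permute lam s t) z j (r j a)

/-- A sum over the symmetrization group does not depend on the numbering of the labels, as long as
the numberings agree at the top level, which is not symmetrized. -/
theorem sum_lab_eq {N n : ℕ} {lam : Fin N → ℕ} (t : ℕ → ℕ → ℂ) (z : Fin n → ℂ) {ι : Type*}
    (A : ℕ → Finset ι) {r r' : ℕ → ι → ℕ}
    (hr : ∀ j ∈ Finset.Icc 1 (N - 1), ∀ a ∈ A j, r j a < lev lam j)
    (hr' : ∀ j ∈ Finset.Icc 1 (N - 1), ∀ a ∈ A j, r' j a < lev lam j)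
    (hi : ∀ j ∈ Finset.Icc 1 (N - 1), Set.InjOn (r j) (A j))
    (hi' : ∀ j ∈ Finset.Icc 1 (N - 1), Set.InjOn (r' j) (A j))
    (hN : ∀ a ∈ A N, r N a = r' N a)
    (F : (ℕ → ι → ℂ) → ℂ)
    (hF : ∀ x x', (∀ j ∈ Finset.Icc 1 N, ∀ a ∈ A j, x j a = x' j a) → F x = F x') :
    ∑ s : PermGroup lam, F (lab t z r s) = ∑ s : PermGroup lam, F (lab t z r' s) := by
  obtain ⟨e, he⟩ := exists_permIdx A hr hr' hi hi'
  rw [← Equiv.sum_comp (Equiv.mulRight e)]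
  refine Finset.sum_congr rfl fun s _ => hF _ _ fun j hj a ha => ?_
  rw [lab, lab, Equiv.coe_mulRight, allVars_permute_mul]
  have hj' := Finset.mem_Icc.1 hj
  rcases hj'.2.lt_or_eq with h | rfl
  · rw [he j (Finset.mem_Icc.2 ⟨hj'.1, by omega⟩) a ha]
  · rw [permIdx_of_le e le_rfl, hN a ha]

/-! ### Inserting an extra column -/

theorem col_congr {N : ℕ} (h : ℂ) {P Q : Finset ℕ} {x x' y y' : ℕ → ℂ}
    (hx : ∀ i ∈ P, x i = x' i) (hy : ∀ j ∈ Q, y j = y' j) :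
    col N h P Q x y = col N h P Q x' y' :=
  Finset.prod_congr rfl fun i hi => Finset.prod_congr rfl fun j hj => by rw [hx i hi, hy j hj]

theorem col_union_right {N : ℕ} (h : ℂ) {P Q Q' : Finset ℕ} (hQ : Disjoint Q Q') (x y : ℕ → ℂ) :
    col N h P (Q ∪ Q') x y = col N h P Q x y * col N h P Q' x y := by
  simp only [col, Finset.prod_union hQ, Finset.prod_mul_distrib]

theorem col_union_left {N : ℕ} (h : ℂ) {P P' Q : Finset ℕ} (hP : Disjoint P P') (x y : ℕ → ℂ) :
    col N h (P ∪ P') Q x y = col N h P Q x y * col N h P' Q x y := by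
  simp only [col, Finset.prod_union hP]

theorem prod_swap_values (f : ℕ → ℂ → ℂ) {P Q S : Finset ℕ} (hP : S ⊆ P) (hQ : S ⊆ Q)
    {s s' y y' : ℕ → ℂ} (hs : ∀ j ∈ P, s' j = if j ∈ S then y j else s j)
    (hy : ∀ j ∈ Q, y' j = if j ∈ S then s j else y j) :
    (∏ j ∈ P, f j (s' j)) * ∏ j ∈ Q, f j (y' j) =
      (∏ j ∈ P, f j (s j)) * ∏ j ∈ Q, f j (y j) := by
  rw [← Finset.prod_sdiff hP, ← Finset.prod_sdiff hQ, ← Finset.prod_sdiff hP,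
    ← Finset.prod_sdiff hQ]
  have e1 : ∏ j ∈ P \ S, f j (s' j) = ∏ j ∈ P \ S, f j (s j) :=
    Finset.prod_congr rfl fun j hj => by
      have := Finset.mem_sdiff.1 hj
      rw [hs j this.1, if_neg this.2]
  have e2 : ∏ j ∈ Q \ S, f j (y' j) = ∏ j ∈ Q \ S, f j (y j) :=
    Finset.prod_congr rfl fun j hj => by
      have := Finset.mem_sdiff.1 hj
      rw [hy j this.1, if_neg this.2]
  have e3 : ∏ j ∈ S, f j (s' j) = ∏ j ∈ S, f j (y j) :=
    Finset.prod_congr rfl fun j hj => by rw [hs j (hP hj), if_pos hj]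
  have e4 : ∏ j ∈ S, f j (y' j) = ∏ j ∈ S, f j (s j) :=
    Finset.prod_congr rfl fun j hj => by rw [hy j (hQ hj), if_pos hj]
  rw [e1, e2, e3, e4]
  ring

/-- If two columns on the right of a third one exchange their variables at the levels in `S`, the
product of their interactions with the third column does not change. -/
theorem col_swap_right {N : ℕ} (h : ℂ) {P Q Q' S : Finset ℕ} (hQ : S ⊆ Q) (hQ' : S ⊆ Q')
    {x x' s s' y y' : ℕ → ℂ} (hx : ∀ i ∈ P, x' i = x i)
    (hs : ∀ j ∈ Q, s' j = if j ∈ S then y j else s j)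
    (hy : ∀ j ∈ Q', y' j = if j ∈ S then s j else y j) :
    col N h P Q x' s' * col N h P Q' x' y' = col N h P Q x s * col N h P Q' x y := by
  rw [col_congr h hx (fun _ _ => rfl), col_congr (Q := Q') h hx (fun _ _ => rfl)]
  simp only [col]
  rw [Finset.prod_comm, Finset.prod_comm (t := Q'), Finset.prod_comm (t := Q),
    Finset.prod_comm (t := Q')]
  exact prod_swap_values (fun j v => ∏ i ∈ P, inter N h i (x i) j v) hQ hQ' hs hy

/-- `col_swap_right` with the third column on the right. -/
theorem col_swap_left {N : ℕ} (h : ℂ) {P Q Q' S : Finset ℕ} (hQ : S ⊆ Q) (hQ' : S ⊆ Q')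
    {x x' s s' y y' : ℕ → ℂ} (hx : ∀ i ∈ P, x' i = x i)
    (hs : ∀ j ∈ Q, s' j = if j ∈ S then y j else s j)
    (hy : ∀ j ∈ Q', y' j = if j ∈ S then s j else y j) :
    col N h Q P s' x' * col N h Q' P y' x' = col N h Q P s x * col N h Q' P y x := by
  rw [col_congr (P := Q) h (fun _ _ => rfl) hx, col_congr (P := Q') h (fun _ _ => rfl) hx]
  exact prod_swap_values (fun j v => ∏ i ∈ P, inter N h j v i (x i)) hQ hQ' hs hy

theorem prod_pairs_split {n : ℕ} (f : Fin n → Fin n → ℂ) (c : Fin n) :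
    (∏ a : Fin n, ∏ b ∈ Finset.univ.filter (fun b : Fin n => a < b), f a b) =
      (∏ a ∈ Finset.univ.erase c, ∏ b ∈ (Finset.univ.filter (fun b : Fin n => a < b)).erase c,
        f a b) * ((∏ a ∈ Finset.univ.filter (fun a : Fin n => a < c), f a c) *
        ∏ b ∈ Finset.univ.filter (fun b : Fin n => c < b), f c b) := by
  rw [← Finset.mul_prod_erase Finset.univ _ (Finset.mem_univ c)]
  have h1 : ∀ a ∈ Finset.univ.erase c, (∏ b ∈ Finset.univ.filter (fun b : Fin n => a < b), f a b)
      = (∏ b ∈ (Finset.univ.filter (fun b : Fin n => a < b)).erase c, f a b) *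
        (if a < c then f a c else 1) := by
    intro a _
    split_ifs with hac
    · rw [mul_comm, Finset.mul_prod_erase _ _ (by simp [hac])]
    · rw [mul_one, Finset.erase_eq_of_notMem (by simp [hac])]
  rw [Finset.prod_congr rfl h1, Finset.prod_mul_distrib]
  have h2 : (∏ a ∈ Finset.univ.erase c, if a < c then f a c else 1) =
      ∏ a ∈ Finset.univ.filter (fun a : Fin n => a < c), f a c := by
    rw [Finset.prod_ite, Finset.prod_const_one, mul_one]
    refine Finset.prod_congr ?_ fun _ _ => rfl
    ext a
    simp only [Finset.mem_filter, Finset.mem_erase, Finset.mem_univ, and_true, true_and]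
    exact ⟨fun h => h.2, fun h => ⟨h.ne, h⟩⟩
  rw [h2]
  ring

/-- The interaction of an extra column `s`, with variables at the levels `α + 1, …, β`, inserted at
the position `c`, with the columns of all positions other than `c`. -/
def ins {N n : ℕ} (J : Fin n → Fin N) (α β : ℕ) (h : ℂ) (x : ℕ → Fin n → ℂ) (s : ℕ → ℂ)
    (c : Fin n) : ℂ :=
  (∏ a ∈ Finset.univ.filter (fun a : Fin n => a < c),
      col N h (supp J a) (Finset.Ioc α β) (fun i => x i a) s) *
    ∏ a ∈ Finset.univ.filter (fun a : Fin n => c < a),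
      col N h (Finset.Ioc α β) (supp J a) s (fun i => x i a)

/-- The interaction of an extra column `s`, with variables at the levels `α + 1, …, β`, inserted
just before the position `m`, with the columns of all positions. -/
def cutProd {N n : ℕ} (J : Fin n → Fin N) (α β : ℕ) (h : ℂ) (x : ℕ → Fin n → ℂ) (s : ℕ → ℂ)
    (m : ℕ) : ℂ :=
  ∏ a : Fin n, if a.val < m then col N h (supp J a) (Finset.Ioc α β) (fun i => x i a) s
    else col N h (Finset.Ioc α β) (supp J a) s (fun i => x i a)

theorem prod_erase_lt {n : ℕ} (f g : Fin n → ℂ) (c : Fin n) :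
    (∏ a ∈ Finset.univ.erase c, if a < c then f a else g a) =
      (∏ a ∈ Finset.univ.filter (fun a : Fin n => a < c), f a) *
        ∏ a ∈ Finset.univ.filter (fun a : Fin n => c < a), g a := by
  rw [Finset.prod_ite]
  congr 1
  · refine Finset.prod_congr ?_ fun _ _ => rfl
    ext a
    simp only [Finset.mem_filter, Finset.mem_erase, Finset.mem_univ, and_true, true_and]
    exact ⟨fun h => h.2, fun h => ⟨h.ne, h⟩⟩
  · refine Finset.prod_congr ?_ fun _ _ => rfl
    ext a
    simp only [Finset.mem_filter, Finset.mem_erase, Finset.mem_univ, and_true, true_and]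
    exact ⟨fun h => lt_of_le_of_ne (not_lt.1 h.2) (Ne.symm h.1), fun h => ⟨h.ne', h.not_gt⟩⟩

theorem cutProd_succ {N n : ℕ} (J : Fin n → Fin N) (α β : ℕ) (h : ℂ) (x : ℕ → Fin n → ℂ)
    (s : ℕ → ℂ) (c : Fin n) :
    cutProd J α β h x s (c.val + 1) = ins J α β h x s c *
      col N h (supp J c) (Finset.Ioc α β) (fun i => x i c) s := by
  rw [cutProd, ← Finset.mul_prod_erase Finset.univ _ (Finset.mem_univ c), ins, ← prod_erase_lt,
    if_pos (Nat.lt_succ_self _), mul_comm]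
  congr 1
  refine Finset.prod_congr rfl fun a ha => ?_
  have hac : a ≠ c := (Finset.mem_erase.1 ha).1
  have : a.val < c.val + 1 ↔ a < c := by
    rw [Nat.lt_succ_iff, Fin.val_fin_le]; exact ⟨fun h => lt_of_le_of_ne h hac, le_of_lt⟩
  simp only [this]

theorem cutProd_val {N n : ℕ} (J : Fin n → Fin N) (α β : ℕ) (h : ℂ) (x : ℕ → Fin n → ℂ)
    (s : ℕ → ℂ) (c : Fin n) :
    cutProd J α β h x s c.val = ins J α β h x s c *
      col N h (Finset.Ioc α β) (supp J c) s (fun i => x i c) := by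
  rw [cutProd, ← Finset.mul_prod_erase Finset.univ _ (Finset.mem_univ c), ins, ← prod_erase_lt,
    if_neg (lt_irrefl _), mul_comm]
  congr 1

/-- An extra column below the column of `c`, inserted at `c`, extends it: the position `c` gets the
colour `α`. -/
theorem V_mul_ins {N n : ℕ} (J : Fin n → Fin N) (α : Fin N) (h : ℂ) {x x' : ℕ → Fin n → ℂ}
    {s : ℕ → ℂ} {c : Fin n} (hα : α < J c)
    (hx : ∀ a ≠ c, ∀ i ∈ supp J a, x' i a = x i a) (hc : ∀ i ∈ supp J c, x' i c = x i c)
    (hs : ∀ i ∈ Finset.Ioc α.val (J c).val, x' i c = s i) :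
    V J h x * ins J α (J c) h x s c = V (Function.update J c α) h x' := by
  have hα' : α.val < (J c).val := hα
  have hsc : supp (Function.update J c α) c = Finset.Ioc α.val (J c).val ∪ supp J c := by
    ext l
    simp only [supp, Function.update_self, Finset.mem_union, Finset.mem_Ioc]
    omega
  have hdisj : Disjoint (Finset.Ioc α.val (J c).val) (supp J c) := by
    rw [Finset.disjoint_left]
    intro l hl hl'
    simp only [supp, Finset.mem_Ioc] at hl hl'
    omega
  have hsa : ∀ a ≠ c, supp (Function.update J c α) a = supp J a := fun a ha => by
    simp [supp, Function.update_of_ne ha]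
  rw [V, V, prod_pairs_split _ c, prod_pairs_split _ c, ins]
  have e1 : (∏ a ∈ Finset.univ.erase c,
      ∏ b ∈ (Finset.univ.filter (fun b : Fin n => a < b)).erase c,
        col N h (supp (Function.update J c α) a) (supp (Function.update J c α) b)
          (fun i => x' i a) (fun i => x' i b)) =
      ∏ a ∈ Finset.univ.erase c,
      ∏ b ∈ (Finset.univ.filter (fun b : Fin n => a < b)).erase c,
        col N h (supp J a) (supp J b) (fun i => x i a) (fun i => x i b) := by
    refine Finset.prod_congr rfl fun a ha => Finset.prod_congr rfl fun b hb => ?_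
    have ha' := (Finset.mem_erase.1 ha).1
    have hb' := (Finset.mem_erase.1 hb).1
    rw [hsa a ha', hsa b hb']
    exact col_congr h (hx a ha') (hx b hb')
  have e2 : (∏ a ∈ Finset.univ.filter (fun a : Fin n => a < c),
        col N h (supp (Function.update J c α) a) (supp (Function.update J c α) c)
          (fun i => x' i a) (fun i => x' i c)) =
      (∏ a ∈ Finset.univ.filter (fun a : Fin n => a < c),
        col N h (supp J a) (Finset.Ioc α.val (J c).val) (fun i => x i a) s) *
      ∏ a ∈ Finset.univ.filter (fun a : Fin n => a < c),
        col N h (supp J a) (supp J c) (fun i => x i a) (fun i => x i c) := by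
    rw [← Finset.prod_mul_distrib]
    refine Finset.prod_congr rfl fun a ha => ?_
    have ha' : a ≠ c := (Finset.mem_filter.1 ha).2.ne
    rw [hsa a ha', hsc, col_union_right h hdisj]
    exact congrArg₂ (· * ·) (col_congr h (hx a ha') hs) (col_congr h (hx a ha') hc)
  have e3 : (∏ a ∈ Finset.univ.filter (fun a : Fin n => c < a),
        col N h (supp (Function.update J c α) c) (supp (Function.update J c α) a)
          (fun i => x' i c) (fun i => x' i a)) =
      (∏ a ∈ Finset.univ.filter (fun a : Fin n => c < a),
        col N h (Finset.Ioc α.val (J c).val) (supp J a) s (fun i => x i a)) *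
      ∏ a ∈ Finset.univ.filter (fun a : Fin n => c < a),
        col N h (supp J c) (supp J a) (fun i => x i c) (fun i => x i a) := by
    rw [← Finset.prod_mul_distrib]
    refine Finset.prod_congr rfl fun a ha => ?_
    have ha' : a ≠ c := (Finset.mem_filter.1 ha).2.ne'
    rw [hsa a ha', hsc, col_union_left h hdisj]
    exact congrArg₂ (· * ·) (col_congr h hs (hx a ha')) (col_congr h hc (hx a ha'))
  rw [e1, e2, e3]
  ring

/-- The product of `V` and `ins` is unchanged if the extra column and the column of `c` exchange
their variables at common levels. Their interaction with each other is left out of this product. -/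
theorem V_mul_ins_swap {N n : ℕ} (J : Fin n → Fin N) (α β : ℕ) (h : ℂ) {x x' : ℕ → Fin n → ℂ}
    {s s' : ℕ → ℂ} {c : Fin n} {S : Finset ℕ} (hS : S ⊆ Finset.Ioc α β) (hS' : S ⊆ supp J c)
    (hx : ∀ a ≠ c, ∀ i ∈ supp J a, x' i a = x i a)
    (hs : ∀ i ∈ Finset.Ioc α β, s' i = if i ∈ S then x i c else s i)
    (hc : ∀ i ∈ supp J c, x' i c = if i ∈ S then s i else x i c) :
    V J h x' * ins J α β h x' s' c = V J h x * ins J α β h x s c := by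
  have e : ∀ (x : ℕ → Fin n → ℂ) (s : ℕ → ℂ), V J h x * ins J α β h x s c =
      (∏ a ∈ Finset.univ.erase c, ∏ b ∈ (Finset.univ.filter (fun b : Fin n => a < b)).erase c,
        col N h (supp J a) (supp J b) (fun i => x i a) (fun i => x i b)) *
      ((∏ a ∈ Finset.univ.filter (fun a : Fin n => a < c),
        col N h (supp J a) (Finset.Ioc α β) (fun i => x i a) s *
          col N h (supp J a) (supp J c) (fun i => x i a) (fun i => x i c)) *
      ∏ a ∈ Finset.univ.filter (fun a : Fin n => c < a),
        (col N h (Finset.Ioc α β) (supp J a) s (fun i => x i a) *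
          col N h (supp J c) (supp J a) (fun i => x i c) (fun i => x i a))) := by
    intro x s
    rw [V, prod_pairs_split _ c, ins, Finset.prod_mul_distrib, Finset.prod_mul_distrib]
    ring
  rw [e, e]
  refine congrArg₂ (· * ·) ?_ (congrArg₂ (· * ·) ?_ ?_)
  · refine Finset.prod_congr rfl fun a ha => Finset.prod_congr rfl fun b hb => ?_
    exact col_congr h (hx a (Finset.mem_erase.1 ha).1) (hx b (Finset.mem_erase.1 hb).1)
  · refine Finset.prod_congr rfl fun a ha => ?_
    exact col_swap_right h hS hS' (hx a (Finset.mem_filter.1 ha).2.ne) hs hc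
  · refine Finset.prod_congr rfl fun a ha => ?_
    exact col_swap_left h hS hS' (hx a (Finset.mem_filter.1 ha).2.ne') hs hc

/-! ### The interaction of a column with the extra column -/

theorem Ioc_subset_Icc_one {N α β : ℕ} (hβ : β < N) : Finset.Ioc α β ⊆ Finset.Icc 1 N := by
  intro l hl
  simp only [Finset.mem_Ioc, Finset.mem_Icc] at hl ⊢
  omega

theorem Ioc_subset_Icc_one' {N k : ℕ} : Finset.Ioc k N ⊆ Finset.Icc 1 N := by
  intro l hl
  simp only [Finset.mem_Ioc, Finset.mem_Icc] at hl ⊢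
  omega

/-- A column with colour above `β` does not interact with the extra column. -/
theorem col_eq_one_of_lt {N α β k : ℕ} (h : ℂ) (hk : β < k) (x s : ℕ → ℂ) :
    col N h (Finset.Ioc k N) (Finset.Ioc α β) x s = 1 ∧
      col N h (Finset.Ioc α β) (Finset.Ioc k N) s x = 1 := by
  constructor
  all_goals
    refine Finset.prod_eq_one fun i hi => Finset.prod_eq_one fun j hj => ?_
    have hi' := Finset.mem_Ioc.1 hi
    have hj' := Finset.mem_Ioc.1 hj
    rw [inter, if_neg (by omega), if_neg (by omega), if_neg (by omega)]
    ring

/-- A column with colour `β` interacts with the extra column only through the adjacent levels `β`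
and `β + 1`. -/
theorem col_adjacent {N α β : ℕ} (h : ℂ) (hα : α < β) (hβ : β < N) (x s : ℕ → ℂ) :
    col N h (Finset.Ioc β N) (Finset.Ioc α β) x s = s β - x (β + 1) ∧
      col N h (Finset.Ioc α β) (Finset.Ioc β N) s x = s β - x (β + 1) - h := by
  have hm : β ∈ Finset.Icc 1 (N - 1) := Finset.mem_Icc.2 ⟨by omega, by omega⟩
  constructor
  · rw [col_eq_prod_levels h Ioc_subset_Icc_one' (Ioc_subset_Icc_one hβ),
      Finset.prod_eq_single_of_mem β hm]
    · simp only [Finset.mem_Ioc]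
      rw [if_neg (by omega), if_pos (by omega), if_neg (by omega)]
      ring
    · intro l _ hl
      simp only [Finset.mem_Ioc]
      rw [if_neg (by omega), if_neg (by omega), if_neg (by omega)]
      ring
  · rw [col_eq_prod_levels h (Ioc_subset_Icc_one hβ) Ioc_subset_Icc_one',
      Finset.prod_eq_single_of_mem β hm]
    · simp only [Finset.mem_Ioc]
      rw [if_pos (by omega), if_neg (by omega), if_neg (by omega)]
      ring
    · intro l _ hl
      simp only [Finset.mem_Ioc]
      rw [if_neg (by omega), if_neg (by omega), if_neg (by omega)]
      ring

theorem prod_levels_up {N α β k : ℕ} (hα : α < β) (hβ : β < N) (f : ℕ → ℂ) :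
    (∏ l ∈ Finset.Icc 1 (N - 1),
        if l ∈ Finset.Ioc k N ∧ l + 1 ∈ Finset.Ioc α β then f l else 1) =
      (if k < α then f α else 1) * ∏ l ∈ Finset.Ico (max α k + 1) β, f l := by
  rw [← Finset.prod_filter]
  split_ifs with h1
  · rw [← Finset.prod_insert (by simp)]
    refine Finset.prod_congr ?_ fun _ _ => rfl
    ext l
    simp only [Finset.mem_filter, Finset.mem_Icc, Finset.mem_Ioc, Finset.mem_insert,
      Finset.mem_Ico]
    omega
  · rw [one_mul]
    refine Finset.prod_congr ?_ fun _ _ => rfl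
    ext l
    simp only [Finset.mem_filter, Finset.mem_Icc, Finset.mem_Ioc, Finset.mem_Ico]
    omega

theorem prod_levels_down {N α β k : ℕ} (hα : α < β) (hβ : β < N) (hk : k < β) (f : ℕ → ℂ) :
    (∏ l ∈ Finset.Icc 1 (N - 1),
        if l ∈ Finset.Ioc α β ∧ l + 1 ∈ Finset.Ioc k N then f l else 1) =
      (if α < k then f k else 1) * (∏ l ∈ Finset.Ico (max α k + 1) β, f l) * f β := by
  rw [← Finset.prod_filter, mul_assoc, ← Finset.prod_Ico_succ_top (by omega)]
  split_ifs with h1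
  · rw [← Finset.prod_insert (by simp)]
    refine Finset.prod_congr ?_ fun _ _ => rfl
    ext l
    simp only [Finset.mem_filter, Finset.mem_Icc, Finset.mem_Ioc, Finset.mem_insert,
      Finset.mem_Ico]
    omega
  · rw [one_mul]
    refine Finset.prod_congr ?_ fun _ _ => rfl
    ext l
    simp only [Finset.mem_filter, Finset.mem_Icc, Finset.mem_Ioc, Finset.mem_Ico]
    omega

theorem prod_levels_same {N α β k : ℕ} (hα : α < β) (hβ : β < N) (f : ℕ → ℂ) :
    (∏ l ∈ Finset.Icc 1 (N - 1),
        if l ∈ Finset.Ioc α β ∧ l ∈ Finset.Ioc k N then f l else 1) =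
      ∏ l ∈ Finset.Ico (max α k + 1) (β + 1), f l := by
  rw [← Finset.prod_filter]
  refine Finset.prod_congr ?_ fun _ _ => rfl
  ext l
  simp only [Finset.mem_filter, Finset.mem_Icc, Finset.mem_Ioc, Finset.mem_Ico]
  omega

/-- The interaction of a column with colour `k < β` with the extra column, in both orders, as a
chain over the common levels, times the factors at the two ends of the chain. The lower end depends
on which of the two columns reaches further down. -/
theorem col_eq_chain {Ω : Type*} {N α β k : ℕ} (h : ℂ) (hα : α < β) (hβ : β < N) (hk : k < β)
    (s y : ℕ → Ω → ℂ) (ω : Ω) :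
    col N h (Finset.Ioc k N) (Finset.Ioc α β) (fun i => y i ω) (fun i => s i ω) =
      ((if k < α then y α ω - s (α + 1) ω - h else 1) *
        (if α < k then s k ω - y (k + 1) ω else 1)) * chain h s y (max α k + 1) β ω *
          (s β ω - y (β + 1) ω) ∧
    col N h (Finset.Ioc α β) (Finset.Ioc k N) (fun i => s i ω) (fun i => y i ω) =
      ((if k < α then y α ω - s (α + 1) ω else 1) *
        (if α < k then s k ω - y (k + 1) ω - h else 1)) * chain h y s (max α k + 1) β ω *
          (s β ω - y (β + 1) ω - h) := by
  constructor
  · rw [col_eq_prod_levels h Ioc_subset_Icc_one' (Ioc_subset_Icc_one hβ),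
      Finset.prod_mul_distrib, Finset.prod_mul_distrib]
    rw [prod_levels_up hα hβ (fun l => y l ω - s (l + 1) ω - h),
      prod_levels_down hα hβ hk (fun l => s l ω - y (l + 1) ω)]
    simp only [and_comm (a := _ ∈ Finset.Ioc k N)]
    rw [prod_levels_same hα hβ (fun l => (s l ω - y l ω - h) / (s l ω - y l ω)), chain]
    simp only [pairLink, pairRatio, Finset.prod_mul_distrib]
    ring
  · rw [col_eq_prod_levels h (Ioc_subset_Icc_one hβ) Ioc_subset_Icc_one',
      Finset.prod_mul_distrib, Finset.prod_mul_distrib]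
    rw [prod_levels_up hα hβ (fun l => y l ω - s (l + 1) ω),
      prod_levels_down hα hβ hk (fun l => s l ω - y (l + 1) ω - h)]
    rw [prod_levels_same hα hβ (fun l => (y l ω - s l ω - h) / (y l ω - s l ω)), chain]
    simp only [pairLink, pairRatio, Finset.prod_mul_distrib]
    ring

/-! ### Moving the extra column under the symmetrization -/

/-- The indices of the variables of all positions, labelled by `some a`, and of the extra column,
labelled by `none`, which consists of the last variables of the levels. -/
def extRank {N n : ℕ} (lam : Fin N → ℕ) (J : Fin n → Fin N) (j : ℕ) : Option (Fin n) → ℕ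
  | none => lev lam j - 1
  | some a => rank J j a

open scoped Classical in
/-- The labels that have a variable at the level `j`. -/
def extSet {N n : ℕ} (J : Fin n → Fin N) (α β : ℕ) (j : ℕ) : Finset (Option (Fin n)) :=
  Finset.univ.filter fun o => o.elim (j ∈ Finset.Ioc α β) (fun a => a ∈ unionTo J j)

theorem some_mem_extSet {N n : ℕ} {J : Fin n → Fin N} {α β j : ℕ} {a : Fin n} :
    some a ∈ extSet J α β j ↔ a ∈ unionTo J j := by simp [extSet]

theorem none_mem_extSet {N n : ℕ} {J : Fin n → Fin N} {α β j : ℕ} :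
    none ∈ extSet J α β j ↔ j ∈ Finset.Ioc α β := by simp [extSet]

/-- The colouring `J` uses one variable fewer than `λ` provides at each of the levels `α + 1, …, β`,
and all variables at the other levels. -/
def IsShort {N n : ℕ} (lam : Fin N → ℕ) (J : Fin n → Fin N) (α β : ℕ) : Prop :=
  ∀ j ≤ N, (unionTo J j).card + (if j ∈ Finset.Ioc α β then 1 else 0) = lev lam j

theorem extRank_lt {N n : ℕ} {lam : Fin N → ℕ} {J : Fin n → Fin N} {α β j : ℕ}
    (hJ : IsShort lam J α β) (hj : j ≤ N) {o : Option (Fin n)} (ho : o ∈ extSet J α β j) :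
    extRank lam J j o < lev lam j := by
  have h := hJ j hj
  cases o with
  | none =>
    rw [none_mem_extSet] at ho
    rw [if_pos ho] at h
    simp only [extRank]; omega
  | some a =>
    rw [some_mem_extSet] at ho
    have := rank_lt ho
    simp only [extRank]; omega

theorem extRank_injOn {N n : ℕ} {lam : Fin N → ℕ} {J : Fin n → Fin N} {α β j : ℕ}
    (hJ : IsShort lam J α β) (hj : j ≤ N) : Set.InjOn (extRank lam J j) (extSet J α β j) := by
  have h := hJ j hj
  have key : ∀ a, some a ∈ extSet J α β j → none ∈ extSet J α β j →
      rank J j a ≠ lev lam j - 1 := by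
    intro a ha hn
    rw [none_mem_extSet] at hn
    rw [if_pos hn] at h
    have := rank_lt (some_mem_extSet.1 ha)
    omega
  intro o ho o' ho' hoo'
  rw [Finset.mem_coe] at ho ho'
  cases o with
  | none =>
    cases o' with
    | none => rfl
    | some a => exact absurd hoo'.symm (key a ho' ho)
  | some a =>
    cases o' with
    | none => exact absurd hoo' (key a ho ho')
    | some b => exact congrArg some (rank_injOn J j (some_mem_extSet.1 ho)
        (some_mem_extSet.1 ho') hoo')

theorem mem_supp_iff {N n : ℕ} {J : Fin n → Fin N} {a : Fin n} {l : ℕ} :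
    l ∈ supp J a ↔ a ∈ unionTo J l ∧ l ≤ N := by
  simp [supp, unionTo]

/-- Some element of the symmetrization group exchanges the variables of the extra column and of the
column of `c` at a given set of common levels and fixes all other variables. -/
theorem exists_column_swap {N n : ℕ} {lam : Fin N → ℕ} {J : Fin n → Fin N} {α β : ℕ}
    (hβ : β < N) (hJ : IsShort lam J α β) (t : ℕ → ℕ → ℂ) (z : Fin n → ℂ) (c : Fin n)
    {S : Finset ℕ} (hS : S ⊆ Finset.Ioc α β) (hS' : S ⊆ supp J c) :
    ∃ e : PermGroup lam, ∀ σ : PermGroup lam,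
      (∀ i ∈ Finset.Ioc α β, lab t z (extRank lam J) (σ * e) i none =
        if i ∈ S then lab t z (extRank lam J) σ i (some c) else lab t z (extRank lam J) σ i none) ∧
      (∀ i ∈ supp J c, lab t z (extRank lam J) (σ * e) i (some c) =
        if i ∈ S then lab t z (extRank lam J) σ i none else lab t z (extRank lam J) σ i (some c)) ∧
      ∀ a ≠ c, ∀ i ∈ supp J a, lab t z (extRank lam J) (σ * e) i (some a) =
        lab t z (extRank lam J) σ i (some a) := by
  classical
  -- The numbering of the labels with `some c` and `none` exchanged at the levels in `S`.
  let w : ℕ → Option (Fin n) → Option (Fin n) := fun j o =>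
    if j ∈ S then Equiv.swap (some c) none o else o
  have hw : ∀ j o, o ∈ extSet J α β j → w j o ∈ extSet J α β j := by
    intro j o ho
    by_cases hj : j ∈ S
    · simp only [w, if_pos hj]
      rw [Equiv.swap_apply_def]
      split_ifs
      · exact none_mem_extSet.2 (hS hj)
      · exact some_mem_extSet.2 (mem_supp_iff.1 (hS' hj)).1
      · exact ho
    · simpa only [w, if_neg hj] using ho
  have hwi : ∀ j, Function.Injective (w j) := by
    intro j
    by_cases hj : j ∈ S
    · simp only [w, if_pos hj]; exact (Equiv.swap _ _).injective
    · simp only [w, if_neg hj]; exact fun _ _ h => h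
  have hle : ∀ j ∈ Finset.Icc 1 (N - 1), j ≤ N := fun j hj => by
    have := Finset.mem_Icc.1 hj
    omega
  obtain ⟨e, he⟩ := exists_permIdx (lam := lam) (extSet J α β) (r := extRank lam J)
    (r' := fun j o => extRank lam J j (w j o))
    (fun j hj o ho => extRank_lt hJ (hle j hj) ho)
    (fun j hj o ho => extRank_lt hJ (hle j hj) (hw j o ho))
    (fun j hj => extRank_injOn hJ (hle j hj))
    (fun j hj o ho o' ho' h => hwi j (extRank_injOn hJ (hle j hj) (hw j o ho) (hw j o' ho') h))
  have key : ∀ σ : PermGroup lam, ∀ i ∈ Finset.Icc 1 N, ∀ o ∈ extSet J α β i,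
      lab t z (extRank lam J) (σ * e) i o = lab t z (extRank lam J) σ i (w i o) := by
    intro σ i hi o ho
    have hi' := Finset.mem_Icc.1 hi
    rw [lab, lab, allVars_permute_mul]
    rcases hi'.2.lt_or_eq with h | rfl
    · rw [he i (Finset.mem_Icc.2 ⟨hi'.1, by omega⟩) o ho]
    · have : i ∉ S := fun h => by
        have := Finset.mem_Ioc.1 (hS h)
        omega
      rw [permIdx_of_le e le_rfl]
      simp only [w, if_neg this]
  have h1 : ∀ i ∈ Finset.Ioc α β, i ∈ Finset.Icc 1 N := fun i hi => Ioc_subset_Icc_one hβ hi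
  refine ⟨e, fun σ => ⟨fun i hi => ?_, fun i hi => ?_, fun a ha i hi => ?_⟩⟩
  · rw [key σ i (h1 i hi) none (none_mem_extSet.2 hi)]
    by_cases hj : i ∈ S <;> simp [w, hj]
  · rw [key σ i (supp_subset J c hi) _ (some_mem_extSet.2 (mem_supp_iff.1 hi).1)]
    by_cases hj : i ∈ S <;> simp [w, hj]
  · rw [key σ i (supp_subset J a hi) _ (some_mem_extSet.2 (mem_supp_iff.1 hi).1)]
    by_cases hj : i ∈ S
    · simp only [w, if_pos hj]
      rw [Equiv.swap_apply_of_ne_of_ne (by simpa using ha) (by simp)]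
    · simp [w, hj]

/-- The variables of each symmetrized level are pairwise distinct, so that no denominator of the
weight functions vanishes. -/
def Distinct {N : ℕ} (lam : Fin N → ℕ) (t : ℕ → ℕ → ℂ) : Prop :=
  ∀ j ∈ Finset.Icc 1 (N - 1), ∀ a < lev lam j, ∀ b < lev lam j, a ≠ b → t j a ≠ t j b

/-- Moving the extra column past a column of colour less than `β` does not change the
symmetrization. -/
theorem sum_cut_eq_zero {N n : ℕ} {lam : Fin N → ℕ} {J : Fin n → Fin N} {α β : ℕ}
    (hα : α < β) (hβ : β < N) (hJ : IsShort lam J α β) (h : ℂ) {t : ℕ → ℕ → ℂ}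
    (ht : Distinct lam t) (z : Fin n → ℂ) (c : Fin n) (hc : (J c).val < β) :
    ∑ σ : PermGroup lam, V J h (fun j a => lab t z (extRank lam J) σ j (some a)) *
      ins J α β h (fun j a => lab t z (extRank lam J) σ j (some a))
        (fun j => lab t z (extRank lam J) σ j none) c *
      (col N h (supp J c) (Finset.Ioc α β) (fun j => lab t z (extRank lam J) σ j (some c))
          (fun j => lab t z (extRank lam J) σ j none) -
        col N h (Finset.Ioc α β) (supp J c) (fun j => lab t z (extRank lam J) σ j none)
          (fun j => lab t z (extRank lam J) σ j (some c))) = 0 := by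
  classical
  set k := (J c).val with hk
  set m := max α k + 1 with hm
  have hmβ : m ≤ β := by omega
  have hKs : Finset.Icc m β ⊆ Finset.Ioc α β := fun i hi => by
    simp only [Finset.mem_Icc, Finset.mem_Ioc] at hi ⊢; omega
  have hKc : Finset.Icc m β ⊆ supp J c := fun i hi => by
    simp only [supp, Finset.mem_Icc, Finset.mem_Ioc] at hi ⊢; omega
  have hex : ∀ S : Finset ℕ, ∃ e : PermGroup lam, S ⊆ Finset.Icc m β → ∀ σ : PermGroup lam,
      (∀ i ∈ Finset.Ioc α β, lab t z (extRank lam J) (σ * e) i none =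
        if i ∈ S then lab t z (extRank lam J) σ i (some c) else lab t z (extRank lam J) σ i none) ∧
      (∀ i ∈ supp J c, lab t z (extRank lam J) (σ * e) i (some c) =
        if i ∈ S then lab t z (extRank lam J) σ i none else lab t z (extRank lam J) σ i (some c)) ∧
      ∀ a ≠ c, ∀ i ∈ supp J a, lab t z (extRank lam J) (σ * e) i (some a) =
        lab t z (extRank lam J) σ i (some a) := by
    intro S
    by_cases hS : S ⊆ Finset.Icc m β
    · obtain ⟨e, he⟩ := exists_column_swap hβ hJ t z c (hS.trans hKs) (hS.trans hKc)
      exact ⟨e, fun _ => he⟩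
    · exact ⟨1, fun h => absurd h hS⟩
  choose e he using hex
  set s : ℕ → PermGroup lam → ℂ := fun j σ => lab t z (extRank lam J) σ j none with hs
  set y : ℕ → PermGroup lam → ℂ := fun j σ => lab t z (extRank lam J) σ j (some c) with hy
  let lB : PermGroup lam → ℂ := fun ω => (if k < α then y α ω - s (α + 1) ω - h else 1) *
        (if α < k then s k ω - y (k + 1) ω else 1)
  let lA : PermGroup lam → ℂ := fun ω => (if k < α then y α ω - s (α + 1) ω else 1) *
        (if α < k then s k ω - y (k + 1) ω - h else 1)
  let τ : Finset ℕ → Equiv.Perm (PermGroup lam) := fun S => Equiv.mulRight (e S)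
  have hsτ : ∀ S ⊆ Finset.Icc m β, ∀ i ∈ Finset.Ioc α β, ∀ ω,
      s i (τ S ω) = if i ∈ S then y i ω else s i ω := fun S hS i hi ω => (he S hS ω).1 i hi
  have hyτ : ∀ S ⊆ Finset.Icc m β, ∀ i ∈ supp J c, ∀ ω,
      y i (τ S ω) = if i ∈ S then s i ω else y i ω := fun S hS i hi ω => (he S hS ω).2.1 i hi
  have hends := sum_chain_ends h hmβ τ (s := s) (y := y)
    (fun S hS j hj ω => ⟨hsτ S hS j (hKs hj) ω, hyτ S hS j (hKc hj) ω⟩)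
    (fun i hi ω => by
      have hi' := Finset.mem_Icc.1 hi
      have hiN : i < N := by omega
      have him : i ∈ Finset.Icc 1 (N - 1) := Finset.mem_Icc.2 ⟨by omega, by omega⟩
      have hn : none ∈ extSet J α β i := none_mem_extSet.2 (hKs hi)
      have hcm : some c ∈ extSet J α β i := some_mem_extSet.2 (mem_supp_iff.1 (hKc hi)).1
      simp only [hs, hy, lab, allVars, hiN, if_true, permute_apply]
      refine ht i him _ (permIdx_lt ω (extRank_lt hJ hiN.le hn)) _
        (permIdx_lt ω (extRank_lt hJ hiN.le hcm)) fun hEq => ?_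
      have := extRank_injOn hJ hiN.le hn hcm (permIdx_injective ω i hEq)
      cases this)
    (fun σ => V J h (fun j a => lab t z (extRank lam J) σ j (some a)) *
      ins J α β h (fun j a => lab t z (extRank lam J) σ j (some a))
        (fun j => lab t z (extRank lam J) σ j none) c) (y (β + 1)) lB lA
    (fun S hS ω => V_mul_ins_swap J α β h (hS.trans hKs) (hS.trans hKc)
      (he S hS ω).2.2 (he S hS ω).1 (he S hS ω).2.1)
    (fun S hS ω => by
      have hb : β + 1 ∈ supp J c := by
        simp only [supp, Finset.mem_Ioc]; omega
      have hb' : β + 1 ∉ S := fun hb => by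
        have := Finset.mem_Icc.1 (hS hb)
        omega
      rw [hyτ S hS _ hb, if_neg hb'])
    -- The sign `ε` depends on which column reaches further down; for `k = α` the lower end has no
    -- factor.
    (if k < α then -1 else if α < k then 1 else 0)
    (fun ω => by
      simp only [lB, lA]
      rcases lt_trichotomy k α with hka | hka | hka
      · have hm' : m = α + 1 := by omega
        have hα1 : α + 1 ∈ Finset.Icc m β := Finset.mem_Icc.2 ⟨by omega, by omega⟩
        have hα0 : α ∈ supp J c := by
          simp only [supp, Finset.mem_Ioc]; omega
        have hα2 : α ∉ Finset.Icc m β := fun hb => by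
          have := Finset.mem_Icc.1 hb
          omega
        simp only [hka, hka.not_gt, if_true, if_false]
        rw [hsτ _ subset_rfl _ (hKs hα1), if_pos hα1, hyτ _ subset_rfl _ hα0, if_neg hα2, hm']
        ring
      · simp [hka]
      · have hm' : m = k + 1 := by omega
        have hk1 : k + 1 ∈ Finset.Icc m β := Finset.mem_Icc.2 ⟨by omega, by omega⟩
        have hk0 : k ∈ Finset.Ioc α β := by
          simp only [Finset.mem_Ioc]; omega
        have hk2 : k ∉ Finset.Icc m β := fun hb => by
          have := Finset.mem_Icc.1 hb
          omega
        simp only [hka, hka.not_gt, if_true, if_false]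
        rw [hyτ _ subset_rfl _ (hKc hk1), if_pos hk1, hsτ _ subset_rfl _ hk0, if_neg hk2, hm']
        ring)
    (fun ω => by
      have hmm : m ∈ Finset.Icc m β := Finset.mem_Icc.2 ⟨le_rfl, hmβ⟩
      have hsub : ({m} : Finset ℕ) ⊆ Finset.Icc m β := Finset.singleton_subset_iff.2 hmm
      simp only [lB]
      rcases lt_trichotomy k α with hka | hka | hka
      · have hm' : α + 1 = m := by omega
        have hα0 : α ∈ supp J c := by
          simp only [supp, Finset.mem_Ioc]; omega
        simp only [hka, hka.not_gt, if_true, if_false]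
        rw [hm', hsτ _ hsub _ (hKs hmm), if_pos (by simp), hyτ _ hsub _ hα0,
          if_neg (by simp only [Finset.mem_singleton]; omega)]
        ring
      · simp [hka]
      · have hm' : k + 1 = m := by omega
        have hk0 : k ∈ Finset.Ioc α β := by
          simp only [Finset.mem_Ioc]; omega
        simp only [hka, hka.not_gt, if_true, if_false]
        rw [hm', hyτ _ hsub _ (hKc hmm), if_pos (by simp), hsτ _ hsub _ hk0,
          if_neg (by simp only [Finset.mem_singleton]; omega)]
        ring)
    (fun i hi ω => by
      have hi' := Finset.mem_Ioc.1 hi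
      have hmm : m ∈ Finset.Icc m β := Finset.mem_Icc.2 ⟨le_rfl, hmβ⟩
      have hsub : ({i} : Finset ℕ) ⊆ Finset.Icc m β :=
        Finset.singleton_subset_iff.2 (Finset.Ioc_subset_Icc_self hi)
      simp only [lB]
      rcases lt_trichotomy k α with hka | hka | hka
      · have hm' : α + 1 = m := by omega
        have hα0 : α ∈ supp J c := by
          simp only [supp, Finset.mem_Ioc]; omega
        simp only [hka, hka.not_gt, if_true, if_false]
        rw [hm', hsτ _ hsub _ (hKs hmm), if_neg (by simp only [Finset.mem_singleton]; omega),
          hyτ _ hsub _ hα0, if_neg (by simp only [Finset.mem_singleton]; omega)]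
      · simp [hka]
      · have hm' : k + 1 = m := by omega
        have hk0 : k ∈ Finset.Ioc α β := by
          simp only [Finset.mem_Ioc]; omega
        simp only [hka, hka.not_gt, if_true, if_false]
        rw [hm', hyτ _ hsub _ (hKc hmm), if_neg (by simp only [Finset.mem_singleton]; omega),
          hsτ _ hsub _ hk0, if_neg (by simp only [Finset.mem_singleton]; omega)])
  rw [← hends]
  refine Finset.sum_congr rfl fun ω _ => ?_
  have hcol := col_eq_chain h hα hβ hc s y ω
  rw [supp]
  simp only [lA, lB]
  rw [← hcol.1, ← hcol.2]

theorem V_congr {N n : ℕ} (J : Fin n → Fin N) (h : ℂ) {x x' : ℕ → Fin n → ℂ}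
    (hx : ∀ a, ∀ i ∈ supp J a, x i a = x' i a) : V J h x = V J h x' :=
  Finset.prod_congr rfl fun a _ => Finset.prod_congr rfl fun b _ => col_congr h (hx a) (hx b)

theorem mem_unionTo {N n : ℕ} {J : Fin n → Fin N} {j : ℕ} {a : Fin n} :
    a ∈ unionTo J j ↔ (J a).val < j := by simp [unionTo]

/-- Symmetrization of `V_mul_ins`: an extra column inserted at a position `c` of colour `β` turns
the sum for `J` into the sum for `J` with `c` recoloured by `α`. The function `G` of the two
variables where the columns meet is carried along. -/
theorem sum_ins {N n : ℕ} {lam : Fin N → ℕ} {J : Fin n → Fin N} {α : Fin N} {c : Fin n}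
    (hα : α < J c) (hJ : IsShort lam J α (J c)) (h : ℂ) (t : ℕ → ℕ → ℂ) (z : Fin n → ℂ)
    (G : ℂ → ℂ → ℂ) :
    ∑ σ : PermGroup lam, V J h (fun j a => lab t z (extRank lam J) σ j (some a)) *
      ins J α (J c) h (fun j a => lab t z (extRank lam J) σ j (some a))
        (fun j => lab t z (extRank lam J) σ j none) c *
      G (lab t z (extRank lam J) σ (J c) none) (lab t z (extRank lam J) σ ((J c).val + 1) (some c))
    = ∑ σ : PermGroup lam, V (Function.update J c α) h
        (lab t z (rank (Function.update J c α)) σ) *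
      G (lab t z (rank (Function.update J c α)) σ (J c) c)
        (lab t z (rank (Function.update J c α)) σ ((J c).val + 1) c) := by
  have hα' : α.val < (J c).val := hα
  have hβ : (J c).val < N := (J c).isLt
  set I' := Function.update J c α with hI'
  -- The column of `c` in the new colouring consists of the extra column and the old column of `c`.
  set emb : ℕ → Fin n → Option (Fin n) := fun j a =>
    if a = c ∧ j ∈ Finset.Ioc α.val (J c).val then none else some a with hemb
  have hmem : ∀ j, ∀ a ∈ unionTo I' j, emb j a ∈ extSet J α (J c) j := by
    intro j a ha
    simp only [hemb]
    split_ifs with hac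
    · exact none_mem_extSet.2 hac.2
    · rw [some_mem_extSet, mem_unionTo]
      rw [mem_unionTo] at ha
      by_cases hc : a = c
      · subst hc
        rw [hI', Function.update_self] at ha
        simp only [true_and, Finset.mem_Ioc] at hac
        omega
      · rwa [hI', Function.update_of_ne hc] at ha
  have hinj : ∀ j, Function.Injective (emb j) := by
    intro j a b hab
    simp only [hemb] at hab
    split_ifs at hab with h1 h2 h2
    · exact h1.1.trans h2.1.symm
    · exact Option.some.inj hab
  have hcard : ∀ j ≤ N, (unionTo I' j).card = lev lam j := by
    intro j hj
    rw [← hJ j hj]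
    split_ifs with hm
    · have hm' := Finset.mem_Ioc.1 hm
      have : unionTo I' j = insert c (unionTo J j) := by
        ext a
        rw [Finset.mem_insert, mem_unionTo, mem_unionTo]
        by_cases hc : a = c
        · subst hc; simp [hI']; omega
        · simp [hI', hc]
      rw [this, Finset.card_insert_of_notMem]
      rw [mem_unionTo]; omega
    · have : unionTo I' j = unionTo J j := by
        ext a
        rw [mem_unionTo, mem_unionTo]
        by_cases hc : a = c
        · subst hc
          simp only [hI', Function.update_self, Finset.mem_Ioc] at hm ⊢
          omega
        · simp [hI', Function.update_of_ne hc]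
      rw [this, add_zero]
  have hle : ∀ j ∈ Finset.Icc 1 (N - 1), j ≤ N := fun j hj => by
    have := Finset.mem_Icc.1 hj
    omega
  have hβc : (J c).val ∈ Finset.Ioc α.val (J c).val := Finset.mem_Ioc.2 ⟨hα', le_rfl⟩
  have hβc' : (J c).val + 1 ∉ Finset.Ioc α.val (J c).val := by simp
  rw [← sum_lab_eq t z (unionTo I') (r := fun j a => extRank lam J j (emb j a)) (r' := rank I')
    (fun j hj a ha => extRank_lt hJ (hle j hj) (hmem j a ha))
    (fun j hj a ha => hcard j (hle j hj) ▸ rank_lt ha)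
    (fun j hj a ha b hb hab => hinj j (extRank_injOn hJ (hle j hj) (hmem j a ha)
      (hmem j b hb) hab))
    (fun j _ => rank_injOn I' j)
    (fun a _ => by
      have hN : N ∉ Finset.Ioc α.val (J c).val := by
        simp only [Finset.mem_Ioc]; omega
      have hu : ∀ K : Fin n → Fin N, unionTo K N = Finset.univ := fun K => by
        ext a; simp [mem_unionTo]
      simp only [hemb, hN, and_false, if_false, extRank, rank, hu])
    (fun x => V I' h x * G (x (J c) c) (x ((J c).val + 1) c))
    (fun x x' hxx => by
      have e1 : V I' h x = V I' h x' := V_congr I' h fun a i hi =>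
        hxx i (supp_subset I' a hi) a (mem_supp_iff.1 hi).1
      rw [e1, hxx (J c) (Finset.mem_Icc.2 ⟨by omega, hβ.le⟩) c
          (by rw [mem_unionTo, hI', Function.update_self]; exact hα'),
        hxx ((J c).val + 1) (Finset.mem_Icc.2 ⟨by omega, hβ⟩) c
          (by rw [mem_unionTo, hI', Function.update_self]; omega)])]
  refine Finset.sum_congr rfl fun σ _ => ?_
  have hx1 : ∀ j a, a ≠ c → lab t z (fun j a => extRank lam J j (emb j a)) σ j a =
      lab t z (extRank lam J) σ j (some a) := fun j a ha => by
    simp only [lab, hemb, ha, false_and, if_false]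
  have hx2 : ∀ j ∈ Finset.Ioc α.val (J c).val,
      lab t z (fun j a => extRank lam J j (emb j a)) σ j c =
      lab t z (extRank lam J) σ j none := fun j hj => by
    simp only [lab, hemb, hj, and_self, if_true]
  have hx3 : ∀ j ∉ Finset.Ioc α.val (J c).val,
      lab t z (fun j a => extRank lam J j (emb j a)) σ j c =
      lab t z (extRank lam J) σ j (some c) := fun j hj => by
    simp only [lab, hemb, hj, and_false, if_false]
  rw [hx2 _ hβc, hx3 _ hβc']
  congr 1
  exact V_mul_ins J α h hα (fun a ha i _ => hx1 i a ha)
    (fun i hi => hx3 i (by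
      simp only [supp, Finset.mem_Ioc] at hi ⊢
      omega)) (fun i hi => hx2 i hi)

theorem W_eq_sum_V {N n : ℕ} (lam : Fin N → ℕ) (I : Fin n → Fin N) (t : ℕ → ℕ → ℂ)
    (z : Fin n → ℂ) (h : ℂ) :
    W lam I t z h = ∑ σ : PermGroup lam, V I h (lab t z (rank I) σ) := by
  rw [W, sym]
  exact Finset.sum_congr rfl fun σ _ => U_eq_V I _ z h

/-- The symmetrization of `U_J` times the interaction with the extra column of last variables,
inserted just before the position `m`. -/
def symCut {N n : ℕ} (lam : Fin N → ℕ) (J : Fin n → Fin N) (α β : ℕ) (t : ℕ → ℕ → ℂ)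
    (z : Fin n → ℂ) (h : ℂ) (m : ℕ) : ℂ :=
  ∑ σ : PermGroup lam, V J h (fun j a => lab t z (extRank lam J) σ j (some a)) *
    cutProd J α β h (fun j a => lab t z (extRank lam J) σ j (some a))
      (fun j => lab t z (extRank lam J) σ j none) m

/-- The effect on `symCut` of moving the extra column past the position `c`. -/
theorem symCut_succ_sub {N n : ℕ} {lam : Fin N → ℕ} {J : Fin n → Fin N} {α β : Fin N}
    (hα : α < β) (hJ : IsShort lam J α β) (h : ℂ) {t : ℕ → ℕ → ℂ}
    (ht : Distinct lam t) (z : Fin n → ℂ) (c : Fin n) :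
    symCut lam J α β t z h (c.val + 1) - symCut lam J α β t z h c.val =
      if J c = β then h * W lam (Function.update J c α) t z h else 0 := by
  have hα' : α.val < β.val := hα
  have hβ' : β.val < N := β.isLt
  rw [symCut, symCut, ← Finset.sum_sub_distrib]
  simp only [cutProd_succ, cutProd_val, ← mul_sub, ← mul_assoc]
  rcases lt_trichotomy (J c) β with hc | hc | hc
  · rw [if_neg hc.ne]
    exact sum_cut_eq_zero hα' hβ' hJ h ht z c hc
  · rw [if_pos hc]
    subst hc
    rw [W_eq_sum_V, Finset.mul_sum]
    have := sum_ins hα hJ h t z (fun _ _ => h)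
    simp only [mul_comm h]
    rw [← this]
    refine Finset.sum_congr rfl fun σ _ => ?_
    rw [supp, (col_adjacent h hα' hβ' _ _).1, (col_adjacent h hα' hβ' _ _).2]
    ring
  · rw [if_neg hc.ne']
    refine Finset.sum_eq_zero fun σ _ => ?_
    rw [supp, (col_eq_one_of_lt h hc _ _).1, (col_eq_one_of_lt h hc _ _).2]
    ring

/-- With the extra column inserted just behind `p`, the product is the function `V` of `J` with `p`
recoloured by `α`, times a difference of two variables of `p`. -/
theorem symCut_at {N n : ℕ} {lam : Fin N → ℕ} {J : Fin n → Fin N} {α : Fin N} {p : Fin n}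
    (hα : α < J p) (hJ : IsShort lam J α (J p)) (h : ℂ) (t : ℕ → ℕ → ℂ) (z : Fin n → ℂ) :
    symCut lam J α (J p) t z h (p.val + 1) =
      ∑ σ : PermGroup lam, V (Function.update J p α) h
        (lab t z (rank (Function.update J p α)) σ) *
      (lab t z (rank (Function.update J p α)) σ (J p) p -
        lab t z (rank (Function.update J p α)) σ ((J p).val + 1) p) := by
  rw [← sum_ins hα hJ h t z (fun u v => u - v), symCut]
  refine Finset.sum_congr rfl fun σ _ => ?_
  rw [cutProd_succ, supp, (col_adjacent h hα (J p).isLt _ _).1]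
  ring

/-! ### The special discrete differentials as ends of the sequence of cuts -/

theorem prod_fin_ite_mem {N n : ℕ} (J : Fin n → Fin N) (j : ℕ) (f : ℕ → ℂ) :
    (∏ a : Fin n, if a ∈ unionTo J j then f (rank J j a) else 1) =
      ∏ r ∈ Finset.range (unionTo J j).card, f r := by
  rw [prod_range_eq_prod_rank, Finset.prod_ite_mem, Finset.univ_inter]

theorem Icc_filter_Ioc {α β N : ℕ} (hβ : β < N) :
    (Finset.Icc 1 (N - 1)).filter (fun l => l ∈ Finset.Ioc α β) = Finset.Icc (α + 1) β := by
  ext l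
  simp only [Finset.mem_filter, Finset.mem_Icc, Finset.mem_Ioc]
  omega

theorem prod_Icc_pred {α β N : ℕ} (hβ : β < N) (g : ℕ → ℂ) (h0 : α = 0 → g 1 = 1) :
    (∏ l ∈ Finset.Icc 1 (N - 1), if l + 1 ∈ Finset.Ioc α β then g (l + 1) else 1) =
      ∏ l ∈ Finset.Icc (α + 1) β, g l := by
  rw [← Finset.prod_filter]
  have hz : ∀ l ∈ Finset.Icc (α + 1) β, l ∉ Finset.Icc (max (α + 1) 2) β → g l = 1 := by
    intro l hl hl'
    simp only [Finset.mem_Icc] at hl hl'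
    have : l = 1 := by omega
    rw [this]
    exact h0 (by omega)
  rw [← Finset.prod_subset (Finset.Icc_subset_Icc (le_max_left _ _) le_rfl) hz]
  refine Finset.prod_nbij' (fun l => l + 1) (fun l => l - 1) ?_ ?_ ?_ ?_ ?_
  · intro l hl
    simp only [Finset.mem_filter, Finset.mem_Icc, Finset.mem_Ioc] at hl ⊢
    omega
  · intro l hl
    simp only [Finset.mem_filter, Finset.mem_Icc, Finset.mem_Ioc] at hl ⊢
    omega
  · intro l _; simp
  · intro l hl
    have := Finset.mem_Icc.1 hl
    omega
  · intro l _; rfl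

/-- A product over columns and levels of factors involving the levels of the extra column, rewritten
as products over the indices of the variables. -/
theorem prod_columns_levels {N n : ℕ} (J : Fin n → Fin N) {α β : ℕ} (hβ : β < N)
    (f₁ f₂ f₃ : ℕ → ℕ → ℂ) :
    (∏ a : Fin n, ∏ l ∈ Finset.Icc 1 (N - 1),
      ((if l ∈ Finset.Ioc α β ∧ l + 1 ∈ supp J a then f₁ l (rank J (l + 1) a) else 1) *
      (if l ∈ supp J a ∧ l + 1 ∈ Finset.Ioc α β then f₂ (l + 1) (rank J l a) else 1) *
      (if l ∈ Finset.Ioc α β ∧ l ∈ supp J a then f₃ l (rank J l a) else 1))) =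
    (∏ l ∈ Finset.Icc (α + 1) β, ∏ r ∈ Finset.range (unionTo J (l + 1)).card, f₁ l r) *
    (∏ l ∈ Finset.Icc (α + 1) β, ∏ r ∈ Finset.range (unionTo J (l - 1)).card, f₂ l r) *
    ∏ l ∈ Finset.Icc (α + 1) β, ∏ r ∈ Finset.range (unionTo J l).card, f₃ l r := by
  rw [Finset.prod_comm]
  have hmem : ∀ l ∈ Finset.Icc 1 (N - 1), l ≤ N ∧ l + 1 ≤ N := fun l hl => by
    have := Finset.mem_Icc.1 hl
    omega
  simp only [Finset.prod_mul_distrib]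
  refine congrArg₂ (· * ·) (congrArg₂ (· * ·) ?_ ?_) ?_
  · rw [← Icc_filter_Ioc hβ, Finset.prod_filter]
    refine Finset.prod_congr rfl fun l hl => ?_
    rw [← prod_fin_ite_mem]
    split_ifs with h
    · simp only [h, true_and, mem_supp (hmem l hl).2]
    · simp [h]
  · have h0 : ∀ l ∈ Finset.Icc 1 (N - 1), (∏ a : Fin n,
        if l ∈ supp J a ∧ l + 1 ∈ Finset.Ioc α β then f₂ (l + 1) (rank J l a) else 1) =
        if l + 1 ∈ Finset.Ioc α β then
          ∏ r ∈ Finset.range (unionTo J l).card, f₂ (l + 1) r else 1 := by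
      intro l hl
      rw [← prod_fin_ite_mem]
      split_ifs with h
      · simp only [h, and_true, mem_supp (hmem l hl).1]
      · simp [h]
    rw [Finset.prod_congr rfl h0]
    refine prod_Icc_pred (α := α) hβ
      (fun l => ∏ r ∈ Finset.range (unionTo J (l - 1)).card, f₂ l r) fun _ => ?_
    simp [unionTo]
  · rw [← Icc_filter_Ioc hβ, Finset.prod_filter]
    refine Finset.prod_congr rfl fun l hl => ?_
    rw [← prod_fin_ite_mem]
    split_ifs with h
    · simp only [h, true_and, mem_supp (hmem l hl).1]
    · simp [h]

theorem prod_range_pred_mul {m : ℕ} (hm : 1 ≤ m) (f : ℕ → ℂ) :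
    ∏ r ∈ Finset.range m, f r = f (m - 1) * ∏ r ∈ Finset.range (m - 1), f r := by
  obtain ⟨k, rfl⟩ : ∃ k, m = k + 1 := ⟨m - 1, by omega⟩
  rw [Finset.prod_range_succ, mul_comm]; rfl

theorem prod_Icc_upper {N n : ℕ} {lam : Fin N → ℕ} {J : Fin n → Fin N} {α β : ℕ}
    (hα : α < β) (hβ : β < N) (hJ : IsShort lam J α β) (hpos : 1 ≤ lev lam (β + 1))
    (f : ℕ → ℕ → ℂ) :
    (∏ l ∈ Finset.Icc (α + 1) β, ∏ r ∈ Finset.range (unionTo J (l + 1)).card, f l r) =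
      f β (lev lam (β + 1) - 1) *
        ∏ l ∈ Finset.Icc (α + 1) β, ∏ r ∈ Finset.range (lev lam (l + 1) - 1), f l r := by
  have hβm : β ∈ Finset.Icc (α + 1) β := Finset.mem_Icc.2 ⟨by omega, le_rfl⟩
  rw [← Finset.mul_prod_erase _ _ hβm, ← Finset.mul_prod_erase _ _ hβm, ← mul_assoc]
  congr 1
  · have h := hJ (β + 1) hβ
    rw [if_neg (by simp), add_zero] at h
    rw [h, prod_range_pred_mul hpos]
  · refine Finset.prod_congr rfl fun l hl => ?_
    have hl' := Finset.mem_erase.1 hl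
    have hl'' := Finset.mem_Icc.1 hl'.2
    have h := hJ (l + 1) (by omega)
    rw [if_pos (Finset.mem_Ioc.2 ⟨by omega, by omega⟩)] at h
    rw [← h, Nat.add_sub_cancel]

theorem prod_Icc_lower {N n : ℕ} {lam : Fin N → ℕ} {J : Fin n → Fin N} {α β : ℕ}
    (hα : α < β) (hβ : β < N) (hJ : IsShort lam J α β) (f : ℕ → ℕ → ℂ) :
    (∏ l ∈ Finset.Icc (α + 1) β, ∏ r ∈ Finset.range (unionTo J (l - 1)).card, f l r) =
      (if lev lam α = 0 then 1 else f (α + 1) (lev lam α - 1)) *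
        ∏ l ∈ Finset.Icc (α + 1) β, ∏ r ∈ Finset.range (lev lam (l - 1) - 1), f l r := by
  have hαm : α + 1 ∈ Finset.Icc (α + 1) β := Finset.mem_Icc.2 ⟨le_rfl, by omega⟩
  rw [← Finset.mul_prod_erase _ _ hαm, ← Finset.mul_prod_erase _ _ hαm, ← mul_assoc]
  congr 1
  · have h := hJ α (by omega)
    rw [if_neg (by simp), add_zero] at h
    simp only [Nat.add_sub_cancel, h]
    split_ifs with h0
    · simp [h0]
    · rw [prod_range_pred_mul (by omega)]
  · refine Finset.prod_congr rfl fun l hl => ?_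
    have hl' := Finset.mem_erase.1 hl
    have hl'' := Finset.mem_Icc.1 hl'.2
    have h := hJ (l - 1) (by omega)
    rw [if_pos (Finset.mem_Ioc.2 ⟨by omega, by omega⟩)] at h
    rw [← h, Nat.add_sub_cancel]

theorem prod_Icc_same {N n : ℕ} {lam : Fin N → ℕ} {J : Fin n → Fin N} {α β : ℕ}
    (hβ : β < N) (hJ : IsShort lam J α β) (f : ℕ → ℕ → ℂ) :
    (∏ l ∈ Finset.Icc (α + 1) β, ∏ r ∈ Finset.range (unionTo J l).card, f l r) =
        ∏ l ∈ Finset.Icc (α + 1) β, ∏ r ∈ Finset.range (lev lam l - 1), f l r := by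
  refine Finset.prod_congr rfl fun l hl => ?_
  have hl'' := Finset.mem_Icc.1 hl
  have h := hJ l (by omega)
  rw [if_pos (Finset.mem_Ioc.2 ⟨by omega, by omega⟩)] at h
  rw [← h, Nat.add_sub_cancel]

theorem lev_mono {N : ℕ} (lam : Fin N → ℕ) {j k : ℕ} (hjk : j ≤ k) : lev lam j ≤ lev lam k := by
  refine Finset.sum_le_sum_of_subset fun c hc => ?_
  simp only [Finset.mem_filter, Finset.mem_univ, true_and] at hc ⊢
  omega

theorem IsShort.lev_pos {N n : ℕ} {lam : Fin N → ℕ} {J : Fin n → Fin N} {α β : ℕ}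
    (hJ : IsShort lam J α β) (hβ : β < N) {j : ℕ} (hj : j ∈ Finset.Ioc α β) :
    1 ≤ lev lam j := by
  have h := hJ j (by have := Finset.mem_Ioc.1 hj; omega)
  rw [if_pos hj] at h
  omega

theorem ite_mul_ite_mul_ite_comm {p q r s u v : Prop} [Decidable p] [Decidable q] [Decidable r]
    [Decidable s] [Decidable u] [Decidable v] (x y w : ℂ) :
    (if p ∧ q then x else 1) * (if r ∧ s then y else 1) * (if u ∧ v then w else 1) =
      (if r ∧ s then y else 1) * (if p ∧ q then x else 1) * (if v ∧ u then w else 1) := by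
  rw [mul_comm (if p ∧ q then x else 1)]
  simp only [and_comm (a := u)]

/-- The products in `prodA` pair each variable of the extra column with those variables of the same
and of the adjacent levels that occur in `U_J`, and contain, apart from them, no pair of variables
of the extra column. -/
theorem prodA_eq_levels {N n : ℕ} {lam : Fin N → ℕ} {J : Fin n → Fin N} {α β : Fin N}
    (hα : α < β) (hJ : IsShort lam J α β) (t : ℕ → ℕ → ℂ) (z : Fin n → ℂ) (h : ℂ) :
    prodA lam α β t z h =
      (∏ l ∈ Finset.Icc (α.val + 1) β, ∏ r ∈ Finset.range (unionTo J (l + 1)).card,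
        (lastVar lam t z l - allVars N t z (l + 1) r - h)) *
      (∏ l ∈ Finset.Icc (α.val + 1) β, ∏ r ∈ Finset.range (unionTo J (l - 1)).card,
        (allVars N t z (l - 1) r - lastVar lam t z l)) *
      ∏ l ∈ Finset.Icc (α.val + 1) β, ∏ r ∈ Finset.range (unionTo J l).card,
        ((allVars N t z l r - lastVar lam t z l - h) /
          (allVars N t z l r - lastVar lam t z l)) := by
  have hα' : α.val < β.val := hα
  have hβ' : β.val < N := β.isLt
  rw [prod_Icc_upper hα' hβ' hJ ((hJ.lev_pos hβ' (Finset.mem_Ioc.2 ⟨hα', le_rfl⟩)).trans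
      (lev_mono lam (Nat.le_succ _)))
      (fun l r => lastVar lam t z l - allVars N t z (l + 1) r - h),
    prod_Icc_lower hα' hβ' hJ (fun l r => allVars N t z (l - 1) r - lastVar lam t z l),
    prod_Icc_same hβ' hJ (fun l r => (allVars N t z l r - lastVar lam t z l - h) /
      (allVars N t z l r - lastVar lam t z l)), prodA]
  simp only [Nat.add_sub_cancel]
  rw [← lastVar, ← lastVar]
  ring

theorem prodB_eq_levels {N n : ℕ} {lam : Fin N → ℕ} {J : Fin n → Fin N} {α β : Fin N}
    (hα : α < β) (hJ : IsShort lam J α β) (t : ℕ → ℕ → ℂ) (z : Fin n → ℂ) (h : ℂ) :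
    prodB lam α β t z h =
      (∏ l ∈ Finset.Icc (α.val + 1) β, ∏ r ∈ Finset.range (unionTo J (l + 1)).card,
        (lastVar lam t z l - allVars N t z (l + 1) r)) *
      (∏ l ∈ Finset.Icc (α.val + 1) β, ∏ r ∈ Finset.range (unionTo J (l - 1)).card,
        (allVars N t z (l - 1) r - lastVar lam t z l - h)) *
      ∏ l ∈ Finset.Icc (α.val + 1) β, ∏ r ∈ Finset.range (unionTo J l).card,
        ((lastVar lam t z l - allVars N t z l r - h) /
          (lastVar lam t z l - allVars N t z l r)) := by
  have hα' : α.val < β.val := hα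
  have hβ' : β.val < N := β.isLt
  rw [prod_Icc_upper hα' hβ' hJ ((hJ.lev_pos hβ' (Finset.mem_Ioc.2 ⟨hα', le_rfl⟩)).trans
      (lev_mono lam (Nat.le_succ _)))
      (fun l r => lastVar lam t z l - allVars N t z (l + 1) r),
    prod_Icc_lower hα' hβ' hJ (fun l r => allVars N t z (l - 1) r - lastVar lam t z l - h),
    prod_Icc_same hβ' hJ (fun l r => (lastVar lam t z l - allVars N t z l r - h) /
      (lastVar lam t z l - allVars N t z l r)), prodB]
  simp only [Nat.add_sub_cancel]
  rw [← lastVar, ← lastVar]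
  ring

/-- In `prodA` the extra column stands to the left of all positions. -/
theorem prodA_eq_cutProd {N n : ℕ} {lam : Fin N → ℕ} {J : Fin n → Fin N} {α β : Fin N}
    (hα : α < β) (hJ : IsShort lam J α β) (t : ℕ → ℕ → ℂ) (z : Fin n → ℂ) (h : ℂ) :
    prodA lam α β t z h = cutProd J α β h (fun j a => allVars N t z j (rank J j a))
      (fun j => lastVar lam t z j) 0 := by
  have hβ' : β.val < N := β.isLt
  simp only [cutProd, Nat.not_lt_zero, if_false]
  rw [Finset.prod_congr rfl fun a _ => col_eq_prod_levels h (Ioc_subset_Icc_one hβ')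
    (supp_subset J a) _ _]
  have key := prod_columns_levels (α := α) J hβ'
    (fun l r => lastVar lam t z l - allVars N t z (l + 1) r - h)
    (fun l r => allVars N t z (l - 1) r - lastVar lam t z l)
    (fun l r => (allVars N t z l r - lastVar lam t z l - h) /
      (allVars N t z l r - lastVar lam t z l))
  simp only [Nat.add_sub_cancel] at key
  rw [key, prodA_eq_levels hα hJ]

/-- In `prodB` the extra column stands to the right of all positions. -/
theorem prodB_eq_cutProd {N n : ℕ} {lam : Fin N → ℕ} {J : Fin n → Fin N} {α β : Fin N}
    (hα : α < β) (hJ : IsShort lam J α β) (t : ℕ → ℕ → ℂ) (z : Fin n → ℂ) (h : ℂ) :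
    prodB lam α β t z h = cutProd J α β h (fun j a => allVars N t z j (rank J j a))
      (fun j => lastVar lam t z j) n := by
  have hβ' : β.val < N := β.isLt
  simp only [cutProd, Fin.is_lt, if_true]
  rw [Finset.prod_congr rfl fun a _ => (col_eq_prod_levels h (supp_subset J a)
    (Ioc_subset_Icc_one hβ') _ _).trans
      (Finset.prod_congr rfl fun l _ => ite_mul_ite_mul_ite_comm _ _ _)]
  have key := prod_columns_levels (α := α) J hβ'
    (fun l r => lastVar lam t z l - allVars N t z (l + 1) r)
    (fun l r => allVars N t z (l - 1) r - lastVar lam t z l - h)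
    (fun l r => (lastVar lam t z l - allVars N t z l r - h) /
      (lastVar lam t z l - allVars N t z l r))
  simp only [Nat.add_sub_cancel] at key
  rw [key, prodB_eq_levels hα hJ]

theorem dU_eq_symCut {N n : ℕ} {lam : Fin N → ℕ} {J : Fin n → Fin N} {α β : Fin N}
    (hα : α < β) (hJ : IsShort lam J α β) (t : ℕ → ℕ → ℂ) (z : Fin n → ℂ) (h : ℂ)
    (q : Fin N → ℂ) :
    dU lam α β J t z h q = 1 / (q α - q β) *
      (q β * symCut lam J α β t z h 0 - q α * symCut lam J α β t z h n) := by
  rw [dU, sym, symCut, symCut, Finset.mul_sum, Finset.mul_sum, ← Finset.sum_sub_distrib,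
    Finset.mul_sum]
  refine Finset.sum_congr rfl fun σ _ => ?_
  rw [U_eq_V, prodA_eq_cutProd hα hJ, prodB_eq_cutProd hα hJ]
  have e1 : (fun j a => allVars N (permute lam σ t) z j (rank J j a)) =
      fun j a => lab t z (extRank lam J) σ j (some a) := rfl
  have e2 : (fun j => lastVar lam (permute lam σ t) z j) =
      fun j => lab t z (extRank lam J) σ j none := rfl
  rw [e1, e2]
  ring

/-! ### Telescoping the sequence of cuts -/

theorem sum_Ico_telescope (f : ℕ → ℂ) {k l : ℕ} (hkl : k ≤ l) :
    ∑ m ∈ Finset.Ico k l, (f (m + 1) - f m) = f l - f k := by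
  rw [Finset.sum_Ico_eq_sub _ hkl, Finset.sum_range_sub, Finset.sum_range_sub]
  ring

theorem sum_filter_gt_telescope {n : ℕ} (f : ℕ → ℂ) (p : Fin n) :
    ∑ c ∈ Finset.univ.filter (fun c : Fin n => p < c), (f (c.val + 1) - f c.val) =
      f n - f (p.val + 1) := by
  rw [← sum_Ico_telescope f p.isLt, Finset.sum_filter]
  simp only [Fin.lt_def]
  rw [Fin.sum_univ_eq_sum_range (fun m : ℕ => if p.val < m then f (m + 1) - f m else 0),
    ← Finset.sum_filter]
  refine Finset.sum_congr ?_ fun _ _ => rfl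
  ext m
  simp only [Finset.mem_filter, Finset.mem_range, Finset.mem_Ico]
  omega

theorem sum_filter_lt_telescope {n : ℕ} (f : ℕ → ℂ) (p : Fin n) :
    ∑ c ∈ Finset.univ.filter (fun c : Fin n => c < p), (f (c.val + 1) - f c.val) =
      f p.val - f 0 := by
  rw [← sum_Ico_telescope f (Nat.zero_le _), Finset.sum_filter]
  simp only [Fin.lt_def]
  rw [Fin.sum_univ_eq_sum_range (fun m : ℕ => if m < p.val then f (m + 1) - f m else 0),
    ← Finset.sum_filter]
  refine Finset.sum_congr ?_ fun _ _ => rfl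
  ext m
  have := p.isLt
  simp only [Finset.mem_filter, Finset.mem_range, Finset.mem_Ico]
  omega

theorem update_update_eq_swap {N n : ℕ} (I : Fin n → Fin N) {p c : Fin n} {β : Fin N}
    (hc : I c = β) :
    Function.update (Function.update I p β) c (I p) = I ∘ Equiv.swap p c := by
  funext a
  simp only [Function.comp_apply, Equiv.swap_apply_def]
  by_cases hac : a = c
  · subst hac
    by_cases hap : a = p
    · subst hap; simp
    · simp [hap]
  · rw [Function.update_of_ne hac]
    by_cases hap : a = p
    · subst hap; simp [hc]
    · simp [hap, hac]

/-- The symmetrization of `U_I` times the difference of the variables of the levels `β` and `β + 1`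
that belong to the position `p`. -/
def jump {N n : ℕ} (lam : Fin N → ℕ) (I : Fin n → Fin N) (β : ℕ) (p : Fin n)
    (t : ℕ → ℕ → ℂ) (z : Fin n → ℂ) (h : ℂ) : ℂ :=
  ∑ σ : PermGroup lam, V I h (lab t z (rank I) σ) *
    (lab t z (rank I) σ β p - lab t z (rank I) σ (β + 1) p)

/-- The sum of the steps `symCut_succ_sub` from the position `p` to the right end. -/
theorem symCut_top {N n : ℕ} {lam : Fin N → ℕ} {I : Fin n → Fin N} {β : Fin N} {p : Fin n}
    (hα : I p < β) (hJ : IsShort lam (Function.update I p β) (I p) β) (h : ℂ) {t : ℕ → ℕ → ℂ}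
    (ht : Distinct lam t) (z : Fin n → ℂ) :
    symCut lam (Function.update I p β) (I p) β t z h n = jump lam I β p t z h +
      h * ∑ c ∈ Finset.univ.filter (fun c : Fin n => p < c ∧ I c = β),
        W lam (I ∘ Equiv.swap p c) t z h := by
  have h1 := sum_filter_gt_telescope (symCut lam (Function.update I p β) (I p) β t z h) p
  have h2 : symCut lam (Function.update I p β) (I p) β t z h (p.val + 1) =
      jump lam I β p t z h := by
    have := symCut_at (lam := lam) (J := Function.update I p β) (p := p) (α := I p)
      (by simpa using hα) (by simpa using hJ) h t z
    simpa [jump] using this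
  rw [h2] at h1
  rw [← sub_eq_iff_eq_add', ← h1, ← Finset.filter_filter, Finset.sum_filter (p := fun c => I c = β),
    Finset.mul_sum]
  refine Finset.sum_congr rfl fun c hc => ?_
  have hcp : c ≠ p := (Finset.mem_filter.1 hc).2.ne'
  rw [symCut_succ_sub hα hJ h ht z c, Function.update_of_ne hcp]
  split_ifs with hIc
  · rw [update_update_eq_swap I hIc]
  · rw [mul_zero]

/-- The sum of the steps `symCut_succ_sub` from the left end to the position `p`. Its last step
passes `p` itself, which gives back `W_I`. -/
theorem symCut_bot {N n : ℕ} {lam : Fin N → ℕ} {I : Fin n → Fin N} {β : Fin N} {p : Fin n}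
    (hα : I p < β) (hJ : IsShort lam (Function.update I p β) (I p) β) (h : ℂ) {t : ℕ → ℕ → ℂ}
    (ht : Distinct lam t) (z : Fin n → ℂ) :
    symCut lam (Function.update I p β) (I p) β t z h 0 = jump lam I β p t z h -
      h * W lam I t z h -
      h * ∑ c ∈ Finset.univ.filter (fun c : Fin n => c < p ∧ I c = β),
        W lam (I ∘ Equiv.swap p c) t z h := by
  have h1 := sum_filter_lt_telescope (symCut lam (Function.update I p β) (I p) β t z h) p
  have h2 : symCut lam (Function.update I p β) (I p) β t z h (p.val + 1) =
      jump lam I β p t z h := by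
    have := symCut_at (lam := lam) (J := Function.update I p β) (p := p) (α := I p)
      (by simpa using hα) (by simpa using hJ) h t z
    simpa [jump] using this
  have h3 := symCut_succ_sub hα hJ h ht z p
  rw [h2, if_pos (by simp), Function.update_idem, Function.update_eq_self] at h3
  have h4 : h * ∑ c ∈ Finset.univ.filter (fun c : Fin n => c < p ∧ I c = β),
        W lam (I ∘ Equiv.swap p c) t z h =
      symCut lam (Function.update I p β) (I p) β t z h p.val -
        symCut lam (Function.update I p β) (I p) β t z h 0 := by
    rw [← h1, ← Finset.filter_filter, Finset.sum_filter (p := fun c => I c = β), Finset.mul_sum]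
    refine Finset.sum_congr rfl fun c hc => ?_
    have hcp : c ≠ p := (Finset.mem_filter.1 hc).2.ne
    rw [symCut_succ_sub hα hJ h ht z c, Function.update_of_ne hcp]
    split_ifs with hIc
    · rw [update_update_eq_swap I hIc]
    · rw [mul_zero]
  rw [h4, ← h3]
  ring

theorem card_unionTo {N n : ℕ} {lam : Fin N → ℕ} {I : Fin n → Fin N} (hI : I ∈ parts n lam)
    (j : ℕ) : (unionTo I j).card = lev lam j := by
  have hI' := (Finset.mem_filter.1 hI).2
  rw [unionTo, lev, Finset.card_eq_sum_card_fiberwise (f := I)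
    (t := Finset.univ.filter (fun k : Fin N => k.val < j))]
  · refine Finset.sum_congr rfl fun k hk => ?_
    rw [← hI' k, Finset.filter_filter]
    congr 1
    ext a
    simp only [Finset.mem_filter, Finset.mem_univ, true_and] at hk ⊢
    exact ⟨fun h => h.2, fun h => ⟨h ▸ hk, h⟩⟩
  · intro a ha
    simpa using ha

theorem isShort_update {N n : ℕ} {lam : Fin N → ℕ} {I : Fin n → Fin N} (hI : I ∈ parts n lam)
    {β : Fin N} {p : Fin n} (hα : I p < β) :
    IsShort lam (Function.update I p β) (I p) β := by
  have hα' : (I p).val < β.val := hα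
  intro j _
  rw [← card_unionTo hI j]
  split_ifs with hj
  · have hj' := Finset.mem_Ioc.1 hj
    have : unionTo I j = insert p (unionTo (Function.update I p β) j) := by
      ext a
      rw [Finset.mem_insert, mem_unionTo, mem_unionTo]
      by_cases hap : a = p
      · subst hap; simp; omega
      · simp [hap]
    rw [this, Finset.card_insert_of_notMem]
    rw [mem_unionTo, Function.update_self]; omega
  · rw [add_zero]
    congr 1
    ext a
    rw [mem_unionTo, mem_unionTo]
    by_cases hap : a = p
    · subst hap
      simp only [Function.update_self, Finset.mem_Ioc] at hj ⊢
      omega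
    · simp [hap]

/-! ### The coefficients of the dynamical equation -/

theorem sum_color_split {N n : ℕ} {I : Fin n → Fin N} {i : Fin N} {p : Fin n} (hp : I p ≠ i)
    (f : Fin n → ℂ) :
    ∑ c ∈ Finset.univ.filter (fun c : Fin n => I c = i), f c =
      ∑ c ∈ Finset.univ.filter (fun c : Fin n => c < p ∧ I c = i), f c +
      ∑ c ∈ Finset.univ.filter (fun c : Fin n => p < c ∧ I c = i), f c := by
  rw [← Finset.sum_union]
  · refine Finset.sum_congr ?_ fun _ _ => rfl
    ext c
    simp only [Finset.mem_filter, Finset.mem_univ, true_and, Finset.mem_union]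
    constructor
    · intro hc
      rcases lt_trichotomy c p with h1 | h1 | h1
      · exact Or.inl ⟨h1, hc⟩
      · subst h1; exact absurd hc hp
      · exact Or.inr ⟨h1, hc⟩
    · rintro (h1 | h1) <;> exact h1.2
  · rw [Finset.disjoint_left]
    intro c hc hc'
    exact lt_asymm (Finset.mem_filter.1 hc).2.1 (Finset.mem_filter.1 hc').2.1

/-- The summands of `D_{I,i}` with `j < i`. -/
theorem dU_lower {N n : ℕ} {lam : Fin N → ℕ} {I : Fin n → Fin N} (hI : I ∈ parts n lam)
    {i : Fin N} {p : Fin n} (hp : I p < i) (h : ℂ) {t : ℕ → ℕ → ℂ}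
    (ht : Distinct lam t) (z : Fin n → ℂ) {q : Fin N → ℂ} (hq : Function.Injective q) :
    dU lam (I p) i (Function.update I p i) t z h q = -jump lam I i p t z h + h * W lam I t z h +
      h * ∑ c ∈ Finset.univ.filter (fun c : Fin n => c < p ∧ I c = i),
        W lam (I ∘ Equiv.swap p c) t z h +
      q (I p) / (q i - q (I p)) * (h * (W lam I t z h +
        ∑ c ∈ Finset.univ.filter (fun c : Fin n => I c = i),
          W lam (I ∘ Equiv.swap p c) t z h)) := by
  have hJ := isShort_update hI hp
  rw [dU_eq_symCut hp hJ, symCut_top hp hJ h ht, symCut_bot hp hJ h ht]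
  rw [sum_color_split hp.ne]
  have h1 : q (I p) - q i ≠ 0 := sub_ne_zero.2 (hq.ne hp.ne)
  have h2 : q i - q (I p) ≠ 0 := sub_ne_zero.2 (hq.ne hp.ne')
  rw [show q i - q (I p) = -(q (I p) - q i) by ring]
  field_simp
  ring

/-- The summands of `D_{I,i}` with `j > i`. -/
theorem dU_upper {N n : ℕ} {lam : Fin N → ℕ} {I : Fin n → Fin N} (hI : I ∈ parts n lam)
    {j : Fin N} {p : Fin n} (hp : I p < j) (h : ℂ) {t : ℕ → ℕ → ℂ}
    (ht : Distinct lam t) (z : Fin n → ℂ) {q : Fin N → ℂ} (hq : Function.Injective q) :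
    dU lam (I p) j (Function.update I p j) t z h q = -(jump lam I j p t z h +
      h * ∑ c ∈ Finset.univ.filter (fun c : Fin n => p < c ∧ I c = j),
        W lam (I ∘ Equiv.swap p c) t z h +
      q j / (q (I p) - q j) * (h * (W lam I t z h +
        ∑ c ∈ Finset.univ.filter (fun c : Fin n => I c = j),
          W lam (I ∘ Equiv.swap p c) t z h))) := by
  rw [dU_lower hI hp h ht z hq]
  rw [sum_color_split hp.ne]
  have h1 : q (I p) - q j ≠ 0 := sub_ne_zero.2 (hq.ne hp.ne)
  rw [show q j - q (I p) = -(q (I p) - q j) by ring]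
  field_simp
  ring

theorem sum_rank_eq_sum_range {N n : ℕ} {lam : Fin N → ℕ} {I : Fin n → Fin N}
    (hI : I ∈ parts n lam) (t : ℕ → ℕ → ℂ) (z : Fin n → ℂ) (σ : PermGroup lam) (j : ℕ) :
    ∑ p ∈ unionTo I j, lab t z (rank I) σ j p =
      ∑ r ∈ Finset.range (lev lam j), allVars N t z j r := by
  have h1 : ∑ p ∈ unionTo I j, lab t z (rank I) σ j p =
      ∑ r ∈ Finset.range (lev lam j), allVars N (permute lam σ t) z j r := by
    rw [← card_unionTo hI j, ← image_rank, Finset.sum_image (rank_injOn I j)]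
    rfl
  simp only [h1, allVars_permute]
  exact sum_range_permIdx σ j (fun r => allVars N t z j r)

theorem lab_top {N n : ℕ} {lam : Fin N → ℕ} (I : Fin n → Fin N) (t : ℕ → ℕ → ℂ) (z : Fin n → ℂ)
    (σ : PermGroup lam) (p : Fin n) : lab t z (rank I) σ N p = z p := by
  have : rank I N p = p.val := by
    have hu : unionTo I N = Finset.univ := by ext a; simp [mem_unionTo]
    have hp : Finset.univ.filter (fun m => m < p) = Finset.Iio p := by ext; simp
    rw [rank, hu, hp, Fin.card_Iio]
  simp [lab, allVars, this]

theorem sum_fiber_lt {N n : ℕ} (I : Fin n → Fin N) (i : Fin N) (f : Fin n → ℂ) :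
    ∑ j ∈ Finset.univ.filter (fun j : Fin N => j < i),
      ∑ p ∈ Finset.univ.filter (fun p : Fin n => I p = j), f p =
      ∑ p ∈ unionTo I i, f p := by
  rw [← Finset.sum_fiberwise_of_maps_to (s := unionTo I i)
    (t := Finset.univ.filter (fun j : Fin N => j < i)) (g := I)]
  · refine Finset.sum_congr rfl fun j hj => Finset.sum_congr ?_ fun _ _ => rfl
    ext p
    simp only [unionTo, Finset.mem_filter, Finset.mem_univ, true_and] at hj ⊢
    exact ⟨fun h => ⟨h ▸ hj, h⟩, fun h => h.2⟩
  · intro p hp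
    simpa [unionTo] using hp

theorem sum_fiber_gt {N n : ℕ} (I : Fin n → Fin N) (i : Fin N) (P : Fin n → Prop)
    [DecidablePred P] (f : Fin n → ℂ) :
    ∑ j ∈ Finset.univ.filter (fun j : Fin N => i < j),
      ∑ c ∈ Finset.univ.filter (fun c : Fin n => P c ∧ I c = j), f c =
      ∑ c ∈ Finset.univ.filter (fun c : Fin n => P c ∧ i < I c), f c := by
  rw [← Finset.sum_fiberwise_of_maps_to
    (s := Finset.univ.filter (fun c : Fin n => P c ∧ i < I c))
    (t := Finset.univ.filter (fun j : Fin N => i < j)) (g := I)]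
  · refine Finset.sum_congr rfl fun j hj => Finset.sum_congr ?_ fun _ _ => rfl
    ext p
    simp only [Finset.mem_filter, Finset.mem_univ, true_and] at hj ⊢
    exact ⟨fun h => ⟨⟨h.1, h.2 ▸ hj⟩, h.2⟩, fun h => ⟨h.1.1, h.2⟩⟩
  · intro p hp
    simpa using (Finset.mem_filter.1 hp).2.2

/-- The sum of the variables of level `i + 1` minus the sum of those of level `i`, where the colour
`i` is counted from `0`. It is `κ` times the exponent of `q_i` in the master function. -/
def levelDiff {N n : ℕ} (lam : Fin N → ℕ) (i : Fin N) (t : ℕ → ℕ → ℂ) (z : Fin n → ℂ) : ℂ :=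
  ∑ r ∈ Finset.range (lev lam (i.val + 1)), allVars N t z (i.val + 1) r -
    ∑ r ∈ Finset.range (lev lam i), allVars N t z i r

theorem sum_gt_telescope {N : ℕ} (i : Fin N) (f : ℕ → ℂ) :
    ∑ j ∈ Finset.univ.filter (fun j : Fin N => i < j), (f j.val - f (j.val + 1)) =
      f (i.val + 1) - f N := by
  have := sum_filter_gt_telescope f i
  rw [← neg_sub (f N), ← this, ← Finset.sum_neg_distrib]
  exact Finset.sum_congr rfl fun j _ => by ring

/-- The sums `jump` in `D_{I,i}` telescope over the levels of each position: what remains is the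
exponent of `q_i` and the diagonal part of the Hamiltonian. -/
theorem sum_jump {N n : ℕ} {lam : Fin N → ℕ} {I : Fin n → Fin N} (hI : I ∈ parts n lam)
    (i : Fin N) (t : ℕ → ℕ → ℂ) (z : Fin n → ℂ) (h : ℂ) :
    (∑ j ∈ Finset.univ.filter (fun j : Fin N => i < j),
      ∑ p ∈ Finset.univ.filter (fun p : Fin n => I p = i), jump lam I j p t z h) -
      ∑ p ∈ unionTo I i, jump lam I i p t z h =
    (levelDiff lam i t z - ∑ a ∈ Finset.univ.filter (fun a : Fin n => I a = i), z a) *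
      W lam I t z h := by
  have hu : unionTo I (i.val + 1) =
      Finset.univ.filter (fun p : Fin n => I p = i) ∪ unionTo I i := by
    ext a
    simp only [unionTo, Finset.mem_union, Finset.mem_filter, Finset.mem_univ, true_and, Fin.ext_iff]
    omega
  have hd : Disjoint (Finset.univ.filter (fun p : Fin n => I p = i)) (unionTo I i) := by
    rw [Finset.disjoint_left]
    intro a ha hb
    simp only [unionTo, Finset.mem_filter, Finset.mem_univ, true_and] at ha hb
    rw [ha] at hb
    exact lt_irrefl _ hb
  rw [W_eq_sum_V, Finset.mul_sum, Finset.sum_comm]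
  simp only [jump]
  rw [Finset.sum_congr rfl fun p _ => Finset.sum_comm, Finset.sum_comm, Finset.sum_comm
    (s := unionTo I i), ← Finset.sum_sub_distrib]
  refine Finset.sum_congr rfl fun σ _ => ?_
  simp only [← Finset.mul_sum]
  rw [← mul_sub, mul_comm]
  congr 1
  have e1 : ∀ p : Fin n, ∑ j ∈ Finset.univ.filter (fun j : Fin N => i < j),
      (lab t z (rank I) σ j p - lab t z (rank I) σ (j.val + 1) p) =
      lab t z (rank I) σ (i.val + 1) p - z p := fun p => by
    rw [sum_gt_telescope i (fun l => lab t z (rank I) σ l p), lab_top]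
  simp only [e1, Finset.sum_sub_distrib]
  rw [sum_rank_eq_sum_range hI, levelDiff, ← sum_rank_eq_sum_range hI t z σ (i.val + 1), hu,
    Finset.sum_union hd]
  ring

theorem swap_pairs {n : ℕ} (P Q : Fin n → Prop) [DecidablePred P] [DecidablePred Q]
    (f : Fin n → Fin n → ℂ) (hf : ∀ a b, f a b = f b a) :
    ∑ p ∈ Finset.univ.filter (fun p : Fin n => P p),
      ∑ c ∈ Finset.univ.filter (fun c : Fin n => c < p ∧ Q c), f p c =
    ∑ a ∈ Finset.univ.filter (fun a : Fin n => Q a),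
      ∑ b ∈ Finset.univ.filter (fun b : Fin n => a < b ∧ P b), f a b := by
  rw [Finset.sum_comm' (t' := Finset.univ.filter (fun a : Fin n => Q a))
    (s' := fun a => Finset.univ.filter (fun b : Fin n => a < b ∧ P b))]
  · exact Finset.sum_congr rfl fun a _ => Finset.sum_congr rfl fun b _ => hf b a
  · intro p c
    simp only [Finset.mem_filter, Finset.mem_univ, true_and]
    tauto

/-- The coefficient of `v_I` in `X_i W_λ`. -/
def hamCoeff {N n : ℕ} (lam : Fin N → ℕ) (I : Fin n → Fin N) (i : Fin N) (t : ℕ → ℕ → ℂ)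
    (z : Fin n → ℂ) (h : ℂ) (q : Fin N → ℂ) : ℂ :=
  (∑ a ∈ Finset.univ.filter (fun a : Fin n => I a = i), z a) * W lam I t z h -
    h * ((∑ a ∈ Finset.univ.filter (fun a : Fin n => I a = i),
      ∑ b ∈ Finset.univ.filter (fun b : Fin n => a < b ∧ I b ≠ i),
        W lam (I ∘ Equiv.swap a b) t z h) +
      ∑ j ∈ Finset.univ.filter (fun j : Fin N => j ≠ i), q j / (q i - q j) *
        ∑ a ∈ Finset.univ.filter (fun a : Fin n => I a = i),
          ∑ b ∈ Finset.univ.filter (fun b : Fin n => I b = j),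
            W lam (I ∘ Equiv.swap a b) t z h)

/-- The logarithmic derivative `κ q_i ∂/∂q_i` of `Ω_λ Φ_λ`. -/
def logDer {N n : ℕ} (lam : Fin N → ℕ) (i : Fin N) (t : ℕ → ℕ → ℂ)
    (z : Fin n → ℂ) (h : ℂ) (q : Fin N → ℂ) : ℂ :=
  levelDiff lam i t z +
    h * ((∑ j ∈ Finset.univ.filter (fun j : Fin N => i < j), lam i * (q j / (q i - q j))) +
      ∑ j ∈ Finset.univ.filter (fun j : Fin N => j < i), lam j * (q i / (q i - q j)))

theorem sum_ne_eq_lt_add_gt {N : ℕ} (i : Fin N) (f : Fin N → ℂ) :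
    ∑ j ∈ Finset.univ.filter (fun j : Fin N => j ≠ i), f j =
      ∑ j ∈ Finset.univ.filter (fun j : Fin N => i < j), f j +
      ∑ j ∈ Finset.univ.filter (fun j : Fin N => j < i), f j := by
  rw [← Finset.sum_union]
  · refine Finset.sum_congr ?_ fun _ _ => rfl
    ext j
    simp only [Finset.mem_filter, Finset.mem_univ, true_and, Finset.mem_union]
    rw [ne_iff_lt_or_gt, or_comm]
  · rw [Finset.disjoint_left]
    intro c hc hc'
    exact lt_asymm (Finset.mem_filter.1 hc).2 (Finset.mem_filter.1 hc').2

/-- The function `D_{I,i}` is the coefficient of `v_I` in the left-hand side of the dynamical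
equation, with the factor `Ω_λ Φ_λ` removed. -/
theorem D_eq {N n : ℕ} {lam : Fin N → ℕ} {I : Fin n → Fin N} (hI : I ∈ parts n lam)
    (i : Fin N) {t : ℕ → ℕ → ℂ} (ht : Distinct lam t) (z : Fin n → ℂ) (h : ℂ) {q : Fin N → ℂ}
    (hq : Function.Injective q) :
    D lam I i t z h q = logDer lam i t z h q * W lam I t z h - hamCoeff lam I i t z h q := by
  have hcard : ∀ j, ((Finset.univ.filter (fun p : Fin n => I p = j)).card : ℂ) = lam j :=
    fun j => by rw [(Finset.mem_filter.1 hI).2 j]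
  set w := W lam I t z h with hw
  set f : Fin n → Fin n → ℂ := fun a b => W lam (I ∘ Equiv.swap a b) t z h with hf
  have hfc : ∀ a b, f a b = f b a := fun a b => by simp only [hf, Equiv.swap_comm]
  have hlow : (∑ j ∈ Finset.univ.filter (fun j : Fin N => j < i),
      ∑ p ∈ Finset.univ.filter (fun p : Fin n => I p = j),
        dU lam j i (Function.update I p i) t z h q) =
      -(∑ p ∈ unionTo I i, jump lam I i p t z h) +
      h * ∑ a ∈ Finset.univ.filter (fun a : Fin n => I a = i),
        ∑ b ∈ Finset.univ.filter (fun b : Fin n => a < b ∧ I b < i), f a b +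
      h * ∑ j ∈ Finset.univ.filter (fun j : Fin N => j < i),
        (lam j * w + q j / (q i - q j) * (lam j * w +
          ∑ a ∈ Finset.univ.filter (fun a : Fin n => I a = i),
          ∑ b ∈ Finset.univ.filter (fun b : Fin n => I b = j), f a b)) := by
    rw [← swap_pairs (fun b => I b < i) (fun a => I a = i) f hfc]
    have hu : Finset.univ.filter (fun p : Fin n => I p < i) = unionTo I i := rfl
    rw [hu, ← sum_fiber_lt, ← sum_fiber_lt, Finset.mul_sum, Finset.mul_sum,
      ← Finset.sum_neg_distrib, ← Finset.sum_add_distrib, ← Finset.sum_add_distrib]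
    refine Finset.sum_congr rfl fun j hj => ?_
    have hj' : j < i := (Finset.mem_filter.1 hj).2
    have e : ∀ p ∈ Finset.univ.filter (fun p : Fin n => I p = j),
        dU lam j i (Function.update I p i) t z h q = -jump lam I i p t z h + h * w +
          h * ∑ c ∈ Finset.univ.filter (fun c : Fin n => c < p ∧ I c = i), f p c +
          q j / (q i - q j) * (h * (w +
            ∑ c ∈ Finset.univ.filter (fun c : Fin n => I c = i), f p c)) := by
      intro p hp
      have hp' : I p = j := (Finset.mem_filter.1 hp).2
      subst hp'
      exact dU_lower hI hj' h ht z hq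
    rw [Finset.sum_congr rfl e, Finset.sum_add_distrib, Finset.sum_add_distrib,
      Finset.sum_add_distrib, ← Finset.mul_sum, ← Finset.mul_sum, ← Finset.mul_sum,
      ← Finset.mul_sum, Finset.sum_add_distrib, Finset.sum_const, nsmul_eq_mul,
      hcard, Finset.sum_neg_distrib]
    have e2 : ∑ p ∈ Finset.univ.filter (fun p : Fin n => I p = j),
        ∑ c ∈ Finset.univ.filter (fun c : Fin n => I c = i), f p c =
        ∑ a ∈ Finset.univ.filter (fun a : Fin n => I a = i),
          ∑ b ∈ Finset.univ.filter (fun b : Fin n => I b = j), f a b := by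
      rw [Finset.sum_comm]
      exact Finset.sum_congr rfl fun a _ => Finset.sum_congr rfl fun b _ => hfc b a
    rw [e2]
    ring
  have hup : (∑ j ∈ Finset.univ.filter (fun j : Fin N => i < j),
      ∑ p ∈ Finset.univ.filter (fun p : Fin n => I p = i),
        dU lam i j (Function.update I p j) t z h q) =
      -((∑ j ∈ Finset.univ.filter (fun j : Fin N => i < j),
        ∑ p ∈ Finset.univ.filter (fun p : Fin n => I p = i), jump lam I j p t z h) +
      h * ∑ a ∈ Finset.univ.filter (fun a : Fin n => I a = i),
        ∑ b ∈ Finset.univ.filter (fun b : Fin n => a < b ∧ i < I b), f a b +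
      h * ∑ j ∈ Finset.univ.filter (fun j : Fin N => i < j),
        (q j / (q i - q j) * (lam i * w +
          ∑ a ∈ Finset.univ.filter (fun a : Fin n => I a = i),
          ∑ b ∈ Finset.univ.filter (fun b : Fin n => I b = j), f a b))) := by
    rw [← Finset.sum_congr rfl fun a _ => sum_fiber_gt I i (fun b => a < b) (f a),
      Finset.sum_comm (s := Finset.univ.filter (fun a : Fin n => I a = i))
        (t := Finset.univ.filter (fun j : Fin N => i < j)), Finset.mul_sum, Finset.mul_sum,
      ← Finset.sum_add_distrib, ← Finset.sum_add_distrib, ← Finset.sum_neg_distrib]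
    refine Finset.sum_congr rfl fun j hj => ?_
    have hj' : i < j := (Finset.mem_filter.1 hj).2
    have e : ∀ p ∈ Finset.univ.filter (fun p : Fin n => I p = i),
        dU lam i j (Function.update I p j) t z h q = -(jump lam I j p t z h +
          h * ∑ c ∈ Finset.univ.filter (fun c : Fin n => p < c ∧ I c = j), f p c +
          q j / (q i - q j) * (h * (w +
            ∑ c ∈ Finset.univ.filter (fun c : Fin n => I c = j), f p c))) := by
      intro p hp
      have hp' : I p = i := (Finset.mem_filter.1 hp).2
      subst hp'
      exact dU_upper hI hj' h ht z hq
    rw [Finset.sum_congr rfl e, Finset.sum_neg_distrib, Finset.sum_add_distrib,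
      Finset.sum_add_distrib, ← Finset.mul_sum, ← Finset.mul_sum, ← Finset.mul_sum,
      Finset.sum_add_distrib, Finset.sum_const, nsmul_eq_mul, hcard]
    ring
  have hne : ∑ a ∈ Finset.univ.filter (fun a : Fin n => I a = i),
        ∑ b ∈ Finset.univ.filter (fun b : Fin n => a < b ∧ I b ≠ i), f a b =
      ∑ a ∈ Finset.univ.filter (fun a : Fin n => I a = i),
        ∑ b ∈ Finset.univ.filter (fun b : Fin n => a < b ∧ i < I b), f a b +
      ∑ a ∈ Finset.univ.filter (fun a : Fin n => I a = i),
        ∑ b ∈ Finset.univ.filter (fun b : Fin n => a < b ∧ I b < i), f a b := by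
    rw [← Finset.sum_add_distrib]
    refine Finset.sum_congr rfl fun a _ => ?_
    rw [← Finset.sum_union]
    · refine Finset.sum_congr ?_ fun _ _ => rfl
      ext b
      simp only [Finset.mem_filter, Finset.mem_univ, true_and, Finset.mem_union]
      rw [ne_iff_lt_or_gt, ← and_or_left, or_comm]
    · rw [Finset.disjoint_left]
      intro c hc hc'
      exact lt_asymm (Finset.mem_filter.1 hc).2.2 (Finset.mem_filter.1 hc').2.2
  rw [D, hlow, hup, hamCoeff, logDer, sum_ne_eq_lt_add_gt]
  rw [show (∑ a ∈ Finset.univ.filter (fun a : Fin n => I a = i),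
      ∑ b ∈ Finset.univ.filter (fun b : Fin n => a < b ∧ I b ≠ i),
        W lam (I ∘ Equiv.swap a b) t z h) = _ from hne]
  have hj := sum_jump hI i t z h
  rw [← hw] at hj
  -- For `j < i` the coefficients `q_j / (q_i - q_j)` of the Hamiltonian and `q_i / (q_i - q_j)` of
  -- the logarithmic derivative differ by `1`.
  have hone : ∀ j ∈ Finset.univ.filter (fun j : Fin N => j < i),
      (lam j : ℂ) * (q i / (q i - q j)) = lam j + q j / (q i - q j) * lam j := by
    intro j hj
    have h2 : q i - q j ≠ 0 := sub_ne_zero.2 (hq.ne (Finset.mem_filter.1 hj).2.ne')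
    field_simp
    ring
  rw [Finset.sum_congr rfl hone]
  simp only [mul_add, Finset.sum_add_distrib, ← mul_assoc, ← Finset.sum_mul]
  simp only [hf, mul_comm (lam i : ℂ), ← Finset.sum_mul]
  linear_combination hj

/-! ### The dynamical Hamiltonians on the vector of weight functions -/

theorem eAt_basisVec {N n : ℕ} (a : Fin n) (k l : Fin N) (I : Fin n → Fin N) :
    eAt a k l (basisVec I) = if I a = l then basisVec (Function.update I a k) else 0 := by
  rw [eAt, basisVec, PiTensorProduct.map_tprod]
  have hm : Matrix.toLin' (Matrix.single k l (1 : ℂ)) (Pi.single (I a) 1) =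
      if I a = l then Pi.single k 1 else 0 := by
    ext r
    rw [Matrix.toLin'_apply, Matrix.mulVec_single_one]
    simp only [Matrix.col_apply, Matrix.single_apply]
    by_cases hI : I a = l
    · simp [hI, Pi.single_apply, eq_comm]
    · simp [hI, Ne.symm hI]
  split_ifs with hI
  · rw [basisVec]
    congr 1
    funext m
    by_cases hma : m = a
    · subst hma
      rw [Function.update_self, Function.update_self, hm, if_pos hI]
    · rw [Function.update_of_ne hma, Function.update_of_ne hma]
      rfl
  · apply (PiTensorProduct.tprod ℂ).map_coord_zero a
    rw [Function.update_self, hm, if_neg hI]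

theorem eTot_diag_basisVec {N n : ℕ} (i : Fin N) (I : Fin n → Fin N) :
    eTot i i (basisVec I) =
      ((Finset.univ.filter (fun a : Fin n => I a = i)).card : ℂ) • basisVec I := by
  rw [eTot, LinearMap.sum_apply, Finset.sum_congr rfl (g := fun a =>
    if I a = i then basisVec I else 0)]
  · rw [← Finset.sum_filter, Finset.sum_const, Nat.cast_smul_eq_nsmul]
  · intro a _
    rw [eAt_basisVec]
    split_ifs with h
    · rw [← h, Function.update_eq_self]
    · rfl

theorem update_update_eq_swap' {N n : ℕ} (I : Fin n → Fin N) {a b : Fin n} {i : Fin N}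
    (hab : a ≠ b) (hb : I b = i) :
    Function.update (Function.update I b (I a)) a i = I ∘ Equiv.swap a b := by
  rw [Function.update_comm hab.symm, update_update_eq_swap I hb]

/-- The operator `∑_k e_{i,k}^{(a)} e_{k,i}^{(b)}` exchanges the factors `a` and `b` if the factor
`b` is `v_i`. -/
theorem sum_eAt_eAt_basisVec {N n : ℕ} (a b : Fin n) (hab : a ≠ b) (i : Fin N)
    (I : Fin n → Fin N) :
    ∑ k : Fin N, eAt a i k (eAt b k i (basisVec I)) =
      if I b = i then basisVec (I ∘ Equiv.swap a b) else 0 := by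
  have : ∀ k : Fin N, eAt a i k (eAt b k i (basisVec I)) =
      if k = I a then (if I b = i then basisVec (I ∘ Equiv.swap a b) else 0) else 0 := by
    intro k
    rw [eAt_basisVec]
    by_cases hb : I b = i
    · rw [if_pos hb, if_pos hb, eAt_basisVec, Function.update_of_ne hab]
      by_cases hk : k = I a
      · rw [if_pos hk, if_pos hk.symm, hk, update_update_eq_swap' I hab hb]
      · rw [if_neg hk, if_neg (Ne.symm hk)]
    · rw [if_neg hb, if_neg hb, map_zero, ite_self]
  rw [Finset.sum_congr rfl fun k _ => this k]
  simp

theorem eTot_mul_eTot_basisVec {N n : ℕ} {i j : Fin N} (hij : j ≠ i) (I : Fin n → Fin N) :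
    (eTot i j * eTot j i - eTot i i : Module.End ℂ (TensorSpace N n)) (basisVec I) =
      ∑ a : Fin n, ∑ b : Fin n,
        if I b = i ∧ I a = j then basisVec (I ∘ Equiv.swap a b) else 0 := by
  have e : ∀ a b : Fin n, eAt a i j (eAt b j i (basisVec I)) =
      (if I b = i ∧ I a = j then basisVec (I ∘ Equiv.swap a b) else 0) +
        if a = b then (if I b = i then basisVec I else 0) else 0 := by
    intro a b
    rw [eAt_basisVec]
    by_cases hb : I b = i
    · rw [if_pos hb, if_pos hb, eAt_basisVec]
      by_cases hab : a = b
      · subst hab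
        rw [Function.update_self, if_pos rfl, if_pos rfl, Function.update_idem,
          if_neg (fun h => hij (h.2.symm.trans hb)), zero_add, ← hb, Function.update_eq_self]
      · rw [Function.update_of_ne hab, if_neg hab, add_zero]
        by_cases ha : I a = j
        · rw [if_pos ha, if_pos ⟨hb, ha⟩, ← ha, update_update_eq_swap' I hab hb]
        · rw [if_neg ha, if_neg (fun h => ha h.2)]
    · rw [if_neg hb, if_neg hb, map_zero, ite_self, if_neg (fun h => hb h.1), zero_add]
  rw [LinearMap.sub_apply, Module.End.mul_apply, eTot_diag_basisVec, sub_eq_iff_eq_add]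
  simp only [eTot, LinearMap.sum_apply, map_sum]
  rw [Finset.sum_comm]
  simp only [e, Finset.sum_add_distrib]
  congr 1
  simp only [Finset.sum_ite_eq, Finset.mem_univ, if_true]
  rw [← Finset.sum_filter, Finset.sum_const, Nat.cast_smul_eq_nsmul]

theorem card_pairs {n : ℕ} (S : Finset (Fin n)) :
    (∑ a : Fin n, ∑ b ∈ Finset.univ.filter (fun b : Fin n => a < b),
      if b ∈ S ∧ a ∈ S then (1 : ℂ) else 0) = S.card * (S.card - 1) / 2 := by
  set c := ∑ a : Fin n, ∑ b ∈ Finset.univ.filter (fun b : Fin n => a < b),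
      if b ∈ S ∧ a ∈ S then (1 : ℂ) else 0 with hc
  have h1 : ∑ a : Fin n, ∑ b : Fin n, (if b ∈ S ∧ a ∈ S then (1 : ℂ) else 0) = S.card * S.card := by
    have : ∀ a b : Fin n, (if b ∈ S ∧ a ∈ S then (1 : ℂ) else 0) =
        (if a ∈ S then 1 else 0) * (if b ∈ S then 1 else 0) := fun a b => by
      by_cases ha : a ∈ S <;> by_cases hb : b ∈ S <;> simp [ha, hb]
    simp only [this, ← Finset.mul_sum, ← Finset.sum_mul]
    simp
  have h2 : ∑ a : Fin n, ∑ b : Fin n, (if b ∈ S ∧ a ∈ S then (1 : ℂ) else 0) = c + c + S.card := by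
    have e : ∀ a b : Fin n, (if b ∈ S ∧ a ∈ S then (1 : ℂ) else 0) =
        (if a < b then (if b ∈ S ∧ a ∈ S then (1 : ℂ) else 0) else 0) +
        (if b < a then (if a ∈ S ∧ b ∈ S then (1 : ℂ) else 0) else 0) +
        if a = b then (if b ∈ S then (1 : ℂ) else 0) else 0 := by
      intro a b
      rcases lt_trichotomy a b with h | h | h
      · simp [h, h.not_gt, h.ne]
      · subst h; simp
      · simp [h, h.not_gt, h.ne', and_comm]
    have e1 : c = ∑ a : Fin n, ∑ b : Fin n,
        if a < b then (if b ∈ S ∧ a ∈ S then (1 : ℂ) else 0) else 0 :=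
      Finset.sum_congr rfl fun a _ => Finset.sum_filter _ _
    rw [Finset.sum_congr rfl fun a _ => Finset.sum_congr rfl fun b _ => e a b]
    simp only [Finset.sum_add_distrib]
    rw [← e1, Finset.sum_comm (f := fun a b : Fin n =>
      if b < a then (if a ∈ S ∧ b ∈ S then (1 : ℂ) else 0) else 0), ← e1]
    simp
  rw [h1] at h2
  linear_combination -(1 / 2) * h2

/-- The action of `X_i` on a basis vector. The pairs `a < b` with `I a = I b = i` contribute `m (m -
1) / 2` for `m = |I_i|`, which cancels against `e_{i,i} (1 - e_{i,i}) / 2`. -/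
theorem X_basisVec {N n : ℕ} (i : Fin N) (z : Fin n → ℂ) (h : ℂ) (q : Fin N → ℂ)
    (I : Fin n → Fin N) :
    X i z h q (basisVec I) =
      (∑ a ∈ Finset.univ.filter (fun a : Fin n => I a = i), z a) • basisVec I -
      h • ((∑ a : Fin n, ∑ b : Fin n, if a < b ∧ I b = i ∧ I a ≠ i then
          basisVec (I ∘ Equiv.swap a b) else 0) +
        ∑ j ∈ Finset.univ.filter (fun j : Fin N => j ≠ i), (q j / (q i - q j)) •
          ∑ a : Fin n, ∑ b : Fin n,
            if I b = i ∧ I a = j then basisVec (I ∘ Equiv.swap a b) else 0) := by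
  set S := Finset.univ.filter (fun a : Fin n => I a = i) with hS
  have hmem : ∀ a, I a = i ↔ a ∈ S := fun a => by simp [hS]
  rw [X, LinearMap.sub_apply, LinearMap.sum_apply, LinearMap.smul_apply]
  congr 1
  · rw [Finset.sum_smul, Finset.sum_filter]
    refine Finset.sum_congr rfl fun a _ => ?_
    rw [LinearMap.smul_apply, eAt_basisVec]
    split_ifs with ha
    · rw [← ha, Function.update_eq_self]
    · rw [smul_zero]
  · congr 1
    rw [LinearMap.add_apply, LinearMap.add_apply]
    congr 1
    · have e : ∀ a b : Fin n, a < b → (∑ k : Fin N, eAt a i k (eAt b k i (basisVec I))) =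
          (if I b = i ∧ I a ≠ i then basisVec (I ∘ Equiv.swap a b) else 0) +
            (if b ∈ S ∧ a ∈ S then (1 : ℂ) else 0) • basisVec I := by
        intro a b hab
        rw [sum_eAt_eAt_basisVec a b hab.ne]
        simp only [← hmem]
        by_cases hb : I b = i
        · by_cases ha : I a = i
          · have : I ∘ Equiv.swap a b = I := by
              rw [← update_update_eq_swap' I hab.ne hb, ha, ← hb, Function.update_eq_self, hb, ← ha,
                Function.update_eq_self]
            simp [ha, hb, this]
          · simp [ha, hb]
        · simp [hb]
      have hsum : (∑ a : Fin n, ∑ b ∈ Finset.univ.filter (fun b : Fin n => a < b), ∑ k : Fin N,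
          eAt a i k * eAt b k i) (basisVec I) =
          (∑ a : Fin n, ∑ b : Fin n, if a < b ∧ I b = i ∧ I a ≠ i then
            basisVec (I ∘ Equiv.swap a b) else 0) +
          ((S.card : ℂ) * (S.card - 1) / 2) • basisVec I := by
        rw [← card_pairs, Finset.sum_smul]
        simp only [LinearMap.sum_apply, Module.End.mul_apply, Finset.sum_smul]
        rw [← Finset.sum_add_distrib]
        refine Finset.sum_congr rfl fun a _ => ?_
        simp only [ite_and (a < _)]
        rw [← Finset.sum_filter, ← Finset.sum_add_distrib]
        exact Finset.sum_congr rfl fun b hb => e a b (Finset.mem_filter.1 hb).2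
      rw [hsum, LinearMap.smul_apply, Module.End.mul_apply, LinearMap.sub_apply,
        Module.End.one_apply, eTot_diag_basisVec, map_sub, map_smul, eTot_diag_basisVec, ← hS]
      module
    · rw [LinearMap.sum_apply]
      refine Finset.sum_congr rfl fun j hj => ?_
      rw [LinearMap.smul_apply, eTot_mul_eTot_basisVec (Finset.mem_filter.1 hj).2]

theorem comp_swap_mem_parts {N n : ℕ} {lam : Fin N → ℕ} {I : Fin n → Fin N}
    (hI : I ∈ parts n lam) (a b : Fin n) : I ∘ Equiv.swap a b ∈ parts n lam := by
  refine Finset.mem_filter.2 ⟨Finset.mem_univ _, fun k => ?_⟩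
  rw [← (Finset.mem_filter.1 hI).2 k]
  refine Finset.card_nbij' (Equiv.swap a b) (Equiv.swap a b) ?_ ?_ ?_ ?_ <;>
    intro m hm <;> simp_all

theorem sum_parts_swap {N n : ℕ} (lam : Fin N → ℕ) {M : Type*} [AddCommMonoid M] (a b : Fin n)
    (g : (Fin n → Fin N) → (Fin n → Fin N) → M) :
    ∑ I ∈ parts n lam, g I (I ∘ Equiv.swap a b) =
      ∑ I ∈ parts n lam, g (I ∘ Equiv.swap a b) I := by
  have hinv : ∀ I : Fin n → Fin N, (I ∘ Equiv.swap a b) ∘ Equiv.swap a b = I := fun I => by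
    funext m; simp
  refine Finset.sum_nbij' (fun I => I ∘ Equiv.swap a b) (fun I => I ∘ Equiv.swap a b)
    (fun I hI => comp_swap_mem_parts hI a b) (fun I hI => comp_swap_mem_parts hI a b)
    (fun I _ => hinv I) (fun I _ => hinv I) fun I _ => ?_
  simp only [hinv]

theorem X_Wvec {N n : ℕ} (lam : Fin N → ℕ) (i : Fin N) (t : ℕ → ℕ → ℂ) (z : Fin n → ℂ) (h : ℂ)
    (q : Fin N → ℂ) :
    X i z h q (Wvec n lam t z h) =
      ∑ I ∈ parts n lam, hamCoeff lam I i t z h q • basisVec I := by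
  set w : (Fin n → Fin N) → ℂ := fun I => W lam I t z h with hw
  -- Reindexing by `I ↦ I ∘ swap a b` turns sums of basis vectors into sums of coefficients.
  have key : ∀ P : Fin n → Fin n → Fin N → Fin N → Prop,
      ∀ [∀ a b k l, Decidable (P a b k l)],
      ∑ I ∈ parts n lam, w I • (∑ a : Fin n, ∑ b : Fin n,
        if P a b (I b) (I a) then basisVec (I ∘ Equiv.swap a b) else 0) =
      ∑ I ∈ parts n lam, (∑ a : Fin n, ∑ b : Fin n,
        if P a b (I a) (I b) then w (I ∘ Equiv.swap a b) else 0) • basisVec I := by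
    intro P _
    simp only [Finset.smul_sum, Finset.sum_smul]
    rw [Finset.sum_comm, Finset.sum_comm (s := parts n lam)]
    refine Finset.sum_congr rfl fun a _ => ?_
    rw [Finset.sum_comm, Finset.sum_comm (s := parts n lam)]
    refine Finset.sum_congr rfl fun b _ => ?_
    have := sum_parts_swap lam a b (fun I K : Fin n → Fin N =>
      (if P a b (K a) (K b) then w I else 0) • (basisVec K : TensorSpace N n))
    rw [← this]
    refine Finset.sum_congr rfl fun I _ => ?_
    simp only [Function.comp_apply, Equiv.swap_apply_left, Equiv.swap_apply_right]
    split_ifs <;> simp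
  have e1 := key (fun a b k l => a < b ∧ k = i ∧ l ≠ i)
  have e2 := fun j => key (fun _ _ k l => k = i ∧ l = j)
  rw [Wvec, map_sum]
  simp only [map_smul, X_basisVec, smul_sub, Finset.sum_sub_distrib]
  have e3 : ∑ I ∈ parts n lam, w I • h • ((∑ a : Fin n, ∑ b : Fin n,
        if a < b ∧ I b = i ∧ I a ≠ i then basisVec (I ∘ Equiv.swap a b) else 0) +
        ∑ j ∈ Finset.univ.filter (fun j : Fin N => j ≠ i), (q j / (q i - q j)) •
          ∑ a : Fin n, ∑ b : Fin n,
            if I b = i ∧ I a = j then basisVec (I ∘ Equiv.swap a b) else 0) =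
      h • ((∑ I ∈ parts n lam, w I • ∑ a : Fin n, ∑ b : Fin n,
        if a < b ∧ I b = i ∧ I a ≠ i then basisVec (I ∘ Equiv.swap a b) else 0) +
        ∑ j ∈ Finset.univ.filter (fun j : Fin N => j ≠ i), (q j / (q i - q j)) •
          ∑ I ∈ parts n lam, w I • ∑ a : Fin n, ∑ b : Fin n,
            if I b = i ∧ I a = j then basisVec (I ∘ Equiv.swap a b) else 0) := by
    simp only [smul_comm _ h, ← Finset.smul_sum, smul_add, Finset.sum_add_distrib]
    congr 2
    simp only [Finset.smul_sum (s := Finset.univ.filter (fun j : Fin N => j ≠ i))]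
    rw [Finset.sum_comm]
    refine Finset.sum_congr rfl fun j _ => ?_
    rw [Finset.smul_sum]
    exact Finset.sum_congr rfl fun I _ => smul_comm _ _ _
  rw [e3, e1]
  simp only [e2]
  simp only [Finset.smul_sum, smul_smul]
  rw [Finset.sum_comm, ← Finset.sum_add_distrib, Finset.smul_sum, ← Finset.sum_sub_distrib]
  refine Finset.sum_congr rfl fun I _ => ?_
  rw [← Finset.sum_smul, ← add_smul, smul_smul, ← sub_smul]
  congr 1
  rw [hamCoeff]
  have e4 : ∀ j, ∑ a : Fin n, ∑ b : Fin n,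
        (if I a = i ∧ I b = j then w (I ∘ Equiv.swap a b) else 0) =
      ∑ a ∈ Finset.univ.filter (fun a : Fin n => I a = i),
          ∑ b ∈ Finset.univ.filter (fun b : Fin n => I b = j), w (I ∘ Equiv.swap a b) := by
    intro j
    rw [Finset.sum_filter]
    refine Finset.sum_congr rfl fun a _ => ?_
    rw [Finset.sum_filter]
    split_ifs with ha
    · simp [ha]
    · simp [ha]
  have e5 : ∑ a : Fin n, ∑ b : Fin n,
        (if a < b ∧ I a = i ∧ I b ≠ i then w (I ∘ Equiv.swap a b) else 0) =
      ∑ a ∈ Finset.univ.filter (fun a : Fin n => I a = i),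
          ∑ b ∈ Finset.univ.filter (fun b : Fin n => a < b ∧ I b ≠ i),
            w (I ∘ Equiv.swap a b) := by
    rw [Finset.sum_filter]
    refine Finset.sum_congr rfl fun a _ => ?_
    rw [Finset.sum_filter]
    split_ifs with ha
    · simp [ha]
    · simp [ha]
  simp only [e4, e5]
  ring

/-! ### The logarithmic derivative of the prefactor -/

theorem hasDerivAt_update_apply {N : ℕ} (q : Fin N → ℂ) (i k : Fin N) :
    HasDerivAt (fun u : ℂ => Function.update q i u k) (if k = i then 1 else 0) (q i) := by
  by_cases hk : k = i
  · subst hk; simpa using hasDerivAt_id' (q k)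
  · simpa [hk, Function.update_of_ne hk] using hasDerivAt_const (q i) (q k)

/-- The partial derivative of a branch of `log f` is the logarithmic derivative of `f`. -/
theorem IsLogBranch.hasDerivAt {N : ℕ} {O : Set (Fin N → ℂ)} (hO : IsOpen O)
    {f ℓ : (Fin N → ℂ) → ℂ} (hf : IsLogBranch O f ℓ) {q : Fin N → ℂ} (hq : q ∈ O) {i : Fin N}
    {f' : ℂ} (hf' : HasDerivAt (fun u : ℂ => f (Function.update q i u)) f' (q i)) :
    HasDerivAt (fun u : ℂ => ℓ (Function.update q i u)) (f' / f q) (q i) := by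
  have hupd : HasDerivAt (fun u : ℂ => Function.update q i u) (Pi.single i 1) (q i) :=
    hasDerivAt_update q i (q i)
  have hqe : Function.update q i (q i) = q := Function.update_eq_self i q
  have hd : DifferentiableAt ℂ ℓ (Function.update q i (q i)) := by
    rw [hqe]; exact hf.1.differentiableAt (hO.mem_nhds hq)
  have hg : DifferentiableAt ℂ (fun u : ℂ => ℓ (Function.update q i u)) (q i) :=
    DifferentiableAt.comp (q i) hd hupd.differentiableAt
  have hev : (fun u : ℂ => Complex.exp (ℓ (Function.update q i u))) =ᶠ[nhds (q i)]
      fun u => f (Function.update q i u) := by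
    have : ∀ᶠ u in nhds (q i), Function.update q i u ∈ O :=
      hupd.continuousAt.eventually_mem (hO.mem_nhds (by rw [hqe]; exact hq))
    filter_upwards [this] with u hu using hf.2 _ hu
  have h1 := hg.hasDerivAt.cexp
  have h2 := (hf'.congr_of_eventuallyEq hev).unique h1
  have h3 : f q ≠ 0 := by rw [← hf.2 q hq]; exact Complex.exp_ne_zero _
  have h4 : deriv (fun u : ℂ => ℓ (Function.update q i u)) (q i) = f' / f q := by
    rw [h2, hqe, hf.2 q hq]
    field_simp
  rw [← h4]
  exact hg.hasDerivAt

theorem powBase_logDeriv {N n : ℕ} (lam : Fin N → ℕ) {O : Set (Fin N → ℂ)} (hO : IsOpen O)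
    {q : Fin N → ℂ} (hq : q ∈ O) (h0 : ∀ k, q k ≠ 0) (k i : Fin N) {ℓ : (Fin N → ℂ) → ℂ}
    (hℓ : IsLogBranch O (powBase n lam k) ℓ) :
    HasDerivAt (fun u : ℂ => ℓ (Function.update q i u))
      (((if k = i then 1 else 0) - (if k.val + 1 = i.val then 1 else 0)) / q i) (q i) := by
  by_cases hk : k.val + 1 < N
  · have hd := (((hasDerivAt_update_apply q i k).div
      (hasDerivAt_update_apply q i ⟨k.val + 1, hk⟩) (by simpa using h0 _)).const_mul
        (Complex.exp (Real.pi * Complex.I * ((lam ⟨k.val + 1, hk⟩ : ℂ) - (lam k : ℂ)))))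
    have := hℓ.hasDerivAt hO hq (i := i) (by
      simp only [powBase, dif_pos hk]
      exact hd)
    convert this using 1
    simp only [powBase, dif_pos hk, Function.update_eq_self]
    have h1 := h0 k
    have h2 := h0 ⟨k.val + 1, hk⟩
    have h3 := Complex.exp_ne_zero
      (Real.pi * Complex.I * ((lam ⟨k.val + 1, hk⟩ : ℂ) - (lam k : ℂ)))
    by_cases hki : k = i
    · subst hki
      have : ¬ ((⟨k.val + 1, hk⟩ : Fin N) = k) := by simp [Fin.ext_iff]
      simp only [this, if_true, if_false]
      rw [if_neg (by omega)]
      field_simp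
      ring
    · by_cases hki' : k.val + 1 = i.val
      · have : (⟨k.val + 1, hk⟩ : Fin N) = i := Fin.ext hki'
        rw [if_neg hki, if_pos hki', if_pos this]
        rw [this] at h2 h3 ⊢
        field_simp
        ring
      · have : ¬ ((⟨k.val + 1, hk⟩ : Fin N) = i) := by simpa [Fin.ext_iff] using hki'
        rw [if_neg hki, if_neg hki', if_neg this]
        simp
  · have hd := (hasDerivAt_update_apply q i k).const_mul
        (Complex.exp (Real.pi * Complex.I * ((n : ℂ) - (lam k : ℂ))))
    have := hℓ.hasDerivAt hO hq (i := i) (by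
      simp only [powBase, dif_neg hk]
      exact hd)
    convert this using 1
    simp only [powBase, dif_neg hk]
    have h1 := h0 k
    have h3 := Complex.exp_ne_zero (Real.pi * Complex.I * ((n : ℂ) - (lam k : ℂ)))
    have hki' : ¬ (k.val + 1 = i.val) := by omega
    by_cases hki : k = i
    · subst hki
      simp only [if_true]
      rw [if_neg (by omega)]
      field_simp
      ring
    · rw [if_neg hki, if_neg hki']
      simp

theorem ratio_logDeriv {N : ℕ} {O : Set (Fin N → ℂ)} (hO : IsOpen O)
    {q : Fin N → ℂ} (hq : q ∈ O) (h0 : ∀ k, q k ≠ 0) (hinj : Function.Injective q)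
    {k l : Fin N} (hkl : k < l) (i : Fin N) {m : (Fin N → ℂ) → ℂ}
    (hm : IsLogBranch O (fun q => 1 - q l / q k) m) :
    HasDerivAt (fun u : ℂ => m (Function.update q i u))
      (((if k = i then q l / (q i - q l) else 0) + (if l = i then q i / (q i - q k) else 0)) / q i)
      (q i) := by
  have hd := ((hasDerivAt_update_apply q i l).div
      (hasDerivAt_update_apply q i k) (by simpa using h0 _)).const_sub 1
  have := hm.hasDerivAt hO hq hd
  convert this using 1
  simp only [Function.update_eq_self]
  have h1 := h0 k
  have h2 := h0 l
  have h3 : q k - q l ≠ 0 := sub_ne_zero.2 (hinj.ne hkl.ne)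
  have h3' : q l - q k ≠ 0 := sub_ne_zero.2 (hinj.ne hkl.ne')
  have h4 : 1 - q l / q k ≠ 0 := by
    rw [show 1 - q l / q k = (q k - q l) / q k by field_simp]
    exact div_ne_zero h3 h1
  by_cases hki : k = i
  · subst hki
    simp only [hkl.ne', if_true, if_false]
    rw [show 1 - q l / q k = (q k - q l) / q k by field_simp]
    field_simp
    ring
  · by_cases hli : l = i
    · subst hli
      simp only [hkl.ne, if_true, if_false]
      rw [show 1 - q l / q k = -(q l - q k) / q k by field_simp; ring]
      field_simp
      ring
    · simp [hki, hli]

/-- The derivative of `Ω_λ Φ_λ` in `q_i`. It suffices to differentiate the exponents, since the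
remaining factor of `Φ_λ` does not depend on `q`. -/
theorem hasDerivAt_prefactor {N n : ℕ} (lam : Fin N → ℕ) {κ : ℂ} (hκ : κ ≠ 0) (i : Fin N)
    (h : ℂ) (z : Fin n → ℂ) (t : ℕ → ℕ → ℂ) {O : Set (Fin N → ℂ)} (hO : IsOpen O)
    {L : (Fin N → ℂ) → Fin N → ℂ} {M : (Fin N → ℂ) → Fin N → Fin N → ℂ}
    (hL : ∀ k, IsLogBranch O (powBase n lam k) (fun q => L q k))
    (hM : ∀ k l, k < l → IsLogBranch O (fun q => 1 - q l / q k) (fun q => M q k l))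
    {q : Fin N → ℂ} (hq : q ∈ O) (h0 : ∀ k, q k ≠ 0) (hinj : Function.Injective q) :
    HasDerivAt (fun u : ℂ => Omega lam κ h (M (Function.update q i u)) *
        Phi lam κ t z h (L (Function.update q i u)))
      (logDer lam i t z h q / (κ * q i) * (Omega lam κ h (M q) * Phi lam κ t z h (L q))) (q i) := by
  set c : Fin N → ℂ := fun k =>
    (∑ a ∈ Finset.range (lev lam (k.val + 1)), allVars N t z (k.val + 1) a) / κ with hc
  set R : ℂ := ∏ j ∈ Finset.Icc 1 (N - 1), ∏ a ∈ Finset.range (lev lam j),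
      ((∏ b ∈ (Finset.range (lev lam j)).erase a,
          1 / ((t j a - t j b - h) * phi κ h (t j a - t j b))) *
        ∏ c ∈ Finset.range (lev lam (j + 1)), phi κ h (t j a - allVars N t z (j + 1) c)) with hR
  set E : (Fin N → ℂ) → ℂ := fun q =>
    (∑ k : Fin N, ∑ l ∈ Finset.univ.filter (fun l : Fin N => k < l),
      M q k l * (h * (lam k : ℂ) / κ)) + ∑ k : Fin N, L q k * c k with hE
  have hfac : ∀ q, Omega lam κ h (M q) * Phi lam κ t z h (L q) = Complex.exp (E q) * R := by
    intro q
    rw [Omega, Phi, hE]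
    simp only [Complex.exp_add, Complex.exp_sum]
    rw [mul_assoc]
  have hEd : HasDerivAt (fun u : ℂ => E (Function.update q i u))
      ((∑ k : Fin N, ∑ l ∈ Finset.univ.filter (fun l : Fin N => k < l),
        ((if k = i then q l / (q i - q l) else 0) + (if l = i then q i / (q i - q k) else 0)) / q i
          * (h * (lam k : ℂ) / κ)) +
      ∑ k : Fin N, ((if k = i then 1 else 0) - (if k.val + 1 = i.val then 1 else 0)) / q i * c k)
      (q i) := by
    refine HasDerivAt.add (HasDerivAt.fun_sum fun k _ => HasDerivAt.fun_sum fun l hl => ?_)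
      (HasDerivAt.fun_sum fun k _ => ?_)
    · exact (ratio_logDeriv hO hq h0 hinj (Finset.mem_filter.1 hl).2 i
        (hM k l (Finset.mem_filter.1 hl).2)).mul_const _
    · exact (powBase_logDeriv lam hO hq h0 k i (hL k)).mul_const _
  have hval : ((∑ k : Fin N, ∑ l ∈ Finset.univ.filter (fun l : Fin N => k < l),
        ((if k = i then q l / (q i - q l) else 0) + (if l = i then q i / (q i - q k) else 0)) / q i
          * (h * (lam k : ℂ) / κ)) +
      ∑ k : Fin N, ((if k = i then 1 else 0) - (if k.val + 1 = i.val then 1 else 0)) / q i * c k) =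
      logDer lam i t z h q / (κ * q i) := by
    have s1 : ∑ k : Fin N, ∑ l ∈ Finset.univ.filter (fun l : Fin N => k < l),
        (if k = i then q l / (q i - q l) * (lam k : ℂ) else 0) =
        ∑ l ∈ Finset.univ.filter (fun l : Fin N => i < l), lam i * (q l / (q i - q l)) := by
      rw [Finset.sum_eq_single i]
      · exact Finset.sum_congr rfl fun l _ => by rw [if_pos rfl, mul_comm]
      · intro k _ hk
        exact Finset.sum_eq_zero fun l _ => if_neg hk
      · simp
    have s2 : ∑ k : Fin N, ∑ l ∈ Finset.univ.filter (fun l : Fin N => k < l),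
        (if l = i then q i / (q i - q k) * (lam k : ℂ) else 0) =
        ∑ k ∈ Finset.univ.filter (fun k : Fin N => k < i), lam k * (q i / (q i - q k)) := by
      rw [Finset.sum_filter]
      refine Finset.sum_congr rfl fun k _ => ?_
      rw [Finset.sum_ite_eq']
      simp [mul_comm]
    have s3 : ∑ k : Fin N, ((if k = i then 1 else 0) - (if k.val + 1 = i.val then 1 else 0)) * c k =
        levelDiff lam i t z / κ := by
      simp only [sub_mul, Finset.sum_sub_distrib, ite_mul, one_mul, zero_mul, Finset.sum_ite_eq',
        Finset.mem_univ, if_true]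
      rw [levelDiff, sub_div]
      congr 1
      by_cases hi : i.val = 0
      · rw [Finset.sum_eq_zero fun k _ => if_neg (by omega)]
        simp [hi, lev]
      · have hi' := i.isLt
        rw [Finset.sum_eq_single ⟨i.val - 1, by omega⟩]
        · have : i.val - 1 + 1 = i.val := by omega
          simp only [hc, this, if_true]
        · intro k _ hk
          refine if_neg fun h => hk (Fin.ext ?_)
          simp only
          omega
        · simp
    have hqi := h0 i
    have s4 : ∑ k : Fin N, ((if k = i then 1 else 0) - (if k.val + 1 = i.val then 1 else 0)) /
        q i * c k = levelDiff lam i t z / κ / q i := by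
      rw [← s3, Finset.sum_div]
      exact Finset.sum_congr rfl fun k _ => by ring
    rw [s4, logDer, ← s1, ← s2, ← Finset.sum_add_distrib]
    simp only [← Finset.sum_add_distrib]
    rw [add_div, add_comm]
    congr 1
    · rw [div_div]
    · rw [mul_div_assoc, Finset.sum_div, Finset.mul_sum]
      refine Finset.sum_congr rfl fun k _ => ?_
      rw [Finset.sum_div, Finset.mul_sum]
      refine Finset.sum_congr rfl fun l _ => ?_
      split_ifs <;> field_simp
      all_goals try ring
  rw [hval] at hEd
  simp only [hfac]
  have := hEd.cexp.mul_const R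
  rw [Function.update_eq_self] at this
  exact this.congr_deriv (by ring)

/-! ### The dynamical equation -/

/-- The dynamical equation at a point `q` of the domain of the branches. -/
theorem dynamical_equation {N n : ℕ} (lam : Fin N → ℕ) {κ : ℂ} (hκ : κ ≠ 0) (i : Fin N)
    (h : ℂ) (z : Fin n → ℂ) {t : ℕ → ℕ → ℂ} (ht : Distinct lam t) {O : Set (Fin N → ℂ)}
    (hO : IsOpen O)
    {L : (Fin N → ℂ) → Fin N → ℂ} {M : (Fin N → ℂ) → Fin N → Fin N → ℂ}
    (hL : ∀ k, IsLogBranch O (powBase n lam k) (fun q => L q k))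
    (hM : ∀ k l, k < l → IsLogBranch O (fun q => 1 - q l / q k) (fun q => M q k l))
    {q : Fin N → ℂ} (hq : q ∈ O) (h0 : ∀ k, q k ≠ 0) (hinj : Function.Injective q) :
    ∃ G : TensorSpace N n,
      HasPartialDeriv i (fun q' => (Omega lam κ h (M q') * Phi lam κ t z h (L q')) •
        Wvec n lam t z h) G q ∧
      (κ * q i) • G - X i z h q
          ((Omega lam κ h (M q) * Phi lam κ t z h (L q)) • Wvec n lam t z h) =
        (Omega lam κ h (M q) * Phi lam κ t z h (L q)) •
          ∑ I ∈ parts n lam, D lam I i t z h q • basisVec I := by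
  refine ⟨(logDer lam i t z h q / (κ * q i) *
    (Omega lam κ h (M q) * Phi lam κ t z h (L q))) • Wvec n lam t z h, ?_, ?_⟩
  · intro f
    simp only [map_smul, smul_eq_mul]
    exact (hasDerivAt_prefactor lam hκ i h z t hO hL hM hq h0 hinj).mul_const _
  · have hne : κ * q i ≠ 0 := mul_ne_zero hκ (h0 i)
    rw [map_smul, X_Wvec, smul_smul, ← mul_assoc, mul_div_cancel₀ _ hne, mul_comm, ← smul_smul]
    refine (smul_sub _ _ _).symm.trans ?_
    rw [Wvec, Finset.smul_sum, ← Finset.sum_sub_distrib]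
    congr 1
    refine Finset.sum_congr rfl fun I hI => ?_
    rw [D_eq hI i ht z h hinj, smul_smul]
    exact (sub_smul _ _ _).symm

/-! ### The master function under permutations and shifts -/

/-- The difference equation of `φ`, by the functional equation of `Γ`. -/
theorem phi_add {κ h x : ℂ} (hκ : κ ≠ 0) (hx : x ≠ 0) (hx' : x + κ - h ≠ 0) :
    phi κ h (x + κ) * (x + κ - h) = -x * phi κ h x := by
  have e1 : (x + κ) / κ = x / κ + 1 := by field_simp
  have e2 : (h - x) / κ = (h - (x + κ)) / κ + 1 := by field_simp; ring
  have hx2 : (h - (x + κ)) / κ ≠ 0 := by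
    refine div_ne_zero ?_ hκ
    rw [← neg_sub]
    exact neg_ne_zero.2 hx'
  rw [phi, phi, e1, e2, Complex.Gamma_add_one _ (div_ne_zero hx hκ),
    Complex.Gamma_add_one _ hx2]
  field_simp
  ring

theorem phi_sub {κ h x : ℂ} (hκ : κ ≠ 0) (hx : x - κ ≠ 0) (hx' : x - h ≠ 0) :
    phi κ h (x - κ) * (x - κ) = -(x - h) * phi κ h x := by
  have := phi_add (h := h) hκ hx (by rwa [sub_add_cancel])
  rw [sub_add_cancel] at this
  linear_combination this

theorem phi_ne_zero {κ h x : ℂ} (hκ : κ ≠ 0) (hx : ¬ InLattice κ x) (hx' : ¬ InLattice κ (x - h)) :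
    phi κ h x ≠ 0 := by
  refine mul_ne_zero (Complex.Gamma_ne_zero fun m hm => hx ⟨-m, ?_⟩)
    (Complex.Gamma_ne_zero fun m hm => hx' ⟨m, ?_⟩)
  · rw [div_eq_iff hκ] at hm
    rw [hm]; push_cast; ring
  · rw [div_eq_iff hκ] at hm
    rw [← neg_sub, hm]; push_cast; ring

theorem InLattice.zero (κ : ℂ) : InLattice κ 0 := ⟨0, by simp⟩

theorem ne_zero_of_not_inLattice {κ x : ℂ} (hx : ¬ InLattice κ x) : x ≠ 0 :=
  fun h => hx (h ▸ InLattice.zero κ)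

theorem add_ne_zero_of_not_inLattice {κ x : ℂ} (hx : ¬ InLattice κ x) : x + κ ≠ 0 :=
  fun h => hx ⟨-1, by rw [eq_neg_of_add_eq_zero_left h]; push_cast; ring⟩

theorem sub_ne_zero_of_not_inLattice {κ x : ℂ} (hx : ¬ InLattice κ x) : x - κ ≠ 0 :=
  fun h => hx ⟨1, by rw [sub_eq_zero.1 h]; push_cast; ring⟩

/-- The factor of an ordered pair of variables of the same level in the master function. -/
def theta (κ h x : ℂ) : ℂ := 1 / ((x - h) * phi κ h x)

theorem theta_shift {κ h x : ℂ} (hκ : κ ≠ 0) (hx : ¬ InLattice κ x)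
    (hx1 : ¬ InLattice κ (x - h)) (hx2 : ¬ InLattice κ (-x - h)) :
    theta κ h (x + κ) * theta κ h (-(x + κ)) * ((-(x + κ) - h) / -(x + κ)) =
      theta κ h x * theta κ h (-x) * ((x - h) / x) := by
  have hx0 := ne_zero_of_not_inLattice hx
  have h1 : x - h ≠ 0 := ne_zero_of_not_inLattice hx1
  have h2 : -x - h ≠ 0 := ne_zero_of_not_inLattice hx2
  have h3 : x + κ ≠ 0 := add_ne_zero_of_not_inLattice hx
  have h3' : -x - κ ≠ 0 := by rw [← neg_add']; exact neg_ne_zero.2 h3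
  have h4 : x + κ - h ≠ 0 := by
    have := add_ne_zero_of_not_inLattice hx1
    rwa [sub_add_eq_add_sub] at this
  have h5 : -(x + κ) - h ≠ 0 := by
    have := sub_ne_zero_of_not_inLattice hx2
    rwa [show -x - h - κ = -(x + κ) - h by ring] at this
  have e1 := phi_add (h := h) hκ hx0 h4
  have e2 := phi_sub (h := h) (x := -x) hκ h3' h2
  have a1 : theta κ h (x + κ) = 1 / (-x * phi κ h x) := by
    rw [theta, ← e1, mul_comm (phi κ h (x + κ))]
  have a2 : theta κ h (-(x + κ)) * ((-(x + κ) - h) / -(x + κ)) =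
      1 / (-(-x - h) * phi κ h (-x)) := by
    rw [theta, ← e2, neg_add']
    rw [neg_add'] at h5
    by_cases hp : phi κ h (-x - κ) = 0
    · simp [hp]
    · field_simp
  rw [mul_assoc, a2, a1, theta, theta]
  have hp := phi_ne_zero hκ hx hx1
  have hp' := phi_ne_zero (x := -x) hκ (fun ⟨k, hk⟩ => hx ⟨-k, by
    push_cast; linear_combination -hk⟩) hx2
  have h6 : -(-x - h) ≠ 0 := neg_ne_zero.2 h2
  field_simp

theorem prod_range_permIdx {N : ℕ} {lam : Fin N → ℕ} (σ : PermGroup lam) (j : ℕ) (f : ℕ → ℂ) :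
    ∏ r ∈ Finset.range (lev lam j), f (permIdx lam σ j r) =
      ∏ r ∈ Finset.range (lev lam j), f r := by
  conv_rhs => rw [← permIdx_image_range σ j]
  rw [Finset.prod_image (permIdx_injective σ j).injOn]

/-- The master function is symmetric in the variables of each level. -/
theorem Phi_permute {N n : ℕ} {lam : Fin N → ℕ} (κ : ℂ) (σ : PermGroup lam) (t : ℕ → ℕ → ℂ)
    (z : Fin n → ℂ) (h : ℂ) (ℓ : Fin N → ℂ) :
    Phi lam κ (permute lam σ t) z h ℓ = Phi lam κ t z h ℓ := by
  rw [Phi, Phi]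
  congr 1
  · refine Finset.prod_congr rfl fun i _ => ?_
    simp only [allVars_permute]
    rw [sum_range_permIdx σ (i.val + 1) (fun r => allVars N t z (i.val + 1) r)]
  · refine Finset.prod_congr rfl fun j _ => ?_
    simp only [allVars_permute, permute_apply]
    rw [← prod_range_permIdx σ j (fun a => (∏ b ∈ (Finset.range (lev lam j)).erase a,
          1 / ((t j a - t j b - h) * phi κ h (t j a - t j b))) *
        ∏ c ∈ Finset.range (lev lam (j + 1)), phi κ h (t j a - allVars N t z (j + 1) c))]
    refine Finset.prod_congr rfl fun a _ => ?_
    congr 1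
    · conv_rhs => rw [← permIdx_image_range σ j, ← Finset.image_erase (permIdx_injective σ j)]
      rw [Finset.prod_image (permIdx_injective σ j).injOn]
    · exact prod_range_permIdx σ (j + 1)
        (fun c => phi κ h (t j (permIdx lam σ j a) - allVars N t z (j + 1) c))

theorem Generic.permute {N n : ℕ} {lam : Fin N → ℕ} {κ : ℂ} {t : ℕ → ℕ → ℂ} {z : Fin n → ℂ}
    {h : ℂ} {q : Fin N → ℂ} (hg : Generic lam κ t z h q) (σ : PermGroup lam) :
    Generic lam κ (permute lam σ t) z h q := by
  refine ⟨fun j hj a ha b hb hab => ?_, fun j hj a ha c hc => ?_, hg.2.2⟩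
  · simp only [permute_apply]
    exact hg.1 j hj _ (permIdx_lt σ ha) _ (permIdx_lt σ hb)
      (fun h => hab (permIdx_injective σ j h))
  · simp only [allVars_permute, permute_apply]
    exact hg.2.1 j hj _ (permIdx_lt σ ha) _ (permIdx_lt σ hc)

theorem Phi_ne_zero {N n : ℕ} {lam : Fin N → ℕ} {κ : ℂ} (hκ : κ ≠ 0) {t : ℕ → ℕ → ℂ}
    {z : Fin n → ℂ} {h : ℂ} {q : Fin N → ℂ} (hg : Generic lam κ t z h q) (ℓ : Fin N → ℂ) :
    Phi lam κ t z h ℓ ≠ 0 := by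
  refine mul_ne_zero (Finset.prod_ne_zero_iff.2 fun _ _ => Complex.exp_ne_zero _)
    (Finset.prod_ne_zero_iff.2 fun j hj => Finset.prod_ne_zero_iff.2 fun a ha =>
      mul_ne_zero (Finset.prod_ne_zero_iff.2 fun b hb => ?_)
        (Finset.prod_ne_zero_iff.2 fun c hc => ?_))
  · have hb' := Finset.mem_erase.1 hb
    have := hg.1 j hj a (Finset.mem_range.1 ha) b (Finset.mem_range.1 hb'.2) (Ne.symm hb'.1)
    exact div_ne_zero one_ne_zero
      (mul_ne_zero (ne_zero_of_not_inLattice this.2) (phi_ne_zero hκ this.1 this.2))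
  · have := hg.2.1 j hj a (Finset.mem_range.1 ha) c (Finset.mem_range.1 hc)
    exact phi_ne_zero hκ this.1 this.2

/-! ### Splitting off the extra column in the master function -/

theorem prod_offdiag_succ (m : ℕ) (f : ℕ → ℕ → ℂ) :
    (∏ a ∈ Finset.range (m + 1), ∏ b ∈ (Finset.range (m + 1)).erase a, f a b) =
      (∏ a ∈ Finset.range m, ∏ b ∈ (Finset.range m).erase a, f a b) *
        ∏ a ∈ Finset.range m, f m a * f a m := by
  rw [Finset.prod_range_succ, Finset.prod_mul_distrib, mul_comm (∏ a ∈ Finset.range m, f m a),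
    ← mul_assoc, ← Finset.prod_mul_distrib]
  have h1 : (Finset.range (m + 1)).erase m = Finset.range m := by
    rw [Finset.range_add_one, Finset.erase_insert (by simp)]
  rw [h1]
  congr 1
  refine Finset.prod_congr rfl fun a ha => ?_
  have ha' := Finset.mem_range.1 ha
  have h2 : (Finset.range (m + 1)).erase a = insert m ((Finset.range m).erase a) := by
    rw [Finset.range_add_one, Finset.erase_insert_of_ne (by omega)]
  rw [h2, Finset.prod_insert (by simp), mul_comm]

/-- The part of the master function that contains the variables of the extra column together with
the variables that occur in `U_J`. -/
def lastPart {N n : ℕ} (lam : Fin N → ℕ) (J : Fin n → Fin N) (α β : ℕ) (κ : ℂ) (t : ℕ → ℕ → ℂ)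
    (z : Fin n → ℂ) (h : ℂ) : ℂ :=
  (∏ l ∈ Finset.Icc (α + 1) β, ∏ r ∈ Finset.range (unionTo J (l + 1)).card,
    phi κ h (lastVar lam t z l - allVars N t z (l + 1) r)) *
  (∏ l ∈ Finset.Icc (α + 1) β, ∏ r ∈ Finset.range (unionTo J (l - 1)).card,
    phi κ h (allVars N t z (l - 1) r - lastVar lam t z l)) *
  ∏ l ∈ Finset.Icc (α + 1) β, ∏ r ∈ Finset.range (unionTo J l).card,
    (theta κ h (lastVar lam t z l - allVars N t z l r) *
      theta κ h (allVars N t z l r - lastVar lam t z l))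

/-- The part of the master function, apart from the powers, that is unchanged by a simultaneous
shift of the variables of the extra column. -/
def restPart {N n : ℕ} (lam : Fin N → ℕ) (J : Fin n → Fin N) (α β : ℕ) (κ : ℂ) (t : ℕ → ℕ → ℂ)
    (z : Fin n → ℂ) (h : ℂ) : ℂ :=
  ∏ l ∈ Finset.Icc 1 (N - 1),
    ((∏ a ∈ Finset.range (unionTo J l).card, ∏ b ∈ (Finset.range (unionTo J l).card).erase a,
      theta κ h (allVars N t z l a - allVars N t z l b)) *
    (∏ a ∈ Finset.range (unionTo J l).card, ∏ c ∈ Finset.range (unionTo J (l + 1)).card,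
      phi κ h (allVars N t z l a - allVars N t z (l + 1) c)) *
    if l ∈ Finset.Ioc α β ∧ l + 1 ∈ Finset.Ioc α β then
      phi κ h (lastVar lam t z l - lastVar lam t z (l + 1)) else 1)

/-- The master function split according to the way its factors contain the variables of the extra
column. -/
theorem Phi_eq_parts {N n : ℕ} {lam : Fin N → ℕ} {J : Fin n → Fin N} {α β : ℕ}
    (hβ : β < N) (hJ : IsShort lam J α β) (κ : ℂ) (t : ℕ → ℕ → ℂ)
    (z : Fin n → ℂ) (h : ℂ) (ℓ : Fin N → ℂ) :
    Phi lam κ t z h ℓ = (∏ i : Fin N, Complex.exp (ℓ i *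
      ((∑ a ∈ Finset.range (lev lam (i.val + 1)), allVars N t z (i.val + 1) a) / κ))) *
      (restPart lam J α β κ t z h * lastPart lam J α β κ t z h) := by
  rw [Phi]
  congr 1
  set μ : ℕ → ℕ := fun l => (unionTo J l).card with hμ
  have hlev : ∀ l ≤ N, lev lam l = μ l + if l ∈ Finset.Ioc α β then 1 else 0 :=
    fun l hl => (hJ l hl).symm
  have hlast : ∀ l ≤ N, l ∈ Finset.Ioc α β → lastVar lam t z l = allVars N t z l (μ l) := by
    intro l hl hm
    rw [lastVar, hlev l hl, if_pos hm, Nat.add_sub_cancel]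
  have hμ0 : μ 0 = 0 := by simp [hμ, unionTo]
  have hlevel : ∀ l ∈ Finset.Icc 1 (N - 1), (∏ a ∈ Finset.range (lev lam l),
      ((∏ b ∈ (Finset.range (lev lam l)).erase a,
          1 / ((t l a - t l b - h) * phi κ h (t l a - t l b))) *
        ∏ c ∈ Finset.range (lev lam (l + 1)), phi κ h (t l a - allVars N t z (l + 1) c))) =
      ((∏ a ∈ Finset.range (μ l), ∏ b ∈ (Finset.range (μ l)).erase a,
      theta κ h (allVars N t z l a - allVars N t z l b)) *
    (∏ a ∈ Finset.range (μ l), ∏ c ∈ Finset.range (μ (l + 1)),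
      phi κ h (allVars N t z l a - allVars N t z (l + 1) c)) *
    if l ∈ Finset.Ioc α β ∧ l + 1 ∈ Finset.Ioc α β then
      phi κ h (lastVar lam t z l - lastVar lam t z (l + 1)) else 1) *
      ((if l ∈ Finset.Ioc α β then (∏ r ∈ Finset.range (μ (l + 1)),
          phi κ h (lastVar lam t z l - allVars N t z (l + 1) r)) else 1) *
        (if l + 1 ∈ Finset.Ioc α β then (∏ r ∈ Finset.range (μ (l + 1 - 1)),
          phi κ h (allVars N t z (l + 1 - 1) r - lastVar lam t z (l + 1))) else 1) *
        (if l ∈ Finset.Ioc α β then (∏ r ∈ Finset.range (μ l),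
          theta κ h (lastVar lam t z l - allVars N t z l r) *
          theta κ h (allVars N t z l r - lastVar lam t z l)) else 1)) := by
    intro l hl
    have hl' := Finset.mem_Icc.1 hl
    have ht : ∀ a, t l a = allVars N t z l a := fun a => by simp [allVars, show l < N by omega]
    simp only [ht]
    have hth : ∀ x, 1 / ((x - h) * phi κ h x) = theta κ h x := fun x => rfl
    simp only [hth]
    rw [Finset.prod_mul_distrib, hlev l (by omega), hlev (l + 1) (by omega)]
    by_cases h1 : l ∈ Finset.Ioc α β <;> by_cases h2 : l + 1 ∈ Finset.Ioc α β
    · simp only [h1, h2, and_self, if_true]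
      rw [hlast l (by omega) h1, hlast (l + 1) (by omega) h2, prod_offdiag_succ]
      simp only [Finset.prod_range_succ, Finset.prod_mul_distrib, Nat.add_sub_cancel]
      ring
    · simp only [h1, h2, and_false, if_true, if_false, add_zero]
      rw [hlast l (by omega) h1, prod_offdiag_succ]
      simp only [Finset.prod_range_succ, Finset.prod_mul_distrib]
      ring
    · simp only [h1, h2, false_and, if_true, if_false, add_zero]
      rw [hlast (l + 1) (by omega) h2]
      simp only [Finset.prod_range_succ, Finset.prod_mul_distrib, Nat.add_sub_cancel]
      ring
    · simp only [h1, h2, and_self, if_false, add_zero]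
      ring
  rw [Finset.prod_congr rfl hlevel, Finset.prod_mul_distrib, ← restPart]
  congr 1
  have hfilter : ∀ f : ℕ → ℂ, (∏ l ∈ Finset.Icc 1 (N - 1), if l ∈ Finset.Ioc α β then f l else 1) =
      ∏ l ∈ Finset.Icc (α + 1) β, f l := fun f => by
    rw [← Finset.prod_filter, Icc_filter_Ioc hβ]
  rw [Finset.prod_mul_distrib, Finset.prod_mul_distrib, lastPart]
  refine congrArg₂ (· * ·) (congrArg₂ (· * ·) (hfilter _) ?_) (hfilter _)
  exact prod_Icc_pred (α := α) hβ (fun l => ∏ r ∈ Finset.range (μ (l - 1)),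
    phi κ h (allVars N t z (l - 1) r - lastVar lam t z l)) (fun _ => by simp [hμ0])

/-! ### The shift of the extra column -/

/-- The integer vector with entries `1` at the last variables of the levels `α + 1, …, β` and `0`
elsewhere. -/
def lastShift {N : ℕ} (lam : Fin N → ℕ) (α β : ℕ) (j r : ℕ) : ℤ :=
  if j ∈ Finset.Ioc α β ∧ r = lev lam j - 1 then 1 else 0

theorem lev_succ {N : ℕ} (lam : Fin N → ℕ) {l : ℕ} (hl : l < N) :
    lev lam (l + 1) = lev lam l + lam ⟨l, hl⟩ := by
  rw [lev, lev, add_comm (Finset.sum _ _), ← Finset.sum_insert (by simp)]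
  refine Finset.sum_congr ?_ fun _ _ => rfl
  ext k
  simp only [Finset.mem_filter, Finset.mem_univ, true_and, Finset.mem_insert, Fin.ext_iff]
  omega

theorem lastVar_shift {N n : ℕ} {lam : Fin N → ℕ} {α β : ℕ} (hβ : β < N)
    (κ : ℂ) (t : ℕ → ℕ → ℂ) (z : Fin n → ℂ) {l : ℕ} (hl : l ∈ Finset.Ioc α β) :
    lastVar lam (shift κ (lastShift lam α β) t) z l = lastVar lam t z l + κ := by
  have hl' := Finset.mem_Ioc.1 hl
  have hlN : l < N := by omega
  simp [lastVar, allVars, hlN, shift, lastShift, hl]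

theorem allVars_shift {N n : ℕ} {lam : Fin N → ℕ} {J : Fin n → Fin N} {α β : ℕ}
    (hJ : IsShort lam J α β) (κ : ℂ) (t : ℕ → ℕ → ℂ) (z : Fin n → ℂ) {l r : ℕ} (hl : l ≤ N)
    (hr : r < (unionTo J l).card) :
    allVars N (shift κ (lastShift lam α β) t) z l r = allVars N t z l r := by
  by_cases hlN : l < N
  · have h := hJ l hl
    have : lastShift lam α β l r = 0 := by
      rw [lastShift, if_neg]
      rintro ⟨h1, h2⟩
      rw [if_pos h1] at h
      omega
    simp [allVars, hlN, shift, this]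
  · simp [allVars, hlN]

theorem restPart_shift {N n : ℕ} {lam : Fin N → ℕ} {J : Fin n → Fin N} {α β : ℕ} (hβ : β < N)
    (hJ : IsShort lam J α β) (κ : ℂ) (t : ℕ → ℕ → ℂ) (z : Fin n → ℂ) (h : ℂ) :
    restPart lam J α β κ (shift κ (lastShift lam α β) t) z h = restPart lam J α β κ t z h := by
  refine Finset.prod_congr rfl fun l hl => ?_
  have hl' := Finset.mem_Icc.1 hl
  refine congrArg₂ (· * ·) (congrArg₂ (· * ·) ?_ ?_) ?_
  · refine Finset.prod_congr rfl fun a ha => Finset.prod_congr rfl fun b hb => ?_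
    rw [allVars_shift hJ κ t z (by omega) (Finset.mem_range.1 ha),
      allVars_shift hJ κ t z (by omega) (Finset.mem_range.1 (Finset.mem_erase.1 hb).2)]
  · refine Finset.prod_congr rfl fun a ha => Finset.prod_congr rfl fun b hb => ?_
    rw [allVars_shift hJ κ t z (by omega) (Finset.mem_range.1 ha),
      allVars_shift hJ κ t z (by omega) (Finset.mem_range.1 hb)]
  · split_ifs with h1
    · rw [lastVar_shift hβ κ t z h1.1, lastVar_shift hβ κ t z h1.2, add_sub_add_right_eq_sub]
    · rfl

theorem card_le_lev {N n : ℕ} {lam : Fin N → ℕ} {J : Fin n → Fin N} {α β : ℕ}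
    (hJ : IsShort lam J α β) {l : ℕ} (hl : l ≤ N) : (unionTo J l).card ≤ lev lam l := by
  rw [← hJ l hl]; omega

theorem card_lt_lev {N n : ℕ} {lam : Fin N → ℕ} {J : Fin n → Fin N} {α β : ℕ}
    (hJ : IsShort lam J α β) {l : ℕ} (hl : l ≤ N) (hm : l ∈ Finset.Ioc α β) :
    lev lam l - 1 = (unionTo J l).card ∧ (unionTo J l).card < lev lam l := by
  have h := hJ l hl
  rw [if_pos hm] at h
  omega

/-- The shift of the extra column turns `prodA` into `prodB`, up to a sign for every variable of an
adjacent level. -/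
theorem lastPart_shift {N n : ℕ} {lam : Fin N → ℕ} {J : Fin n → Fin N} {α β : Fin N}
    (hα : α < β) (hJ : IsShort lam J α β) {κ : ℂ} (hκ : κ ≠ 0) {t : ℕ → ℕ → ℂ}
    {z : Fin n → ℂ} {h : ℂ} {q : Fin N → ℂ} (hg : Generic lam κ t z h q) :
    lastPart lam J α β κ (shift κ (lastShift lam α β) t) z h *
      prodA lam α β (shift κ (lastShift lam α β) t) z h =
    (∏ l ∈ Finset.Icc (α.val + 1) β, (-1 : ℂ) ^ ((unionTo J (l + 1)).card +
      (unionTo J (l - 1)).card)) * (lastPart lam J α β κ t z h * prodB lam α β t z h) := by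
  have hβ' : β.val < N := β.isLt
  rw [prodA_eq_levels hα hJ, prodB_eq_levels hα hJ, lastPart, lastPart]
  have hIoc : ∀ l ∈ Finset.Icc (α.val + 1) β, l ∈ Finset.Ioc α.val β.val ∧
      l ∈ Finset.Icc 1 (N - 1) ∧ l < N := fun l hl => by
    simp only [Finset.mem_Icc, Finset.mem_Ioc] at hl ⊢
    omega
  have hlt : ∀ l ∈ Finset.Icc (α.val + 1) β, lev lam l - 1 < lev lam l := fun l hl => by
    have := card_lt_lev hJ (hIoc l hl).2.2.le (hIoc l hl).1
    omega
  have hlv : ∀ l ∈ Finset.Icc (α.val + 1) β, lastVar lam t z l = t l (lev lam l - 1) :=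
    fun l hl => by rw [lastVar, allVars, if_pos (hIoc l hl).2.2]
  have g1 : (∏ l ∈ Finset.Icc (α.val + 1) β, ∏ r ∈ Finset.range (unionTo J (l + 1)).card,
      phi κ h (lastVar lam (shift κ (lastShift lam α β) t) z l -
        allVars N (shift κ (lastShift lam α β) t) z (l + 1) r)) *
      (∏ l ∈ Finset.Icc (α.val + 1) β, ∏ r ∈ Finset.range (unionTo J (l + 1)).card,
        (lastVar lam (shift κ (lastShift lam α β) t) z l -
          allVars N (shift κ (lastShift lam α β) t) z (l + 1) r - h)) =
      (∏ l ∈ Finset.Icc (α.val + 1) β, (-1 : ℂ) ^ (unionTo J (l + 1)).card) *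
      ((∏ l ∈ Finset.Icc (α.val + 1) β, ∏ r ∈ Finset.range (unionTo J (l + 1)).card,
        phi κ h (lastVar lam t z l - allVars N t z (l + 1) r)) *
      (∏ l ∈ Finset.Icc (α.val + 1) β, ∏ r ∈ Finset.range (unionTo J (l + 1)).card,
        (lastVar lam t z l - allVars N t z (l + 1) r))) := by
    rw [← Finset.prod_mul_distrib, ← Finset.prod_mul_distrib, ← Finset.prod_mul_distrib]
    refine Finset.prod_congr rfl fun l hl => ?_
    obtain ⟨h1, h2, h3⟩ := hIoc l hl
    conv_rhs => rw [← Finset.card_range (unionTo J (l + 1)).card, ← Finset.prod_const]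
    rw [Finset.card_range, ← Finset.prod_mul_distrib, ← Finset.prod_mul_distrib,
      ← Finset.prod_mul_distrib]
    refine Finset.prod_congr rfl fun r hr => ?_
    rw [lastVar_shift hβ' κ t z h1, allVars_shift hJ κ t z h3 (Finset.mem_range.1 hr),
      add_sub_right_comm]
    have hgen := hg.2.1 l h2 _ (hlt l hl) r
      ((Finset.mem_range.1 hr).trans_le (card_le_lev hJ h3))
    rw [← hlv l hl] at hgen
    have h4 := add_ne_zero_of_not_inLattice hgen.2
    rw [sub_add_eq_add_sub] at h4
    rw [phi_add hκ (ne_zero_of_not_inLattice hgen.1) h4]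
    ring
  have g2 : (∏ l ∈ Finset.Icc (α.val + 1) β, ∏ r ∈ Finset.range (unionTo J (l - 1)).card,
      phi κ h (allVars N (shift κ (lastShift lam α β) t) z (l - 1) r -
        lastVar lam (shift κ (lastShift lam α β) t) z l)) *
      (∏ l ∈ Finset.Icc (α.val + 1) β, ∏ r ∈ Finset.range (unionTo J (l - 1)).card,
        (allVars N (shift κ (lastShift lam α β) t) z (l - 1) r -
          lastVar lam (shift κ (lastShift lam α β) t) z l)) =
      (∏ l ∈ Finset.Icc (α.val + 1) β, (-1 : ℂ) ^ (unionTo J (l - 1)).card) *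
      ((∏ l ∈ Finset.Icc (α.val + 1) β, ∏ r ∈ Finset.range (unionTo J (l - 1)).card,
        phi κ h (allVars N t z (l - 1) r - lastVar lam t z l)) *
      (∏ l ∈ Finset.Icc (α.val + 1) β, ∏ r ∈ Finset.range (unionTo J (l - 1)).card,
        (allVars N t z (l - 1) r - lastVar lam t z l - h))) := by
    rw [← Finset.prod_mul_distrib, ← Finset.prod_mul_distrib, ← Finset.prod_mul_distrib]
    refine Finset.prod_congr rfl fun l hl => ?_
    obtain ⟨h1, h2, h3⟩ := hIoc l hl
    conv_rhs => rw [← Finset.card_range (unionTo J (l - 1)).card, ← Finset.prod_const]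
    rw [Finset.card_range, ← Finset.prod_mul_distrib, ← Finset.prod_mul_distrib,
      ← Finset.prod_mul_distrib]
    refine Finset.prod_congr rfl fun r hr => ?_
    have hr' := Finset.mem_range.1 hr
    have hl2 := Finset.mem_Icc.1 h2
    -- There are no variables at level `0`, so the product over them is empty.
    have hl0 : l - 1 ≠ 0 := fun h0 => by
      rw [h0] at hr'
      simp [unionTo] at hr'
    rw [lastVar_shift hβ' κ t z h1, allVars_shift hJ κ t z (by omega) hr', ← sub_sub]
    have hgen := hg.2.1 (l - 1) (Finset.mem_Icc.2 ⟨by omega, by omega⟩) r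
      (hr'.trans_le (card_le_lev hJ (by omega))) (lev lam l - 1)
    rw [Nat.sub_add_cancel hl2.1] at hgen
    have hgen' := hgen (hlt l hl)
    have e1 : t (l - 1) r = allVars N t z (l - 1) r := by
      rw [allVars, if_pos (by omega)]
    rw [← lastVar, e1] at hgen'
    rw [phi_sub hκ (sub_ne_zero_of_not_inLattice hgen'.1) (ne_zero_of_not_inLattice hgen'.2)]
    ring
  have g3 : (∏ l ∈ Finset.Icc (α.val + 1) β, ∏ r ∈ Finset.range (unionTo J l).card,
      (theta κ h (lastVar lam (shift κ (lastShift lam α β) t) z l -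
          allVars N (shift κ (lastShift lam α β) t) z l r) *
        theta κ h (allVars N (shift κ (lastShift lam α β) t) z l r -
          lastVar lam (shift κ (lastShift lam α β) t) z l))) *
      (∏ l ∈ Finset.Icc (α.val + 1) β, ∏ r ∈ Finset.range (unionTo J l).card,
        ((allVars N (shift κ (lastShift lam α β) t) z l r -
            lastVar lam (shift κ (lastShift lam α β) t) z l - h) /
          (allVars N (shift κ (lastShift lam α β) t) z l r -
            lastVar lam (shift κ (lastShift lam α β) t) z l))) =
      (∏ l ∈ Finset.Icc (α.val + 1) β, ∏ r ∈ Finset.range (unionTo J l).card,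
        (theta κ h (lastVar lam t z l - allVars N t z l r) *
          theta κ h (allVars N t z l r - lastVar lam t z l))) *
      (∏ l ∈ Finset.Icc (α.val + 1) β, ∏ r ∈ Finset.range (unionTo J l).card,
        ((lastVar lam t z l - allVars N t z l r - h) /
          (lastVar lam t z l - allVars N t z l r))) := by
    rw [← Finset.prod_mul_distrib, ← Finset.prod_mul_distrib]
    refine Finset.prod_congr rfl fun l hl => ?_
    obtain ⟨h1, h2, h3⟩ := hIoc l hl
    rw [← Finset.prod_mul_distrib, ← Finset.prod_mul_distrib]
    refine Finset.prod_congr rfl fun r hr => ?_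
    have hr' := Finset.mem_range.1 hr
    have hc := card_lt_lev hJ h3.le h1
    rw [lastVar_shift hβ' κ t z h1, allVars_shift hJ κ t z h3.le hr']
    have hgen := hg.1 l h2 _ (hlt l hl) r (hr'.trans hc.2) (by omega)
    have hgen' := hg.1 l h2 r (hr'.trans hc.2) _ (hlt l hl) (by omega)
    have e1 : t l r = allVars N t z l r := by rw [allVars, if_pos h3]
    rw [← hlv l hl, e1] at hgen hgen'
    set x := lastVar lam t z l - allVars N t z l r with hx
    have e2 : lastVar lam t z l + κ - allVars N t z l r = x + κ := by rw [hx]; ring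
    have e3 : allVars N t z l r - (lastVar lam t z l + κ) = -(x + κ) := by rw [hx]; ring
    have e4 : allVars N t z l r - lastVar lam t z l = -x := by rw [hx]; ring
    rw [e4] at hgen'
    rw [e2, e3, e4]
    exact theta_shift hκ hgen.1 hgen.2 hgen'.2
  simp only [pow_add]
  rw [Finset.prod_mul_distrib (f := fun l => (-1 : ℂ) ^ (unionTo J (l + 1)).card)]
  linear_combination (norm := skip) (congrArg₂ (· * ·) (congrArg₂ (· * ·) g1 g2) g3)
  ring

theorem exp_pi_mul_neg_one_pow (a b : ℕ) :
    Complex.exp (Real.pi * Complex.I * ((a : ℂ) - (b : ℂ))) * (-1) ^ (a + b) = 1 := by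
  rw [mul_sub, Complex.exp_sub, mul_comm _ (a : ℂ), mul_comm _ (b : ℂ), Complex.exp_nat_mul,
    Complex.exp_nat_mul, Complex.exp_pi_mul_I, pow_add]
  have h1 : ((-1 : ℂ) ^ b) ≠ 0 := pow_ne_zero _ (by norm_num)
  rw [div_mul_eq_mul_div, div_eq_iff h1, ← mul_assoc, ← mul_pow]
  norm_num

theorem prod_Icc_div_telescope {f : ℕ → ℂ} {a b : ℕ} (hab : a ≤ b) (hf : ∀ l, f l ≠ 0) :
    ∏ l ∈ Finset.Icc (a + 1) b, f (l - 1) / f l = f a / f b := by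
  induction b, hab using Nat.le_induction with
  | base => simp [hf a]
  | succ b hab ih =>
    rw [Finset.prod_Icc_succ_top (by omega), ih]
    have := hf b
    have := hf (b + 1)
    simp only [Nat.add_sub_cancel]
    field_simp

/-- The parities differ only at the two ends of the range of levels, and the two signs cancel. -/
theorem neg_one_pow_lev {N n : ℕ} {lam : Fin N → ℕ} {J : Fin n → Fin N} {α β : ℕ}
    (hα : α < β) (hβ : β < N) (hJ : IsShort lam J α β) :
    ∏ l ∈ Finset.Icc (α + 1) β, (-1 : ℂ) ^ ((unionTo J (l + 1)).card + (unionTo J (l - 1)).card) =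
      ∏ l ∈ Finset.Icc (α + 1) β, (-1 : ℂ) ^ (lev lam (l + 1) + lev lam (l - 1)) := by
  have h1 : ∀ l ∈ Finset.Icc (α + 1) β, (-1 : ℂ) ^ (lev lam (l + 1) + lev lam (l - 1)) =
      (-1 : ℂ) ^ ((unionTo J (l + 1)).card + (unionTo J (l - 1)).card) *
        ((if l = β then -1 else 1) * (if l = α + 1 then -1 else 1)) := by
    intro l hl
    have hl' := Finset.mem_Icc.1 hl
    rw [← hJ (l + 1) (by omega), ← hJ (l - 1) (by omega)]
    simp only [Finset.mem_Ioc]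
    by_cases hb : l = β <;> by_cases ha : l = α + 1
    · rw [if_neg (by omega), if_neg (by omega), if_pos hb, if_pos ha]; ring
    · rw [if_neg (by omega), if_pos (by omega), if_pos hb, if_neg ha]; ring
    · rw [if_pos (by omega), if_neg (by omega), if_neg hb, if_pos ha]; ring
    · rw [if_pos (by omega), if_pos (by omega), if_neg hb, if_neg ha]; ring
  rw [Finset.prod_congr rfl h1, Finset.prod_mul_distrib, Finset.prod_mul_distrib,
    Finset.prod_ite_eq', Finset.prod_ite_eq', if_pos (Finset.mem_Icc.2 ⟨by omega, le_rfl⟩),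
    if_pos (Finset.mem_Icc.2 ⟨le_rfl, by omega⟩)]
  ring

/-- The shift multiplies the powers in the master function by `powBase` at each level of the extra
column. The exponentials cancel the signs of `lastPart_shift`, and the ratios `q_l / q_{l+1}`
telescope. -/
theorem prod_powBase {N n : ℕ} {lam : Fin N → ℕ} {J : Fin n → Fin N} {α β : Fin N}
    (hα : α < β) (hJ : IsShort lam J α β) {q : Fin N → ℂ} (h0 : ∀ k, q k ≠ 0) :
    (∏ k : Fin N, if k.val + 1 ∈ Finset.Ioc α.val β.val then powBase n lam k q else 1) *
      (∏ l ∈ Finset.Icc (α.val + 1) β, (-1 : ℂ) ^ ((unionTo J (l + 1)).card +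
      (unionTo J (l - 1)).card)) * q β = q α := by
  have hα' : α.val < β.val := hα
  have hβ : β.val < N := β.isLt
  rw [neg_one_pow_lev hα' hβ hJ]
  let f : ℕ → ℂ := fun l => if hl : l < N then q ⟨l, hl⟩ else 1
  have hf : ∀ l, f l ≠ 0 := fun l => by
    simp only [f]; split_ifs
    · exact h0 _
    · exact one_ne_zero
  have hfk : ∀ k : Fin N, f k.val = q k := fun k => by simp [f]
  let g : ℕ → ℂ := fun l => if hl : l - 1 < N then powBase n lam ⟨l - 1, hl⟩ q else 1
  have hg : (∏ k : Fin N, if k.val + 1 ∈ Finset.Ioc α.val β.val then powBase n lam k q else 1) =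
      ∏ l ∈ Finset.Icc (α.val + 1) β, g l := by
    rw [← Finset.prod_filter]
    refine Finset.prod_bij (fun k _ => k.val + 1) ?_ ?_ ?_ ?_
    · intro k hk
      simp only [Finset.mem_filter, Finset.mem_univ, true_and, Finset.mem_Ioc, Finset.mem_Icc]
        at hk ⊢
      omega
    · intro k _ k' _ hkk
      exact Fin.ext (Nat.succ_injective hkk)
    · intro l hl
      have hl' := Finset.mem_Icc.1 hl
      refine ⟨⟨l - 1, by omega⟩, ?_, ?_⟩
      · simp only [Finset.mem_filter, Finset.mem_univ, true_and, Finset.mem_Ioc]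
        omega
      · simp only
        omega
    · intro k _
      simp [g]
  have hgl : ∀ l ∈ Finset.Icc (α.val + 1) β,
      g l * (-1 : ℂ) ^ (lev lam (l + 1) + lev lam (l - 1)) = f (l - 1) / f l := by
    intro l hl
    have hl' := Finset.mem_Icc.1 hl
    obtain ⟨m, rfl⟩ : ∃ m, l = m + 1 := ⟨l - 1, by omega⟩
    have hm : m < N := by omega
    have hm' : m + 1 < N := by omega
    simp only [g, f, Nat.add_sub_cancel, hm, hm', dif_pos, powBase]
    rw [lev_succ lam hm', lev_succ lam hm]
    have e := exp_pi_mul_neg_one_pow (lam ⟨m + 1, hm'⟩) (lam ⟨m, hm⟩)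
    -- The parity of `λ^{(l+1)} + λ^{(l-1)}` is that of the exponent in `powBase`.
    have e2 : (-1 : ℂ) ^ (lev lam m + lam ⟨m, hm⟩ + lam ⟨m + 1, hm'⟩ + lev lam m) =
        (-1) ^ (lam ⟨m + 1, hm'⟩ + lam ⟨m, hm⟩) := by
      rw [show lev lam m + lam ⟨m, hm⟩ + lam ⟨m + 1, hm'⟩ + lev lam m =
        2 * lev lam m + (lam ⟨m + 1, hm'⟩ + lam ⟨m, hm⟩) by ring, pow_add, pow_mul]
      norm_num
    rw [e2, mul_right_comm, e, one_mul]
  rw [hg, ← Finset.prod_mul_distrib, Finset.prod_congr rfl hgl,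
    prod_Icc_div_telescope hα'.le hf, hfk, hfk, div_mul_cancel₀ _ (h0 β)]

theorem exp_shift {N n : ℕ} {lam : Fin N → ℕ} {J : Fin n → Fin N} {α β : ℕ}
    (hβ : β < N) (hJ : IsShort lam J α β) {κ : ℂ} (hκ : κ ≠ 0) (t : ℕ → ℕ → ℂ) (z : Fin n → ℂ)
    (ℓ : Fin N → ℂ) :
    (∏ i : Fin N, Complex.exp (ℓ i * ((∑ a ∈ Finset.range (lev lam (i.val + 1)),
      allVars N (shift κ (lastShift lam α β) t) z (i.val + 1) a) / κ))) =
    (∏ i : Fin N, Complex.exp (ℓ i * ((∑ a ∈ Finset.range (lev lam (i.val + 1)),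
      allVars N t z (i.val + 1) a) / κ))) *
      ∏ i : Fin N, if i.val + 1 ∈ Finset.Ioc α β then Complex.exp (ℓ i) else 1 := by
  rw [← Finset.prod_mul_distrib]
  refine Finset.prod_congr rfl fun i _ => ?_
  have hi : i.val + 1 ≤ N := i.isLt
  have hc := hJ (i.val + 1) hi
  have hsum : ∑ a ∈ Finset.range (unionTo J (i.val + 1)).card,
      allVars N (shift κ (lastShift lam α β) t) z (i.val + 1) a =
      ∑ a ∈ Finset.range (unionTo J (i.val + 1)).card, allVars N t z (i.val + 1) a :=
    Finset.sum_congr rfl fun a ha => allVars_shift hJ κ t z hi (Finset.mem_range.1 ha)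
  by_cases hm : i.val + 1 ∈ Finset.Ioc α β
  · rw [if_pos hm] at hc ⊢
    have hlast := lastVar_shift (lam := lam) hβ κ t z hm
    rw [lastVar, lastVar, ← hc, Nat.add_sub_cancel] at hlast
    rw [← hc, Finset.sum_range_succ, Finset.sum_range_succ, hsum, hlast, ← Complex.exp_add]
    congr 1
    field_simp
    ring
  · rw [if_neg hm] at hc ⊢
    rw [add_zero] at hc
    rw [← hc, hsum, mul_one]

/-- The shift of the extra column turns `Φ_λ · q_β · prodA` into `Φ_λ · q_α · prodB`, in the form in
which the factor `prodA` is shifted with `Φ_λ`. -/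
theorem Phi_shift {N n : ℕ} {lam : Fin N → ℕ} {J : Fin n → Fin N} {α β : Fin N}
    (hα : α < β) (hJ : IsShort lam J α β) {κ : ℂ} (hκ : κ ≠ 0) {t : ℕ → ℕ → ℂ}
    {z : Fin n → ℂ} {h : ℂ} {q : Fin N → ℂ} (hg : Generic lam κ t z h q) {ℓ : Fin N → ℂ}
    (hℓ : ∀ i, Complex.exp (ℓ i) = powBase n lam i q) :
    Phi lam κ (shift κ (lastShift lam α β) t) z h ℓ *
      (q β * prodA lam α β (shift κ (lastShift lam α β) t) z h) =
    Phi lam κ t z h ℓ * (q α * prodB lam α β t z h) := by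
  rw [Phi_eq_parts β.isLt hJ, Phi_eq_parts β.isLt hJ, exp_shift β.isLt hJ hκ,
    restPart_shift β.isLt hJ, ← prod_powBase hα hJ hg.2.2.1]
  simp only [hℓ]
  have := lastPart_shift hα hJ hκ hg
  linear_combination (∏ i : Fin N, Complex.exp (ℓ i * ((∑ a ∈ Finset.range (lev lam (i.val + 1)),
      allVars N t z (i.val + 1) a) / κ))) *
      (∏ i : Fin N, if i.val + 1 ∈ Finset.Ioc α.val β.val then powBase n lam i q else 1) *
      restPart lam J α β κ t z h * q β * this

/-! ### Rational functions of the variables -/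

/-- The function `F` of `(t; z; h; q)` is polynomial in the variables `RatVar N n lam`. -/
def IsPoly {N n : ℕ} (lam : Fin N → ℕ)
    (F : (ℕ → ℕ → ℂ) → (Fin n → ℂ) → ℂ → (Fin N → ℂ) → ℂ) : Prop :=
  ∃ P : MvPolynomial (RatVar N n lam) ℂ,
    ∀ t z h q, F t z h q = MvPolynomial.eval (ratPoint lam t z h q) P

/-- The function `F` of `(t; z; h; q)` agrees with a fraction of polynomials in the variables
`RatVar N n lam` wherever the denominator of that fraction does not vanish. -/
def IsRat {N n : ℕ} (lam : Fin N → ℕ)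
    (F : (ℕ → ℕ → ℂ) → (Fin n → ℂ) → ℂ → (Fin N → ℂ) → ℂ) : Prop :=
  ∃ P Q : MvPolynomial (RatVar N n lam) ℂ, Q ≠ 0 ∧ ∀ t z h q,
    MvPolynomial.eval (ratPoint lam t z h q) Q ≠ 0 →
      F t z h q = MvPolynomial.eval (ratPoint lam t z h q) P /
        MvPolynomial.eval (ratPoint lam t z h q) Q

section Rational

variable {N n : ℕ} {lam : Fin N → ℕ}

theorem IsPoly.sub {F G : (ℕ → ℕ → ℂ) → (Fin n → ℂ) → ℂ → (Fin N → ℂ) → ℂ}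
    (hF : IsPoly lam F) (hG : IsPoly lam G) :
    IsPoly lam (fun t z h q => F t z h q - G t z h q) := by
  obtain ⟨P, hP⟩ := hF
  obtain ⟨P', hP'⟩ := hG
  exact ⟨P - P', fun t z h q => by
    simp only [hP, hP', map_sub]⟩

theorem isPoly_h : IsPoly (n := n) lam (fun _ _ h _ => h) :=
  ⟨MvPolynomial.X (Sum.inr (Sum.inr (Sum.inr ()))), fun t z h q => by simp [ratPoint]⟩

/-- The variable that the permutation `σ` puts in the place `r` of the level `j`. -/
def permVar (n : ℕ) (σ : PermGroup lam) {j r : ℕ} (h1 : 1 ≤ j) (hj : j < N)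
    (hr : r < lev lam j) : RatVar N n lam :=
  Sum.inl ⟨⟨j - 1, by omega⟩, ⟨permIdx lam σ j r,
    by rw [Nat.sub_add_cancel h1]; exact permIdx_lt σ hr⟩⟩

theorem eval_permVar (σ : PermGroup lam) {j r : ℕ} (h1 : 1 ≤ j) (hj : j < N)
    (hr : r < lev lam j) (t : ℕ → ℕ → ℂ) (z : Fin n → ℂ) (h : ℂ) (q : Fin N → ℂ) :
    MvPolynomial.eval (ratPoint lam t z h q) (MvPolynomial.X (permVar n σ h1 hj hr)) =
      allVars N (permute lam σ t) z j r := by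
  rw [allVars_permute, allVars, if_pos hj, MvPolynomial.eval_X]
  simp [permVar, ratPoint, Nat.sub_add_cancel h1]

theorem isPoly_var (σ : PermGroup lam) {j r : ℕ} (hr : r < lev lam j) :
    IsPoly lam (fun t (z : Fin n → ℂ) _ _ => allVars N (permute lam σ t) z j r) := by
  have h1 : 1 ≤ j := by
    rcases Nat.eq_zero_or_pos j with rfl | h
    · simp [lev] at hr
    · exact h
  by_cases hj : j < N
  · exact ⟨_, fun t z h q => (eval_permVar σ h1 hj hr t z h q).symm⟩
  · by_cases hn : r < n
    · exact ⟨MvPolynomial.X (Sum.inr (Sum.inl ⟨r, hn⟩)), fun t z h q => by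
        simp [ratPoint, allVars, hj, hn]⟩
    · exact ⟨0, fun t z h q => by simp [allVars, hj, hn]⟩

theorem IsPoly.isRat {F : (ℕ → ℕ → ℂ) → (Fin n → ℂ) → ℂ → (Fin N → ℂ) → ℂ}
    (hF : IsPoly lam F) : IsRat lam F := by
  obtain ⟨P, hP⟩ := hF
  exact ⟨P, 1, one_ne_zero, fun t z h q _ => by rw [hP, map_one, div_one]⟩

theorem IsRat.mul {F G : (ℕ → ℕ → ℂ) → (Fin n → ℂ) → ℂ → (Fin N → ℂ) → ℂ}
    (hF : IsRat lam F) (hG : IsRat lam G) :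
    IsRat lam (fun t z h q => F t z h q * G t z h q) := by
  obtain ⟨P, Q, hQ, hP⟩ := hF
  obtain ⟨P', Q', hQ', hP'⟩ := hG
  refine ⟨P * P', Q * Q', mul_ne_zero hQ hQ', fun t z h q hne => ?_⟩
  rw [map_mul] at hne
  simp only
  rw [hP t z h q (left_ne_zero_of_mul hne), hP' t z h q (right_ne_zero_of_mul hne), map_mul,
    map_mul, div_mul_div_comm]

theorem isRat_prod {ι : Type*} (s : Finset ι)
    {F : ι → (ℕ → ℕ → ℂ) → (Fin n → ℂ) → ℂ → (Fin N → ℂ) → ℂ}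
    (hF : ∀ i ∈ s, IsRat lam (F i)) : IsRat lam (fun t z h q => ∏ i ∈ s, F i t z h q) := by
  classical
  induction s using Finset.induction_on with
  | empty => exact ⟨1, 1, one_ne_zero, fun t z h q _ => by simp⟩
  | insert a s ha ih =>
    simp only [Finset.prod_insert ha]
    exact (hF a (Finset.mem_insert_self a s)).mul
      (ih fun i hi => hF i (Finset.mem_insert_of_mem hi))

theorem isRat_ratio (σ : PermGroup lam) {j r r' : ℕ} (h1 : 1 ≤ j) (hj : j < N)
    (hr : r < lev lam j) (hr' : r' < lev lam j) (hne : r ≠ r') :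
    IsRat lam (fun t (z : Fin n → ℂ) h _ =>
      (allVars N (permute lam σ t) z j r - allVars N (permute lam σ t) z j r' - h) /
        (allVars N (permute lam σ t) z j r - allVars N (permute lam σ t) z j r')) := by
  obtain ⟨P, hP⟩ := ((isPoly_var (n := n) σ hr).sub (isPoly_var σ hr')).sub isPoly_h
  refine ⟨P, MvPolynomial.X (permVar n σ h1 hj hr) - MvPolynomial.X (permVar n σ h1 hj hr'),
    sub_ne_zero.2 fun h => hne ?_, fun t z h q _ => ?_⟩
  · have h2 := MvPolynomial.X_injective h
    simp only [permVar, Sum.inl.injEq, Sigma.mk.injEq, heq_eq_eq, true_and, Fin.mk.injEq] at h2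
    exact permIdx_injective σ j h2
  · rw [map_sub, eval_permVar, eval_permVar, ← hP t z h q]

theorem isRat_div_sub {α β : Fin N} (hα : α ≠ β) :
    IsRat (n := n) lam (fun _ _ _ q => q β / (q β - q α)) := by
  refine ⟨MvPolynomial.X (Sum.inr (Sum.inr (Sum.inl β))),
    MvPolynomial.X (Sum.inr (Sum.inr (Sum.inl β))) - MvPolynomial.X (Sum.inr (Sum.inr (Sum.inl α))),
    sub_ne_zero.2 fun h => hα ?_, fun t z h q _ => by simp [ratPoint]⟩
  have h2 := MvPolynomial.X_injective h
  simpa using h2.symm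

theorem isRat_U {J : Fin n → Fin N} {α β : ℕ} (hJ : IsShort lam J α β) (σ : PermGroup lam) :
    IsRat lam (fun t z h _ => U J (permute lam σ t) z h) := by
  refine isRat_prod _ fun j hj => isRat_prod _ fun a _ => ?_
  have hj' := Finset.mem_Icc.1 hj
  have hv : ∀ l ≤ N, ∀ r : Fin (unionTo J l).card, r.val < lev lam l := fun l hl r =>
    r.isLt.trans_le (card_le_lev hJ hl)
  have hjN : j < N := by omega
  refine IsRat.mul (IsRat.mul ?_ ?_) ?_
  · exact isRat_prod _ fun c _ =>
      ((isPoly_var σ (hv j hjN.le a)).sub (isPoly_var σ (hv (j + 1) hjN c))).isRat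
  · exact isRat_prod _ fun c _ =>
      (((isPoly_var σ (hv j hjN.le a)).sub (isPoly_var σ (hv (j + 1) hjN c))).sub isPoly_h).isRat
  · refine isRat_prod _ fun b hb => ?_
    have hab : b.val ≠ a.val := fun h => (Finset.mem_filter.1 hb).2.ne' (Fin.ext h)
    have := isRat_ratio (n := n) σ hj'.1 hjN (hv j hjN.le b) (hv j hjN.le a) hab
    simpa only [allVars, if_pos hjN] using this

theorem isRat_prodA {J : Fin n → Fin N} {α β : Fin N} (hα : α < β) (hJ : IsShort lam J α β)
    (σ : PermGroup lam) :
    IsRat lam (fun t (z : Fin n → ℂ) h _ => prodA lam α β (permute lam σ t) z h) := by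
  have hβ : β.val < N := β.isLt
  simp only [prodA_eq_levels hα hJ]
  have hv : ∀ l ≤ N, ∀ r ∈ Finset.range (unionTo J l).card, r < lev lam l := fun l hl r hr =>
    (Finset.mem_range.1 hr).trans_le (card_le_lev hJ hl)
  have hs : ∀ l ∈ Finset.Icc (α.val + 1) β.val, l ≤ N ∧ 1 ≤ l ∧ l < N ∧
      lev lam l - 1 = (unionTo J l).card ∧ lev lam l - 1 < lev lam l := fun l hl => by
    have hl' := Finset.mem_Icc.1 hl
    have := card_lt_lev hJ (l := l) (by omega) (Finset.mem_Ioc.2 (by omega))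
    omega
  refine IsRat.mul (IsRat.mul ?_ ?_) ?_
  · refine isRat_prod _ fun l hl => isRat_prod _ fun r hr => ?_
    obtain ⟨h1, h2, h3, h4, h5⟩ := hs l hl
    exact (((isPoly_var σ h5).sub (isPoly_var σ (hv (l + 1) h3 r hr))).sub isPoly_h).isRat
  · refine isRat_prod _ fun l hl => isRat_prod _ fun r hr => ?_
    obtain ⟨h1, h2, h3, h4, h5⟩ := hs l hl
    exact ((isPoly_var σ (hv (l - 1) (by omega) r hr)).sub (isPoly_var σ h5)).isRat
  · refine isRat_prod _ fun l hl => isRat_prod _ fun r hr => ?_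
    obtain ⟨h1, h2, h3, h4, h5⟩ := hs l hl
    have hr' := Finset.mem_range.1 hr
    exact isRat_ratio σ h2 h3 (hv l h1 r hr) h5 (by omega)

end Rational

/-! ### Discrete differentials -/

section Differentials

variable {N n : ℕ} {lam : Fin N → ℕ} {κ : ℂ}

/-- A single difference of a rational function is a discrete differential. -/
theorem isDiscreteDifferential_of_isRat (w : ℕ → ℕ → ℤ)
    {f D : (ℕ → ℕ → ℂ) → (Fin n → ℂ) → ℂ → (Fin N → ℂ) → ℂ} (hf : IsRat lam f)
    (hD : ∀ t z h q, Generic lam κ t z h q → ∀ ℓ : Fin N → ℂ,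
      (∀ i, Complex.exp (ℓ i) = powBase n lam i q) →
      D t z h q = Phi lam κ (shift κ w t) z h ℓ / Phi lam κ t z h ℓ * f (shift κ w t) z h q -
        f t z h q) :
    IsDiscreteDifferential lam κ D := by
  obtain ⟨P, Q, hQ, hP⟩ := hf
  refine ⟨1, fun _ => w, fun _ => P, fun _ => Q, fun _ => hQ, fun t z h q hg hne ℓ hℓ => ?_⟩
  rw [Fin.sum_univ_one, hD t z h q hg ℓ hℓ, hP _ _ _ _ (hne 0).1, hP _ _ _ _ (hne 0).2]

theorem isDiscreteDifferential_zero :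
    IsDiscreteDifferential (n := n) lam κ (fun _ _ _ _ => 0) :=
  ⟨0, fun s => s.elim0, fun s => s.elim0, fun s => s.elim0, fun s => s.elim0,
    fun t z h q _ _ ℓ _ => by simp⟩

theorem IsDiscreteDifferential.add
    {F G : (ℕ → ℕ → ℂ) → (Fin n → ℂ) → ℂ → (Fin N → ℂ) → ℂ}
    (hF : IsDiscreteDifferential lam κ F) (hG : IsDiscreteDifferential lam κ G) :
    IsDiscreteDifferential lam κ (fun t z h q => F t z h q + G t z h q) := by
  obtain ⟨r, w, P, Q, hQ, hF⟩ := hF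
  obtain ⟨r', w', P', Q', hQ', hG⟩ := hG
  refine ⟨r + r', Fin.append w w', Fin.append P P', Fin.append Q Q', fun s => ?_,
    fun t z h q hg hne ℓ hℓ => ?_⟩
  · refine Fin.addCases (fun s => ?_) (fun s => ?_) s
    · rw [Fin.append_left]; exact hQ s
    · rw [Fin.append_right]; exact hQ' s
  · simp only
    rw [Fin.sum_univ_add,
      hF t z h q hg (fun s => by simpa using hne (Fin.castAdd r' s)) ℓ hℓ,
      hG t z h q hg (fun s => by simpa using hne (Fin.natAdd r s)) ℓ hℓ]
    simp only [Fin.append_left, Fin.append_right]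

theorem IsDiscreteDifferential.neg
    {F : (ℕ → ℕ → ℂ) → (Fin n → ℂ) → ℂ → (Fin N → ℂ) → ℂ}
    (hF : IsDiscreteDifferential lam κ F) :
    IsDiscreteDifferential lam κ (fun t z h q => -F t z h q) := by
  obtain ⟨r, w, P, Q, hQ, hF⟩ := hF
  refine ⟨r, w, fun s => -P s, Q, hQ, fun t z h q hg hne ℓ hℓ => ?_⟩
  simp only
  rw [hF t z h q hg hne ℓ hℓ, ← Finset.sum_neg_distrib]
  refine Finset.sum_congr rfl fun s _ => ?_
  rw [map_neg, map_neg]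
  ring

theorem isDiscreteDifferential_sum {ι : Type*} (s : Finset ι)
    {F : ι → (ℕ → ℕ → ℂ) → (Fin n → ℂ) → ℂ → (Fin N → ℂ) → ℂ}
    (hF : ∀ i ∈ s, IsDiscreteDifferential lam κ (F i)) :
    IsDiscreteDifferential lam κ (fun t z h q => ∑ i ∈ s, F i t z h q) := by
  classical
  induction s using Finset.induction_on with
  | empty => simpa using isDiscreteDifferential_zero
  | insert a s ha ih =>
    simp only [Finset.sum_insert ha]
    exact (hF a (Finset.mem_insert_self a s)).add
      (ih fun i hi => hF i (Finset.mem_insert_of_mem hi))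

/-- A permutation of the variables turns a shift into the shift by the permuted vector. -/
theorem permute_shift (σ : PermGroup lam) (w : ℕ → ℕ → ℤ) (t : ℕ → ℕ → ℂ) :
    permute lam σ (shift κ (fun j r => w j (permIdx lam σ⁻¹ j r)) t) =
      shift κ w (permute lam σ t) := by
  funext j r
  rw [permute_apply, shift, shift, permute_apply, ← permIdx_mul, inv_mul_cancel, permIdx_one]

/-- The function `U_J` does not contain the variables of the extra column. -/
theorem U_shift {J : Fin n → Fin N} {α β : ℕ} (hJ : IsShort lam J α β) (t : ℕ → ℕ → ℂ)
    (z : Fin n → ℂ) (h : ℂ) :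
    U J (shift κ (lastShift lam α β) t) z h = U J t z h := by
  rw [U_eq_V, U_eq_V]
  refine V_congr J h fun a i hi => allVars_shift hJ κ t z ?_ (rank_lt ?_)
  · exact (Finset.mem_Icc.1 (supp_subset J a hi)).2
  · rw [mem_unionTo]
    exact (Finset.mem_Ioc.1 hi).1

theorem isDiscreteDifferential_dU (hκ : κ ≠ 0) {J : Fin n → Fin N} {α β : Fin N} (hα : α < β)
    (hJ : IsShort lam J α β) :
    IsDiscreteDifferential lam κ (fun t z h q => dU lam α β J t z h q) := by
  simp only [dU, sym]
  refine isDiscreteDifferential_sum _ fun σ _ => ?_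
  refine isDiscreteDifferential_of_isRat
    (fun j r => lastShift lam α β j (permIdx lam σ⁻¹ j r))
    (((isRat_U hJ σ).mul (isRat_div_sub hα.ne)).mul (isRat_prodA hα hJ σ))
    fun t z h q hg ℓ hℓ => ?_
  have hΦ := Phi_ne_zero hκ hg ℓ
  have hq : q α - q β ≠ 0 := sub_ne_zero.2 fun h => hα.ne (hg.2.2.2 h)
  have hq' : q β - q α ≠ 0 := sub_ne_zero.2 fun h => hα.ne' (hg.2.2.2 h)
  have key := Phi_shift hα hJ hκ (hg.permute σ) hℓ
  rw [← permute_shift, Phi_permute, Phi_permute] at key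
  have hU := U_shift (κ := κ) hJ (permute lam σ t) z h
  rw [← permute_shift] at hU
  rw [hU]
  -- The remaining identity is algebraic in the values of `prodA`, `prodB` and the master function.
  generalize prodA lam α β (permute lam σ (shift κ _ t)) z h = A' at key ⊢
  generalize Phi lam κ (shift κ _ t) z h ℓ = Φ' at key ⊢
  generalize prodB lam α β (permute lam σ t) z h = B at key ⊢
  have e : q α * B = Φ' / Phi lam κ t z h ℓ * (q β * A') := by
    field_simp
    linear_combination -key
  rw [e, ← neg_sub (q β) (q α)]
  field_simp
  ring

theorem isDiscreteDifferential_D (hκ : κ ≠ 0) {I : Fin n → Fin N} (hI : I ∈ parts n lam)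
    (i : Fin N) : IsDiscreteDifferential lam κ (fun t z h q => D lam I i t z h q) := by
  simp only [D, sub_eq_add_neg]
  refine IsDiscreteDifferential.add ?_ (IsDiscreteDifferential.neg ?_)
  · refine isDiscreteDifferential_sum _ fun j hj => isDiscreteDifferential_sum _ fun p hp => ?_
    obtain rfl := (Finset.mem_filter.1 hp).2
    have hlt := (Finset.mem_filter.1 hj).2
    exact isDiscreteDifferential_dU hκ hlt (isShort_update hI hlt)
  · refine isDiscreteDifferential_sum _ fun j hj => isDiscreteDifferential_sum _ fun p hp => ?_
    obtain rfl := (Finset.mem_filter.1 hp).2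
    have hlt := (Finset.mem_filter.1 hj).2
    exact isDiscreteDifferential_dU hκ hlt (isShort_update hI hlt)

end Differentials

end

end DynConn

/-- The first part is the formula for the dynamical connection applied to
`Ω_λ Φ_λ W_λ`, for all holomorphic branches of the powers of `q` on an open set `O` and all values
of `t, z, h` where the (rational) weight functions are defined. The second part says that the
`D_{I,i}` are discrete differentials. -/
theorem theorem8p1 {N n : ℕ} (lam : Fin N → ℕ) (hlam : ∑ k, lam k = n) (κ : ℂ) (hκ : κ ≠ 0)
    (i : Fin N) :
    (∀ (h : ℂ) (z : Fin n → ℂ) (t : ℕ → ℕ → ℂ),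
      (∀ j ∈ Finset.Icc 1 (N - 1), ∀ a < DynConn.lev lam j, ∀ b < DynConn.lev lam j,
        a ≠ b → t j a ≠ t j b) →
      ∀ O : Set (Fin N → ℂ), IsOpen O →
        (∀ q ∈ O, (∀ k, q k ≠ 0) ∧ Function.Injective q) →
      ∀ (L : (Fin N → ℂ) → Fin N → ℂ) (M : (Fin N → ℂ) → Fin N → Fin N → ℂ),
        (∀ k, DynConn.IsLogBranch O (DynConn.powBase n lam k) (fun q => L q k)) →
        (∀ k l, k < l → DynConn.IsLogBranch O (fun q => 1 - q l / q k) (fun q => M q k l)) →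
      ∀ q ∈ O, ∃ G : DynConn.TensorSpace N n,
        DynConn.HasPartialDeriv i
          (fun q' => (DynConn.Omega lam κ h (M q') * DynConn.Phi lam κ t z h (L q')) •
            DynConn.Wvec n lam t z h) G q ∧
        (κ * q i) • G - DynConn.X i z h q
            ((DynConn.Omega lam κ h (M q) * DynConn.Phi lam κ t z h (L q)) •
              DynConn.Wvec n lam t z h) =
          (DynConn.Omega lam κ h (M q) * DynConn.Phi lam κ t z h (L q)) •
            ∑ I ∈ DynConn.parts n lam, DynConn.D lam I i t z h q • DynConn.basisVec I) ∧
    ∀ I ∈ DynConn.parts n lam,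
      DynConn.IsDiscreteDifferential lam κ (fun t z h q => DynConn.D lam I i t z h q) := by
  exact ⟨fun h z t ht O hO hO' L M hL hM q hq =>
    DynConn.dynamical_equation lam hκ i h z ht hO hL hM hq (hO' q hq).1 (hO' q hq).2,
    fun I hI => DynConn.isDiscreteDifferential_D hκ hI i⟩
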